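/- Let $M$ be a complex manifold and $E\to M$ a holomorphic vector bundle of finite rank, and let $\mathcal O_{\Lambda E}$ be the sheaf of holomorphic sections of $\Lambda E$. For $k\ge 1$ let $Der_{2k}(\Lambda E)$ be the sheaf of $\mathbb C$-linear derivations $u$ of $\mathcal O_{\Lambda E}$ with $u(\mathcal O_{\Lambda^jE})\subset\mathcal O_{\Lambda^{j+2k}E}$ for all $j\ge 0$, and let $Der^{(2)}(\Lambda E)=\bigoplus_{k\ge1}Der_{2k}(\Lambda E)$. Let $G_E$ be the sheaf of groups of automorphisms $\varphi$ of the sheaf of algebras $\mathcal O_{\Lambda E}$ with $(\varphi-Id)(\mathcal O_{\Lambda^jE})\subset\bigoplus_{k\ge1}\mathcal O_{\Lambda^{j+2k}E}$ for all $j\ge 0$. Let $C^p(M,\cdot)$ denote Čech cochains, either for a fixed open cover of $M$ or in the direct limit over all open covers of $M$ under refinement (realised by the covers $(U_x)_{x\in M}$ with $x\in U_x$), and let $H^1(M,\cdot)$ be the corresponding Čech cohomology; cocycles in $Z^1(M,G_E)$ satisfy $(\mathbf d g)_{ijk}:=g_{ij}g_{jk}g_{ki}=Id$, and $g,g'$ are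 cohomologous if $g'_{ij}=h_ig_{ij}h_j^{-1}$ with $h\in C^0(M,G_E)$. Additively, $(dv)_{ij}=v_i-v_j$ and $(du)_{ijk}=u_{ij}+u_{jk}+u_{ki}$. Let $pr_{2k}$ be the projection of endomorphisms to their component of degree $2k$, and $pr_{(2k)}=pr_2+pr_4+\dots+pr_{2k}$. Put $$\tilde C^1=\{u\in C^1(M,Der^{(2)}(\Lambda E)) : \exp(u)\in Z^1(M,G_E)\}$$ and, for $q\ge2$, $R_{2q}(u)=pr_{2q}\big(\mathbf d\exp(pr_{(2q-2)}u)\big)$. For $v\in C^0(M,Der^{(2)}(\Lambda E))$ write $(\exp(v).\exp(u))_{ij}=\exp(v_i)\exp(u_{ij})\exp(-v_j)$, $\lambda(v,u)=\log(\exp(v).\exp(u))$ and $F_{2q}(v,u)=pr_{(2q)}\big(\exp(pr_{(2q-2)}v).\exp(pr_{(2q-2)}u)\big)$, and let $H^0(M,Aut(E))$ (holomorphic automorphisms of $E$ over $Id_M$) act on cochains by $\varphi.u=\varphi u\varphi^{-1}$. A choice of $D$ consists of maps, for $q\ge 2$, $$D_{2q}:H^0(M,Aut(E))\times C^0(M,Der^{(2)}(\Lambda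 E))\times\tilde C^1\to C^1(M,Der_{2q}(\Lambda E))$$ such that $D'_{2q}(u):=D_{2q}(Id,0,u)$ depends only on $pr_{(2q-2)}(u)$ and satisfies $dD'_{2q}(u)=R_{2q}(u)$ for all $u\in\tilde C^1$, and such that for all $\varphi,v,u$ one has $\varphi.\lambda(v,u)\in\tilde C^1$ and $$\varphi.D_{2q}(\varphi,v,u)=D_{2q}(Id,0,\varphi.\lambda(v,u))+pr_{2q}\log\big(Id+F_{2q}(\varphi.v,\varphi.u)\big);$$ put $D=\sum_{q\ge2}D_{2q}$ (a finite sum, since $Der_{2q}(\Lambda E)=0$ for large $q$). Suppose that $H^0(M,Der^{(2)}(\Lambda E))=0$. Then there is a choice of $D$ such that $$\sigma_D:H^1(M,G_E)\to H^1(M,Der^{(2)}(\Lambda E)),\qquad \sigma_D([\exp(u)])=[D(Id,0,u)+u]\quad(u\in\tilde C^1)$$ is well defined (every class in $H^1(M,G_E)$ is of the form $[\exp(u)]$ with $u\in\tilde C^1$, each $D(Id,0,u)+u$ is a cocycle, and its class depends only on $[\exp(u)]$) and injective. This holds both for the cohomology of every fixed open cover of $M$ and for the direct limit over all covers. -/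

import Mathlib

open Bundle Manifold ContDiff TopologicalSpace

noncomputable section

namespace SplitSuper

/-! ### Exponential and logarithm of nilpotent elements -/

section ExpLog

variable {A : Type*} [Ring A] [Algebra ℂ A]

/-- The finite exponential series of a nilpotent element. -/
def nilExp (a : A) : A :=
  ∑ n ∈ Finset.range (nilpotencyClass a), ((n.factorial : ℂ)⁻¹) • a ^ n

/-- The finite logarithmic series `log (1 + a) = a - a² / 2 + a³ / 3 - ⋯` of a nilpotent `a`. -/
def nilLogOneAdd (a : A) : A :=
  ∑ n ∈ Finset.range (nilpotencyClass a), ((-1 : ℂ) ^ (n + 1) / (n : ℂ)) • a ^ n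

end ExpLog

/-! ### Grading of the exterior algebra -/

section Ext

variable {V W : Type*} [AddCommGroup V] [Module ℂ V] [AddCommGroup W] [Module ℂ W]

lemma map_mem_exteriorPower (f : V →ₗ[ℂ] W) (j : ℕ) {a : ExteriorAlgebra ℂ V}
    (ha : a ∈ ⋀[ℂ]^j V) : ExteriorAlgebra.map f a ∈ ⋀[ℂ]^j W := by
  have h : (⋀[ℂ]^j V).map (ExteriorAlgebra.map f).toLinearMap ≤ ⋀[ℂ]^j W := by
    unfold ExteriorAlgebra.exteriorPower
    rw [Submodule.map_pow]
    refine pow_le_pow_left' ?_ j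
    rintro _ ⟨_, ⟨v, rfl⟩, rfl⟩
    exact ⟨f v, by simp⟩
  exact h ⟨a, ha, rfl⟩

/-- The projection of the exterior algebra onto its component of degree `j`. -/
def extProj (V : Type*) [AddCommGroup V] [Module ℂ V] (j : ℕ) :
    ExteriorAlgebra ℂ V →ₗ[ℂ] ExteriorAlgebra ℂ V :=
  GradedAlgebra.proj (fun i : ℕ => ⋀[ℂ]^i V) j

lemma extProj_of_mem {j : ℕ} {a : ExteriorAlgebra ℂ V} (ha : a ∈ ⋀[ℂ]^j V) :
    extProj V j a = a :=
  DirectSum.decompose_of_mem_same (fun i : ℕ => ⋀[ℂ]^i V) ha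

lemma extProj_of_mem_ne {i j : ℕ} {a : ExteriorAlgebra ℂ V} (ha : a ∈ ⋀[ℂ]^i V) (h : i ≠ j) :
    extProj V j a = 0 :=
  DirectSum.decompose_of_mem_ne (fun i : ℕ => ⋀[ℂ]^i V) ha h

lemma map_extProj (f : V →ₗ[ℂ] W) (j : ℕ) (a : ExteriorAlgebra ℂ V) :
    ExteriorAlgebra.map f (extProj V j a) = extProj W j (ExteriorAlgebra.map f a) := by
  induction a using DirectSum.Decomposition.inductionOn (fun i : ℕ => ⋀[ℂ]^i V) with
  | zero => simp
  | add a b ha hb => simp only [map_add, ha, hb]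
  | @homogeneous i a =>
    have hfa := map_mem_exteriorPower f i a.2
    by_cases hij : i = j
    · subst hij
      rw [extProj_of_mem a.2, extProj_of_mem hfa]
    · rw [extProj_of_mem_ne a.2 hij, extProj_of_mem_ne hfa hij, map_zero]

lemma exteriorPower_eq_bot [FiniteDimensional ℂ V] {j : ℕ} (hj : Module.finrank ℂ V < j) :
    (⋀[ℂ]^j V) = ⊥ := by
  have h := exteriorPower.finrank_eq (R := ℂ) (M := V) (n := j)
  rw [Nat.choose_eq_zero_of_lt hj] at h
  exact Submodule.finrank_eq_zero.mp h

instance [FiniteDimensional ℂ V] : FiniteDimensional ℂ (ExteriorAlgebra ℂ V) := by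
  classical
  let b := Module.finBasis ℂ V
  exact Module.Finite.of_basis b.ExteriorAlgebra

end Ext

/-! ### The sheaf of holomorphic sections of the exterior bundle -/

section Sheaf

variable (B : Type*) [NormedAddCommGroup B] [NormedSpace ℂ B]
  {M : Type*} [TopologicalSpace M] [ChartedSpace B M]
  (F : Type*) [NormedAddCommGroup F] [NormedSpace ℂ F] [FiniteDimensional ℂ F]
  (E : M → Type*) [TopologicalSpace (TotalSpace F E)]
  [∀ x, AddCommGroup (E x)] [∀ x, Module ℂ (E x)] [∀ x, TopologicalSpace (E x)]
  [FiberBundle F E] [VectorBundle ℂ F E]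

/-- The value at `x` of a section of `ΛE`, read in the local trivialization of `E` at `x₀`. -/
def localRep {U : Opens M} (s : ∀ x : U, ExteriorAlgebra ℂ (E x)) (x₀ : M) (x : U) :
    ExteriorAlgebra ℂ F :=
  ExteriorAlgebra.map ((trivializationAt F E x₀).linearMapAt ℂ (x : M)) (s x)

/-- A section of `ΛE` over `U` is holomorphic if near every point its coordinates, with respect to
the local trivialization of `E` there, are holomorphic functions. -/
def IsHolomorphic {U : Opens M} (s : ∀ x : U, ExteriorAlgebra ℂ (E x)) : Prop :=
  ∀ (x₀ : U) (ℓ : Module.Dual ℂ (ExteriorAlgebra ℂ F)),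
    ContMDiffAt 𝓘(ℂ, B) 𝓘(ℂ, ℂ) ω (fun x : U => ℓ (localRep F E s (x₀ : M) x)) x₀

/-- The subalgebra of holomorphic sections in the algebra of all sections of `ΛE` over `U`. -/
def secAlg (U : Opens M) : Subalgebra ℂ (∀ x : U, ExteriorAlgebra ℂ (E x)) where
  carrier := {s | IsHolomorphic B F E s}
  mul_mem' := by
    intro s t hs ht x₀ ℓ
    let b := Module.finBasis ℂ (ExteriorAlgebra ℂ F)
    have key : ∀ a c : ExteriorAlgebra ℂ F,
        ℓ (a * c) = ∑ i, ∑ j, b.coord i a * b.coord j c * ℓ (b i * b j) := by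
      intro a c
      conv_lhs => rw [← b.sum_repr a, ← b.sum_repr c]
      simp only [Finset.sum_mul, Finset.mul_sum, map_sum, smul_mul_smul_comm, map_smul,
        smul_eq_mul, Module.Basis.coord_apply]
      rw [Finset.sum_comm]
    have h2 : (fun x : U => ℓ (localRep F E (s * t) (x₀ : M) x)) = fun x : U =>
        ∑ i, ∑ j, b.coord i (localRep F E s (x₀ : M) x) * b.coord j (localRep F E t (x₀ : M) x)
          * ℓ (b i * b j) := by
      funext x
      rw [← key]
      simp [localRep]
    rw [h2]
    exact ContMDiffAt.sum fun i _ => ContMDiffAt.sum fun j _ =>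
      ((hs x₀ (b.coord i)).mul (ht x₀ (b.coord j))).mul contMDiffAt_const
  add_mem' := by
    intro s t hs ht x₀ ℓ
    have h2 : (fun x : U => ℓ (localRep F E (s + t) (x₀ : M) x)) = fun x : U =>
        ℓ (localRep F E s (x₀ : M) x) + ℓ (localRep F E t (x₀ : M) x) := by
      funext x
      simp [localRep]
    rw [h2]
    exact (hs x₀ ℓ).add (ht x₀ ℓ)
  algebraMap_mem' := by
    intro r x₀ ℓ
    have h2 : (fun x : U => ℓ (localRep F E
        (algebraMap ℂ (∀ x : U, ExteriorAlgebra ℂ (E x)) r) (x₀ : M) x)) = fun _ =>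
        ℓ (algebraMap ℂ _ r) := by
      funext x
      simp [localRep]
    rw [h2]
    exact contMDiffAt_const

/-- `𝒪_{ΛE}(U)`: the algebra of holomorphic sections of `ΛE` over `U`. -/
def Sec (U : Opens M) : Type _ := secAlg B F E U

instance (U : Opens M) : Ring (Sec B F E U) := inferInstanceAs (Ring (secAlg B F E U))

instance (U : Opens M) : Algebra ℂ (Sec B F E U) := inferInstanceAs (Algebra ℂ (secAlg B F E U))

variable {B F E} in
/-- The value of a section at a point. -/
def Sec.val {U : Opens M} (s : Sec B F E U) (x : U) : ExteriorAlgebra ℂ (E x) := s.1 x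

/-- Restriction of sections. -/
def secRes {U V : Opens M} (h : V ≤ U) : Sec B F E U →ₐ[ℂ] Sec B F E V where
  toFun s := ⟨fun x => s.1 ⟨x, h x.2⟩, fun x₀ ℓ =>
    ContMDiffAt.comp (M := V) (M' := U) (I := 𝓘(ℂ, B)) (I' := 𝓘(ℂ, B)) (f := Set.inclusion h)
      (g := fun x : U => ℓ (localRep F E s.1 (x₀ : M) x)) x₀
      (s.2 ⟨x₀, h x₀.2⟩ ℓ) (contMDiff_inclusion h x₀)⟩
  map_one' := rfl
  map_mul' _ _ := rfl
  map_zero' := rfl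
  map_add' _ _ := rfl
  commutes' _ := rfl

/-- `𝒪_{Λ^j E}(U)`, as a subspace of `𝒪_{ΛE}(U)`. -/
def secDeg (j : ℕ) (U : Opens M) : Submodule ℂ (Sec B F E U) where
  carrier := {s | ∀ x : U, s.val x ∈ ⋀[ℂ]^j (E x)}
  add_mem' hs ht x := Submodule.add_mem _ (hs x) (ht x)
  zero_mem' _ := Submodule.zero_mem _
  smul_mem' c _ hs x := Submodule.smul_mem _ c (hs x)

/-- The projection `𝒪_{ΛE}(U) → 𝒪_{Λ^j E}(U)`. -/
def secProj (j : ℕ) (U : Opens M) : Sec B F E U →ₗ[ℂ] Sec B F E U where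
  toFun s := ⟨fun x => extProj (E x) j (s.1 x), by
    intro x₀ ℓ
    have h := s.2 x₀ (ℓ ∘ₗ extProj F j)
    simpa only [localRep, map_extProj, LinearMap.comp_apply] using h⟩
  map_add' s t := Subtype.ext (funext fun x => map_add (extProj (E x) j) (s.1 x) (t.1 x))
  map_smul' c s := Subtype.ext (funext fun x => map_smul (extProj (E x) j) c (s.1 x))

lemma secDeg_eq_bot {j : ℕ} (hj : Module.finrank ℂ F < j) (U : Opens M) :
    secDeg B F E j U = ⊥ := by
  rw [eq_bot_iff]
  intro s hs
  have h0 : ∀ x : U, s.1 x = 0 := by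
    intro x
    let e := ((trivializationAt F E (x : M)).continuousLinearEquivAt ℂ (x : M)
      (FiberBundle.mem_baseSet_trivializationAt F E (x : M))).toLinearEquiv
    have : FiniteDimensional ℂ (E x) := e.symm.finiteDimensional
    have hx := hs x
    rw [exteriorPower_eq_bot (by rwa [e.finrank_eq])] at hx
    exact hx
  exact Subtype.ext (funext h0)


/-! ### Endomorphisms, derivations and automorphisms of `𝒪_{ΛE}` -/

/-- The families of linear
endomorphisms of `𝒪_{ΛE}(V)`, `V ⊆ U`, commuting with restrictions. -/
def sheafEndAlg (U : Opens M) : Subalgebra ℂ (∀ V : Set.Iic U, Module.End ℂ (Sec B F E V.1)) where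
  carrier := {f | ∀ (V W : Set.Iic U) (h : W.1 ≤ V.1) (a : Sec B F E V.1),
    secRes B F E h (f V a) = f W (secRes B F E h a)}
  mul_mem' := by
    intro f g hf hg V W h a
    simp only [Pi.mul_apply, Module.End.mul_apply]
    rw [hf V W h, hg V W h]
  add_mem' := by
    intro f g hf hg V W h a
    simp only [Pi.add_apply, LinearMap.add_apply, map_add]
    rw [hf V W h, hg V W h]
  algebraMap_mem' := by
    intro r V W h a
    simp [Algebra.algebraMap_eq_smul_one]

/-- The algebra of `ℂ`-linear endomorphisms of the sheaf `𝒪_{ΛE}|_U`. -/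
def SheafEnd (U : Opens M) : Type _ := sheafEndAlg B F E U

instance (U : Opens M) : Ring (SheafEnd B F E U) := inferInstanceAs (Ring (sheafEndAlg B F E U))

instance (U : Opens M) : Algebra ℂ (SheafEnd B F E U) :=
  inferInstanceAs (Algebra ℂ (sheafEndAlg B F E U))

variable {B F E} in
/-- The action of a sheaf endomorphism on the sections over `V ⊆ U`. -/
def SheafEnd.app {U : Opens M} (f : SheafEnd B F E U) (V : Set.Iic U) :
    Module.End ℂ (Sec B F E V.1) := f.1 V

/-- Restriction of sheaf endomorphisms. -/
def endRes {U V : Opens M} (h : V ≤ U) : SheafEnd B F E U →ₐ[ℂ] SheafEnd B F E V where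
  toFun f := ⟨fun W => f.1 ⟨W.1, le_trans W.2 h⟩, fun W W' hW a =>
    f.2 ⟨W.1, le_trans W.2 h⟩ ⟨W'.1, le_trans W'.2 h⟩ hW a⟩
  map_one' := rfl
  map_mul' _ _ := rfl
  map_zero' := rfl
  map_add' _ _ := rfl
  commutes' _ := rfl

/-- The component of degree `2k` of an endomorphism `T` of `𝒪_{ΛE}(U)`: it maps `a` to
`∑ j, (T a_j)_{j + 2k}`, where `a_j` is the component of degree `j` of `a`. -/
def degPart (k : ℕ) (U : Opens M) (T : Module.End ℂ (Sec B F E U)) : Module.End ℂ (Sec B F E U) :=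
  ∑ j ∈ Finset.range (Module.finrank ℂ F + 1), secProj B F E (j + 2 * k) U * T * secProj B F E j U

/-- `pr_{2k}`: the component of degree `2k` of a sheaf endomorphism. -/
def endPr (k : ℕ) (U : Opens M) : SheafEnd B F E U →ₗ[ℂ] SheafEnd B F E U where
  toFun f := ⟨fun V => degPart B F E k V.1 (f.app V), by
    intro V W h a
    simp only [degPart, LinearMap.sum_apply, map_sum, Module.End.mul_apply]
    refine Finset.sum_congr rfl fun j _ => ?_
    have h1 : ∀ (i : ℕ) (b : Sec B F E V.1),
        secRes B F E h (secProj B F E i V.1 b) = secProj B F E i W.1 (secRes B F E h b) :=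
      fun _ _ => rfl
    have h2 : ∀ b : Sec B F E V.1,
        secRes B F E h (f.app V b) = f.app W (secRes B F E h b) := f.2 V W h
    rw [h1, h2, h1]⟩
  map_add' f g := by
    have h : ∀ (V : Set.Iic U) (S T : Module.End ℂ (Sec B F E V.1)),
        degPart B F E k V.1 (S + T) = degPart B F E k V.1 S + degPart B F E k V.1 T := by
      intro V S T
      simp [degPart, mul_add, add_mul, Finset.sum_add_distrib]
    exact Subtype.ext (funext fun V => h V (f.app V) (g.app V))
  map_smul' c f := by
    have h : ∀ (V : Set.Iic U) (T : Module.End ℂ (Sec B F E V.1)),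
        degPart B F E k V.1 (c • T) = c • degPart B F E k V.1 T := by
      intro V T
      simp [degPart, Finset.smul_sum]
    exact Subtype.ext (funext fun V => h V (f.app V))

/-- `Der_{2k}(ΛE)(U)`: the `ℂ`-linear derivations of `𝒪_{ΛE}|_U` raising the degree by `2k`. -/
def derDeg (k : ℕ) (U : Opens M) : Submodule ℂ (SheafEnd B F E U) where
  carrier := {f | (∀ (V : Set.Iic U) (a b : Sec B F E V.1),
      f.app V (a * b) = f.app V a * b + a * f.app V b) ∧
    ∀ (V : Set.Iic U) (j : ℕ), ∀ a ∈ secDeg B F E j V.1, f.app V a ∈ secDeg B F E (j + 2 * k) V.1}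
  add_mem' := by
    rintro f g ⟨hf, hf'⟩ ⟨hg, hg'⟩
    refine ⟨fun V a b => ?_, fun V j a ha => Submodule.add_mem _ (hf' V j a ha) (hg' V j a ha)⟩
    change f.app V (a * b) + g.app V (a * b) = (f.app V a + g.app V a) * b + a * (f.app V b + g.app V b)
    rw [hf, hg, add_mul, mul_add]
    abel
  zero_mem' := ⟨fun V a b => by
    change (0 : Sec B F E V.1) = 0 * b + a * 0
    rw [zero_mul, mul_zero, add_zero], fun V j a _ => Submodule.zero_mem _⟩
  smul_mem' := by
    rintro c f ⟨hf, hf'⟩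
    refine ⟨fun V a b => ?_, fun V j a ha => Submodule.smul_mem _ c (hf' V j a ha)⟩
    change c • f.app V (a * b) = (c • f.app V a) * b + a * (c • f.app V b)
    rw [hf, smul_add, smul_mul_assoc, mul_smul_comm]

/-- `Der^{(2)}(ΛE)(U) = ⨁_{k ≥ 1} Der_{2k}(ΛE)(U)`. -/
def derPos (U : Opens M) : Submodule ℂ (SheafEnd B F E U) :=
  ⨆ k : ℕ, ⨆ _ : 1 ≤ k, derDeg B F E k U

/-- `⨁_{k ≥ 1} 𝒪_{Λ^{j + 2k} E}(U)`. -/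
def secAbove (j : ℕ) (U : Opens M) : Submodule ℂ (Sec B F E U) :=
  ⨆ k : ℕ, ⨆ _ : 1 ≤ k, secDeg B F E (j + 2 * k) U

lemma secDeg_le_secAbove {j k : ℕ} (hk : 1 ≤ k) (U : Opens M) :
    secDeg B F E (j + 2 * k) U ≤ secAbove B F E j U :=
  le_iSup₂_of_le (f := fun k (_ : 1 ≤ k) => secDeg B F E (j + 2 * k) U) k hk le_rfl

lemma secAbove_le (j k : ℕ) (U : Opens M) :
    secAbove B F E (j + 2 * k) U ≤ secAbove B F E j U := by
  refine iSup₂_le fun l hl => ?_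
  rw [add_assoc, ← mul_add]
  exact secDeg_le_secAbove B F E (by omega) U

/-- `G_E(U)`: the algebra automorphisms `φ` of `𝒪_{ΛE}|_U` such that `φ - Id` maps
`𝒪_{Λ^j E}` to `⨁_{k ≥ 1} 𝒪_{Λ^{j + 2k} E}` for all `j`. -/
def autG (U : Opens M) : Subgroup (SheafEnd B F E U)ˣ where
  carrier := {φ | (∀ (V : Set.Iic U) (a b : Sec B F E V.1),
      φ.1.app V (a * b) = φ.1.app V a * φ.1.app V b) ∧
    ∀ (V : Set.Iic U) (j : ℕ), ∀ a ∈ secDeg B F E j V.1,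
      φ.1.app V a - a ∈ secAbove B F E j V.1}
  one_mem' := ⟨fun V a b => rfl, fun V j a _ => by
    change a - a ∈ _
    rw [sub_self]
    exact Submodule.zero_mem _⟩
  mul_mem' := by
    rintro φ ψ ⟨hφ, hφ'⟩ ⟨hψ, hψ'⟩
    refine ⟨fun V a b => ?_, fun V j a ha => ?_⟩
    · change φ.1.app V (ψ.1.app V (a * b)) = φ.1.app V (ψ.1.app V a) * φ.1.app V (ψ.1.app V b)
      rw [hψ, hφ]
    · change φ.1.app V (ψ.1.app V a) - a ∈ _
      have key : secAbove B F E j V.1 ≤ (secAbove B F E j V.1).comap (φ.1.app V) := by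
        refine iSup₂_le fun k hk b hb => ?_
        have h1 := Submodule.add_mem _ (secAbove_le B F E j k V.1 (hφ' V _ b hb))
          (secDeg_le_secAbove B F E hk V.1 hb)
        rwa [sub_add_cancel] at h1
      have h2 := Submodule.add_mem (secAbove B F E j V.1) (key (hψ' V j a ha)) (hφ' V j a ha)
      have h3 : φ.1.app V (ψ.1.app V a) - a = φ.1.app V (ψ.1.app V a - a) + (φ.1.app V a - a) := by
        rw [map_sub]; abel
      rw [h3]
      exact h2
  inv_mem' := by
    rintro φ ⟨hφ, hφ'⟩
    have hl : ∀ (V : Set.Iic U) (a : Sec B F E V.1), (φ⁻¹).1.app V (φ.1.app V a) = a := fun V a =>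
      congrArg (fun f : SheafEnd B F E U => f.app V a) φ.inv_mul
    have hr : ∀ (V : Set.Iic U) (a : Sec B F E V.1), φ.1.app V ((φ⁻¹).1.app V a) = a := fun V a =>
      congrArg (fun f : SheafEnd B F E U => f.app V a) φ.mul_inv
    refine ⟨fun V a b => ?_, fun V j => ?_⟩
    · conv_lhs => rw [← hr V a, ← hr V b, ← hφ, hl]
    · by_cases hj : Module.finrank ℂ F < j
      · intro a ha
        rw [secDeg_eq_bot B F E hj] at ha
        rw [(Submodule.mem_bot ℂ).mp ha, map_zero, sub_zero]
        exact Submodule.zero_mem _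
      · induction hn : Module.finrank ℂ F + 1 - j using Nat.strong_induction_on generalizing j with
        | _ n ih =>
          intro a ha
          have key : secAbove B F E j V.1 ≤ (secAbove B F E j V.1).comap ((φ⁻¹).1.app V) := by
            refine iSup₂_le fun k hk b hb => ?_
            by_cases hjk : Module.finrank ℂ F < j + 2 * k
            · rw [secDeg_eq_bot B F E hjk] at hb
              rw [(Submodule.mem_bot ℂ).mp hb]
              exact Submodule.zero_mem _
            · have h1 := Submodule.add_mem _
                (secAbove_le B F E j k V.1 (ih _ (by omega) (j + 2 * k) hjk rfl b hb))
                (secDeg_le_secAbove B F E hk V.1 hb)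
              rwa [sub_add_cancel] at h1
          have h2 := Submodule.neg_mem (secAbove B F E j V.1) (key (hφ' V j a ha))
          have h3 : (φ⁻¹).1.app V a - a = -((φ⁻¹).1.app V (φ.1.app V a - a)) := by
            rw [map_sub, hl]; abel
          rw [h3]
          exact h2

/-- The automorphisms of the vector bundle `E|_U` over the identity, in the form of the induced
automorphisms of `𝒪_{ΛE}|_U`: the automorphisms that preserve every `𝒪_{Λ^j E}` and are the
identity on `𝒪_M = 𝒪_{Λ^0 E}`. -/
def autE (U : Opens M) : Subgroup (SheafEnd B F E U)ˣ where
  carrier := {φ | (∀ (V : Set.Iic U) (a b : Sec B F E V.1),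
      φ.1.app V (a * b) = φ.1.app V a * φ.1.app V b) ∧
    (∀ (V : Set.Iic U) (j : ℕ) (a : Sec B F E V.1),
      φ.1.app V a ∈ secDeg B F E j V.1 ↔ a ∈ secDeg B F E j V.1) ∧
    ∀ (V : Set.Iic U), ∀ a ∈ secDeg B F E 0 V.1, φ.1.app V a = a}
  one_mem' := ⟨fun V a b => rfl, fun V j a => Iff.rfl, fun V a _ => rfl⟩
  mul_mem' := by
    rintro φ ψ ⟨hφ, hφ', hφ''⟩ ⟨hψ, hψ', hψ''⟩
    refine ⟨fun V a b => ?_, fun V j a => ?_, fun V a ha => ?_⟩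
    · change φ.1.app V (ψ.1.app V (a * b)) = φ.1.app V (ψ.1.app V a) * φ.1.app V (ψ.1.app V b)
      rw [hψ, hφ]
    · exact (hφ' V j (ψ.1.app V a)).trans (hψ' V j a)
    · change φ.1.app V (ψ.1.app V a) = a
      rw [hψ'' V a ha, hφ'' V a ha]
  inv_mem' := by
    rintro φ ⟨hφ, hφ', hφ''⟩
    have hl : ∀ (V : Set.Iic U) (a : Sec B F E V.1), (φ⁻¹).1.app V (φ.1.app V a) = a := fun V a =>
      congrArg (fun f : SheafEnd B F E U => f.app V a) φ.inv_mul
    have hr : ∀ (V : Set.Iic U) (a : Sec B F E V.1), φ.1.app V ((φ⁻¹).1.app V a) = a := fun V a =>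
      congrArg (fun f : SheafEnd B F E U => f.app V a) φ.mul_inv
    refine ⟨fun V a b => ?_, fun V j a => ?_, fun V a ha => ?_⟩
    · conv_lhs => rw [← hr V a, ← hr V b, ← hφ, hl]
    · rw [← hφ' V j, hr]
    · conv_lhs => rw [← hφ'' V a ha, hl]

/-! ### Čech cochains -/

/-- The intersection `𝒰 (s 0) ∩ ⋯ ∩ 𝒰 (s p)`. -/
def inter {ι : Type*} (𝒰 : ι → Opens M) {p : ℕ} (s : Fin (p + 1) → ι) : Opens M :=
  Finset.univ.inf fun k => 𝒰 (s k)

lemma inter_mono {ι : Type*} {𝒰 𝒱 : ι → Opens M} (h : 𝒱 ≤ 𝒰) {p : ℕ} (s : Fin (p + 1) → ι) :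
    inter 𝒱 s ≤ inter 𝒰 s :=
  Finset.inf_mono_fun fun k _ => h (s k)

lemma inter_comp_le {ι : Type*} (𝒰 : ι → Opens M) {p q : ℕ} (a : Fin (p + 1) → Fin (q + 1))
    (s : Fin (q + 1) → ι) : inter 𝒰 s ≤ inter 𝒰 (s ∘ a) :=
  Finset.le_inf fun k _ => Finset.inf_le (f := fun k => 𝒰 (s k)) (Finset.mem_univ (a k))

section FixedCover

variable {ι : Type*} (𝒰 : ι → Opens M)

/-- The algebra `C^p(𝒰, End(ΛE))` of Čech `p`-cochains for the open cover `𝒰`. -/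
abbrev CochAt (p : ℕ) : Type _ := ∀ s : Fin (p + 1) → ι, SheafEnd B F E (inter 𝒰 s)

/-- The pullback along `a`: for `a = ![1, 2]` it maps `(u_{ij})` to the `2`-cochain with
component `u_{jk}` on `U_i ∩ U_j ∩ U_k`. -/
def pullAt {p q : ℕ} (a : Fin (p + 1) → Fin (q + 1)) :
    CochAt B F E 𝒰 p →ₐ[ℂ] CochAt B F E 𝒰 q :=
  AlgHom.pi fun s => (endRes B F E (inter_comp_le 𝒰 a s)).comp (Pi.evalAlgHom ℂ _ (s ∘ a))

/-- A global endomorphism as a cochain. -/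
def constAt (p : ℕ) : SheafEnd B F E (⊤ : Opens M) →ₐ[ℂ] CochAt B F E 𝒰 p :=
  AlgHom.pi fun _ => endRes B F E le_top

/-- `pr_{2k}` on cochains. -/
def prAt (k p : ℕ) : CochAt B F E 𝒰 p →ₗ[ℂ] CochAt B F E 𝒰 p :=
  LinearMap.pi fun s => endPr B F E k (inter 𝒰 s) ∘ₗ LinearMap.proj s

/-- `C^p(𝒰, Der_{2k}(ΛE))`. -/
def derDegAt (k p : ℕ) : Submodule ℂ (CochAt B F E 𝒰 p) :=
  Submodule.pi Set.univ fun s => derDeg B F E k (inter 𝒰 s)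

/-- `C^p(𝒰, Der^{(2)}(ΛE))`. -/
def derPosAt (p : ℕ) : Submodule ℂ (CochAt B F E 𝒰 p) :=
  Submodule.pi Set.univ fun s => derPos B F E (inter 𝒰 s)

/-- `C^p(𝒰, G_E)`. -/
def autGAt (p : ℕ) : Subgroup (CochAt B F E 𝒰 p)ˣ :=
  ⨅ s, (autG B F E (inter 𝒰 s)).comap
    (Units.map (Pi.evalMonoidHom (fun s => SheafEnd B F E (inter 𝒰 s)) s))

/-- Refinement of cochains to a finer cover with the same index set. -/
def refine {𝒰 𝒱 : ι → Opens M} (h : 𝒱 ≤ 𝒰) (p : ℕ) :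
    CochAt B F E 𝒰 p →ₐ[ℂ] CochAt B F E 𝒱 p :=
  AlgHom.pi fun s => (endRes B F E (inter_mono h s)).comp (Pi.evalAlgHom ℂ _ s)

end FixedCover

end Sheaf

/-- A nonempty family of open covers of `M` with a common index set, any two of which have a
common refinement in the family. Čech cochains are taken in the direct limit over the family. -/
structure CoverSystem (M : Type*) [TopologicalSpace M] where
  /-- the common index set -/
  ι : Type*
  /-- the covers of the family -/
  covers : Set (ι → Opens M)
  isCover : ∀ 𝒰 ∈ covers, ⨆ i, 𝒰 i = ⊤
  nonempty : covers.Nonempty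
  directed : ∀ 𝒰 ∈ covers, ∀ 𝒱 ∈ covers, ∃ 𝒲 ∈ covers, 𝒲 ≤ 𝒰 ∧ 𝒲 ≤ 𝒱

namespace CoverSystem

variable {M : Type*} [TopologicalSpace M]

/-- The family consisting of a single cover, for the Čech cohomology of this cover. -/
def single {ι : Type*} (𝒰 : ι → Opens M) (h : ⨆ i, 𝒰 i = ⊤) : CoverSystem M where
  ι := ι
  covers := {𝒰}
  isCover := fun 𝒱 h' => by rw [Set.mem_singleton_iff.mp h']; exact h
  nonempty := ⟨𝒰, rfl⟩
  directed := fun _ h₁ _ h₂ => ⟨𝒰, rfl, (Set.mem_singleton_iff.mp h₁).ge,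
    (Set.mem_singleton_iff.mp h₂).ge⟩

variable (M) in
/-- The family of all covers `(U_x)_{x ∈ M}` with `x ∈ U_x`, for the Čech cohomology of `M`:
every open cover is refined by a cover of this form. -/
def all : CoverSystem M where
  ι := M
  covers := {𝒰 | ∀ x, x ∈ 𝒰 x}
  isCover := fun _ h => eq_top_iff.mpr fun x _ => Opens.mem_iSup.mpr ⟨x, h x⟩
  nonempty := ⟨fun _ => ⊤, fun _ => trivial⟩
  directed := fun 𝒰 h 𝒱 h' => ⟨𝒰 ⊓ 𝒱, fun x => ⟨h x, h' x⟩, inf_le_left, inf_le_right⟩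

/-- The covers of the family, directed by refinement: finer covers are larger. -/
abbrev Idx (𝒮 : CoverSystem M) : Type _ := (𝒮.covers)ᵒᵈ

/-- The cover belonging to an index. -/
abbrev cover (𝒮 : CoverSystem M) (i : 𝒮.Idx) : 𝒮.ι → Opens M := (OrderDual.ofDual i).1

instance (𝒮 : CoverSystem M) : Nonempty 𝒮.Idx := ⟨OrderDual.toDual ⟨_, 𝒮.nonempty.some_mem⟩⟩

instance (𝒮 : CoverSystem M) : IsDirectedOrder 𝒮.Idx where
  directed i j := by
    obtain ⟨𝒲, h, h1, h2⟩ := 𝒮.directed _ (OrderDual.ofDual i).2 _ (OrderDual.ofDual j).2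
    exact ⟨OrderDual.toDual ⟨𝒲, h⟩, h1, h2⟩

end CoverSystem

/-! ### Čech cohomology and the maps `D`, `σ_D` -/

section Cohomology

variable (B : Type*) [NormedAddCommGroup B] [NormedSpace ℂ B]
  {M : Type*} [TopologicalSpace M] [ChartedSpace B M]
  (F : Type*) [NormedAddCommGroup F] [NormedSpace ℂ F] [FiniteDimensional ℂ F]
  (E : M → Type*) [TopologicalSpace (TotalSpace F E)]
  [∀ x, AddCommGroup (E x)] [∀ x, Module ℂ (E x)] [∀ x, TopologicalSpace (E x)]
  [FiberBundle F E] [VectorBundle ℂ F E] (𝒮 : CoverSystem M)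

/-- The transition maps of the direct system of cochains. -/
def refineIdx (p : ℕ) (i j : 𝒮.Idx) (h : i ≤ j) :
    CochAt B F E (𝒮.cover i) p →ₐ[ℂ] CochAt B F E (𝒮.cover j) p :=
  refine B F E (𝒰 := 𝒮.cover i) (𝒱 := 𝒮.cover j) h p

instance (p : ℕ) : DirectedSystem (fun i : 𝒮.Idx => CochAt B F E (𝒮.cover i) p)
    (refineIdx B F E 𝒮 p · · ·) where
  map_self _ _ := rfl
  map_map _ _ _ _ _ _ := rfl

/-- The algebra `C^p(M, End(ΛE))` of Čech `p`-cochains. -/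
def Coch (p : ℕ) : Type _ :=
  DirectLimit (fun i : 𝒮.Idx => CochAt B F E (𝒮.cover i) p) (refineIdx B F E 𝒮 p)

instance (p : ℕ) : Ring (Coch B F E 𝒮 p) := inferInstanceAs (Ring (DirectLimit _ _))

instance (p : ℕ) : Algebra ℂ (Coch B F E 𝒮 p) := inferInstanceAs (Algebra ℂ (DirectLimit _ _))

/-- The cochain represented by a cochain for one of the covers. -/
def toCoch (i : 𝒮.Idx) (p : ℕ) : CochAt B F E (𝒮.cover i) p →ₐ[ℂ] Coch B F E 𝒮 p where
  toFun u := ⟦⟨i, u⟩⟧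
  map_one' := (DirectLimit.one_def i).symm
  map_mul' _ _ := (DirectLimit.mul_def ..).symm
  map_zero' := (DirectLimit.zero_def i).symm
  map_add' _ _ := (DirectLimit.add_def ..).symm
  commutes' r := (DirectLimit.algebraMap_def i r).symm

lemma toCoch_refine {i j : 𝒮.Idx} (h : i ≤ j) (p : ℕ) (u : CochAt B F E (𝒮.cover i) p) :
    toCoch B F E 𝒮 j p (refineIdx B F E 𝒮 p i j h u) = toCoch B F E 𝒮 i p u :=
  (DirectLimit.eq_of_le (f := refineIdx B F E 𝒮 p)
    (⟨i, u⟩ : Σ i : 𝒮.Idx, CochAt B F E (𝒮.cover i) p) j h).symm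

lemma exists_toCoch₂ {p : ℕ} (x y : Coch B F E 𝒮 p) :
    ∃ i u v, x = toCoch B F E 𝒮 i p u ∧ y = toCoch B F E 𝒮 i p v :=
  DirectLimit.exists_eq_mk₂ (f := refineIdx B F E 𝒮 p) x y

lemma pullAt_refineIdx {p q : ℕ} (a : Fin (p + 1) → Fin (q + 1)) (i j : 𝒮.Idx) (h : i ≤ j)
    (u : CochAt B F E (𝒮.cover i) p) :
    refineIdx B F E 𝒮 q i j h (pullAt B F E (𝒮.cover i) a u) =
      pullAt B F E (𝒮.cover j) a (refineIdx B F E 𝒮 p i j h u) :=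
  rfl

lemma prAt_refineIdx (k p : ℕ) (i j : 𝒮.Idx) (h : i ≤ j) (u : CochAt B F E (𝒮.cover i) p) :
    refineIdx B F E 𝒮 p i j h (prAt B F E (𝒮.cover i) k p u) =
      prAt B F E (𝒮.cover j) k p (refineIdx B F E 𝒮 p i j h u) :=
  rfl

/-- The map underlying `pull`. -/
def pullFun {p q : ℕ} (a : Fin (p + 1) → Fin (q + 1)) : Coch B F E 𝒮 p → Coch B F E 𝒮 q :=
  DirectLimit.map (refineIdx B F E 𝒮 p) (refineIdx B F E 𝒮 q)
    (fun i u => pullAt B F E (𝒮.cover i) a u) (pullAt_refineIdx B F E 𝒮 a)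

lemma pullFun_toCoch {p q : ℕ} (a : Fin (p + 1) → Fin (q + 1)) (i : 𝒮.Idx)
    (u : CochAt B F E (𝒮.cover i) p) :
    pullFun B F E 𝒮 a (toCoch B F E 𝒮 i p u) = toCoch B F E 𝒮 i q (pullAt B F E (𝒮.cover i) a u) :=
  rfl

/-- Pullback of cochains along `a`, as in `pullAt`. -/
def pull {p q : ℕ} (a : Fin (p + 1) → Fin (q + 1)) : Coch B F E 𝒮 p →ₐ[ℂ] Coch B F E 𝒮 q where
  toFun := pullFun B F E 𝒮 a
  map_one' := by
    let i : 𝒮.Idx := Classical.arbitrary _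
    rw [← map_one (toCoch B F E 𝒮 i p), pullFun_toCoch, map_one, map_one]
  map_zero' := by
    let i : 𝒮.Idx := Classical.arbitrary _
    rw [← map_zero (toCoch B F E 𝒮 i p), pullFun_toCoch, map_zero, map_zero]
  map_mul' x y := by
    obtain ⟨i, u, v, rfl, rfl⟩ := exists_toCoch₂ B F E 𝒮 x y
    rw [← map_mul, pullFun_toCoch, pullFun_toCoch, pullFun_toCoch, map_mul, map_mul]
  map_add' x y := by
    obtain ⟨i, u, v, rfl, rfl⟩ := exists_toCoch₂ B F E 𝒮 x y
    rw [← map_add, pullFun_toCoch, pullFun_toCoch, pullFun_toCoch, map_add, map_add]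
  commutes' r := by
    let i : 𝒮.Idx := Classical.arbitrary _
    rw [← (toCoch B F E 𝒮 i p).commutes, pullFun_toCoch, AlgHom.commutes, AlgHom.commutes]

/-- A global endomorphism as a cochain. -/
def constCoch (p : ℕ) : SheafEnd B F E (⊤ : Opens M) →ₐ[ℂ] Coch B F E 𝒮 p :=
  (toCoch B F E 𝒮 (Classical.arbitrary _) p).comp (constAt B F E _ p)

/-- The map underlying `pr`. -/
def prFun (k p : ℕ) : Coch B F E 𝒮 p → Coch B F E 𝒮 p :=
  DirectLimit.map (refineIdx B F E 𝒮 p) (refineIdx B F E 𝒮 p)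
    (fun i u => prAt B F E (𝒮.cover i) k p u) (prAt_refineIdx B F E 𝒮 k p)

lemma prFun_toCoch (k p : ℕ) (i : 𝒮.Idx) (u : CochAt B F E (𝒮.cover i) p) :
    prFun B F E 𝒮 k p (toCoch B F E 𝒮 i p u) =
      toCoch B F E 𝒮 i p (prAt B F E (𝒮.cover i) k p u) :=
  rfl

/-- `pr_{2k}` on cochains. -/
def pr (k : ℕ) {p : ℕ} : Coch B F E 𝒮 p →ₗ[ℂ] Coch B F E 𝒮 p where
  toFun := prFun B F E 𝒮 k p
  map_add' x y := by
    obtain ⟨i, u, v, rfl, rfl⟩ := exists_toCoch₂ B F E 𝒮 x y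
    rw [← map_add, prFun_toCoch, prFun_toCoch, prFun_toCoch, map_add, map_add]
  map_smul' c x := by
    obtain ⟨i, u, v, rfl, -⟩ := exists_toCoch₂ B F E 𝒮 x x
    rw [← map_smul, prFun_toCoch, prFun_toCoch, map_smul, map_smul, RingHom.id_apply]

/-- `pr_{(2k)} = pr_2 + pr_4 + ⋯ + pr_{2k}` on cochains. -/
def prLE (k : ℕ) {p : ℕ} : Coch B F E 𝒮 p →ₗ[ℂ] Coch B F E 𝒮 p :=
  ∑ l ∈ Finset.Icc 1 k, pr B F E 𝒮 l

/-- `C^p(M, Der_{2k}(ΛE))`. -/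
def CDer (k p : ℕ) : Submodule ℂ (Coch B F E 𝒮 p) :=
  ⨆ i : 𝒮.Idx, (derDegAt B F E (𝒮.cover i) k p).map (toCoch B F E 𝒮 i p).toLinearMap

/-- `C^p(M, Der^{(2)}(ΛE))`. -/
def CDerPos (p : ℕ) : Submodule ℂ (Coch B F E 𝒮 p) :=
  ⨆ i : 𝒮.Idx, (derPosAt B F E (𝒮.cover i) p).map (toCoch B F E 𝒮 i p).toLinearMap

/-- `C^p(M, G_E)`. -/
def CG (p : ℕ) : Subgroup (Coch B F E 𝒮 p)ˣ :=
  ⨆ i : 𝒮.Idx, (autGAt B F E (𝒮.cover i) p).map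
    (Units.map (toCoch B F E 𝒮 i p : CochAt B F E (𝒮.cover i) p →* Coch B F E 𝒮 p))

/-- The additive coboundary `(dv)_{ij} = v_i - v_j`. -/
def d0 : Coch B F E 𝒮 0 →ₗ[ℂ] Coch B F E 𝒮 1 :=
  (pull B F E 𝒮 ![0]).toLinearMap - (pull B F E 𝒮 ![1]).toLinearMap

/-- The additive coboundary `(du)_{ijk} = u_{ij} + u_{jk} + u_{ki}`. -/
def d1 : Coch B F E 𝒮 1 →ₗ[ℂ] Coch B F E 𝒮 2 :=
  (pull B F E 𝒮 ![0, 1]).toLinearMap + (pull B F E 𝒮 ![1, 2]).toLinearMap +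
    (pull B F E 𝒮 ![2, 0]).toLinearMap

/-- The multiplicative coboundary `(𝐝g)_{ijk} = g_{ij} g_{jk} g_{ki}`. -/
def mulD (g : Coch B F E 𝒮 1) : Coch B F E 𝒮 2 :=
  pull B F E 𝒮 ![0, 1] g * pull B F E 𝒮 ![1, 2] g * pull B F E 𝒮 ![2, 0] g

/-- `Z^1(M, Der^{(2)}(ΛE))`. -/
def ZDer : Submodule ℂ (Coch B F E 𝒮 1) :=
  CDerPos B F E 𝒮 1 ⊓ LinearMap.ker (d1 B F E 𝒮)

/-- `B^1(M, Der^{(2)}(ΛE))`. -/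
def BDer : Submodule ℂ (Coch B F E 𝒮 1) :=
  (CDerPos B F E 𝒮 0).map (d0 B F E 𝒮)

/-- `H^1(M, Der^{(2)}(ΛE)) = Z^1 / B^1`. -/
abbrev HDer : Type _ := ZDer B F E 𝒮 ⧸ (BDer B F E 𝒮).submoduleOf (ZDer B F E 𝒮)

/-- `Z^1(M, G_E)`. -/
def ZG : Type _ :=
  {g : (Coch B F E 𝒮 1)ˣ // g ∈ CG B F E 𝒮 1 ∧ mulD B F E 𝒮 (g : Coch B F E 𝒮 1) = 1}

/-- Pullback of units along `a`. -/
def pullUnits {p q : ℕ} (a : Fin (p + 1) → Fin (q + 1)) :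
    (Coch B F E 𝒮 p)ˣ →* (Coch B F E 𝒮 q)ˣ :=
  Units.map (pull B F E 𝒮 a : Coch B F E 𝒮 p →* Coch B F E 𝒮 q)

/-- Two cocycles `g`, `g'` are cohomologous if `g'_{ij} = h_i g_{ij} h_j⁻¹` for some
`h ∈ C^0(M, G_E)`. -/
instance cohomologous : Setoid (ZG B F E 𝒮) where
  r g g' := ∃ h ∈ CG B F E 𝒮 0,
    g'.1 = pullUnits B F E 𝒮 ![0] h * g.1 * (pullUnits B F E 𝒮 ![1] h)⁻¹
  iseqv :=
    { refl := fun g => ⟨1, one_mem _, by simp⟩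
      symm := by
        rintro g g' ⟨h, hh, e⟩
        exact ⟨h⁻¹, inv_mem hh, by rw [e]; simp [mul_assoc]⟩
      trans := by
        rintro g g' g'' ⟨h, hh, e⟩ ⟨h', hh', e'⟩
        exact ⟨h' * h, mul_mem hh' hh, by rw [e', e]; simp [mul_assoc]⟩ }

/-- The pointed set `H^1(M, G_E)`. -/
abbrev HG : Type _ := Quotient (cohomologous B F E 𝒮)

/-- `C̃^1(M, Der^{(2)}(ΛE)) = {u ∈ C^1(M, Der^{(2)}(ΛE)) | exp u ∈ Z^1(M, G_E)}`. -/
def CTilde : Type _ :=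
  {u : Coch B F E 𝒮 1 // u ∈ CDerPos B F E 𝒮 1 ∧
    ∃ g : ZG B F E 𝒮, (g.1 : Coch B F E 𝒮 1) = nilExp u}

/-- The cocycle `exp u ∈ Z^1(M, G_E)`. -/
def expCocycle (u : CTilde B F E 𝒮) : ZG B F E 𝒮 := u.2.2.choose

lemma expCocycle_spec (u : CTilde B F E 𝒮) :
    ((expCocycle B F E 𝒮 u).1 : Coch B F E 𝒮 1) = nilExp u.1 :=
  u.2.2.choose_spec

/-- `exp(v).exp(u)`, where `(exp(v).exp(u))_{ij} = exp(v_i) exp(u_{ij}) exp(-v_j)`. -/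
def expAct (v : Coch B F E 𝒮 0) (u : Coch B F E 𝒮 1) : Coch B F E 𝒮 1 :=
  pull B F E 𝒮 ![0] (nilExp v) * nilExp u * pull B F E 𝒮 ![1] (nilExp (-v))

/-- `λ(v, u) = log (exp(v).exp(u))`. -/
def lam (v : Coch B F E 𝒮 0) (u : Coch B F E 𝒮 1) : Coch B F E 𝒮 1 :=
  nilLogOneAdd (expAct B F E 𝒮 v u - 1)

/-- `R_{2q}(u) = pr_{2q} (𝐝 exp (pr_{(2q-2)} u))`. -/
def R (q : ℕ) (u : Coch B F E 𝒮 1) : Coch B F E 𝒮 2 :=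
  pr B F E 𝒮 q (mulD B F E 𝒮 (nilExp (prLE B F E 𝒮 (q - 1) u)))

/-- `F_{2q}(v, u) = pr_{(2q)} (exp(pr_{(2q-2)} v).exp(pr_{(2q-2)} u))`. -/
def FMap (q : ℕ) (v : Coch B F E 𝒮 0) (u : Coch B F E 𝒮 1) : Coch B F E 𝒮 1 :=
  prLE B F E 𝒮 q (expAct B F E 𝒮 (prLE B F E 𝒮 (q - 1) v) (prLE B F E 𝒮 (q - 1) u))

/-- The action `φ.u = φ u φ⁻¹` of `H^0(M, Aut(E))` on cochains. -/
def act (φ : autE B F E (⊤ : Opens M)) {p : ℕ} (u : Coch B F E 𝒮 p) : Coch B F E 𝒮 p :=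
  constCoch B F E 𝒮 p (φ.1 : SheafEnd B F E ⊤) * u *
    constCoch B F E 𝒮 p ((φ.1⁻¹ : (SheafEnd B F E ⊤)ˣ) : SheafEnd B F E ⊤)

/-- A choice of the maps `D_{2q} : H^0(M, Aut(E)) × C^0(M, Der^{(2)}) × C̃^1(M, Der^{(2)}) →
C^1(M, Der_{2q})`, `q ≥ 2`. The maps `D'_{2q} = D_{2q}(Id, 0, ·)` factor over `pr_{(2q-2)}` and
satisfy `d D'_{2q} = R_{2q}`, and `D_{2q}` is their continuation by the rule
`φ.D_{2q}(φ, v, u) = D_{2q}(Id, 0, φ.λ(v, u)) + pr_{2q} log F_{2q}(φ.v, φ.u)`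
(`log F` stands for the logarithm of `Id + F`, as `F_{2q}` has no component of degree `0`). -/
structure DChoice where
  /-- the map `D_{2q}` -/
  D : ℕ → autE B F E (⊤ : Opens M) → CDerPos B F E 𝒮 0 → CTilde B F E 𝒮 → Coch B F E 𝒮 1
  mem : ∀ q, 2 ≤ q → ∀ φ v u, D q φ v u ∈ CDer B F E 𝒮 q 1
  factor : ∀ q, 2 ≤ q → ∀ u u' : CTilde B F E 𝒮,
    prLE B F E 𝒮 (q - 1) u.1 = prLE B F E 𝒮 (q - 1) u'.1 → D q 1 0 u = D q 1 0 u'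
  d_eq : ∀ q, 2 ≤ q → ∀ u : CTilde B F E 𝒮, d1 B F E 𝒮 (D q 1 0 u) = R B F E 𝒮 q u.1
  extend : ∀ q, 2 ≤ q → ∀ φ v u, ∃ w : CTilde B F E 𝒮,
    w.1 = act B F E 𝒮 φ (lam B F E 𝒮 v.1 u.1) ∧
    act B F E 𝒮 φ (D q φ v u) = D q 1 0 w +
      pr B F E 𝒮 q (nilLogOneAdd (FMap B F E 𝒮 q (act B F E 𝒮 φ v.1) (act B F E 𝒮 φ u.1)))

variable {B F E 𝒮}

/-- `D = ∑_{q ≥ 2} D_{2q}`; the sum stops at the rank of `E`, since `Der_{2q}(ΛE) = 0` for larger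
`q`. -/
def DChoice.total (D : DChoice B F E 𝒮) (φ : autE B F E (⊤ : Opens M))
    (v : CDerPos B F E 𝒮 0) (u : CTilde B F E 𝒮) : Coch B F E 𝒮 1 :=
  ∑ q ∈ Finset.Icc 2 (Module.finrank ℂ F), D.D q φ v u

/-- The rule `σ_D([exp u]) = [D(Id, 0, u) + u]` defines a map
`σ_D : H^1(M, G_E) → H^1(M, Der^{(2)}(ΛE))`, namely `σ`: every `D(Id, 0, u) + u` is a cocycle, its
class is `σ [exp u]`, and every class in `H^1(M, G_E)` is of the form `[exp u]`. -/
def DChoice.IsSigma (D : DChoice B F E 𝒮) (σ : HG B F E 𝒮 → HDer B F E 𝒮) : Prop :=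
  (∀ u : CTilde B F E 𝒮, ∃ hz : D.total 1 0 u + u.1 ∈ ZDer B F E 𝒮,
    σ ⟦expCocycle B F E 𝒮 u⟧ = Submodule.Quotient.mk ⟨D.total 1 0 u + u.1, hz⟩) ∧
  ∀ c : HG B F E 𝒮, ∃ u : CTilde B F E 𝒮, c = ⟦expCocycle B F E 𝒮 u⟧

end Cohomology

end SplitSuper

end

/-! Index q always stands for degree 2q. The freedom in D is used to compare each u with a normal
form. For every q ≥ 1, `exists_normalForm` chooses N_q(u) in C̃^1 that agrees with u below degree
2q, depends only on the components of u below degree 2q, and has this property: if exp(u) and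
exp(u') are cohomologous up to terms of degree at least 2q, then exp(N_q(u)) and exp(N_q(u')) are
cohomologous without error.

Put D'_{2q}(u) = -pr_{2q} N_q(u). The degree 2q part of 𝐝 exp(u) = Id reads R_{2q}(u) = -d
pr_{2q}(u) for all u in C̃^1 (`R_eq_neg_d1`). As R_{2q} sees only components below degree 2q, this
formula for N_q(u) gives dD'_{2q}(u) = R_{2q}(u). The values of D at other (φ, v) are forced by the
continuation rule (`exists_DChoice`). With N_1 = 0 one gets D(Id, 0, u) + u = ∑_q pr_{2q}(u -
N_q(u)), a sum of cocycles.

The class is well defined (`exists_pr_sub_eq_d0`): if h carries exp(u) to exp(u') and k carries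
exp(N_q(u)) to exp(N_q(u')), then h⁻¹k fixes exp(N_q(u)) below degree 2q. Since there are no global
derivations, h⁻¹k is Id below degree 2q (`sub_one_mem_of_gact`), and its component of degree 2q
bounds the difference of the two summands.

It is injective by induction on the degree (`cohomologousMod_succ_of_pr_sub`): once exp(u) has been
moved to agree with exp(u') below degree 2q, both have the same normal form N_q, so equality of the
classes says that they differ in degree 2q by a coboundary, which a further 0-cochain removes.
Components of large degree vanish, so finitely many steps suffice. -/

noncomputable section

namespace SplitSuper

/-! ### Exponential and logarithm of nilpotent elements through truncated power series -/

section ExpLogLemmas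

open Polynomial TensorProduct

/-- The truncated exponential series. -/
def expPoly (N : ℕ) : ℂ[X] := ∑ n ∈ Finset.range N, C ((n.factorial : ℂ)⁻¹) * X ^ n

/-- The truncated series of `log (1 + X)`. -/
def logPoly (N : ℕ) : ℂ[X] := ∑ n ∈ Finset.range N, C ((-1 : ℂ) ^ (n + 1) / (n : ℂ)) * X ^ n

lemma coeff_expPoly (N n : ℕ) :
    (expPoly N).coeff n = if n < N then (n.factorial : ℂ)⁻¹ else 0 := by
  simp [expPoly, coeff_X_pow]

lemma coeff_logPoly (N n : ℕ) :
    (logPoly N).coeff n = if n < N then (-1 : ℂ) ^ (n + 1) / (n : ℂ) else 0 := by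
  simp only [logPoly, finsetSum_coeff, coeff_C_mul, coeff_X_pow, mul_ite, mul_one, mul_zero,
    Finset.sum_ite_eq, Finset.mem_range]

lemma derivative_expPoly (N : ℕ) :
    derivative (expPoly (N + 1)) + C ((N.factorial : ℂ)⁻¹) * X ^ N = expPoly (N + 1) := by
  ext n
  simp only [coeff_add, coeff_derivative, coeff_expPoly, coeff_C_mul, coeff_X_pow]
  rcases lt_trichotomy n N with h | rfl | h
  · rw [if_pos (by omega), if_neg (by omega), if_pos (by omega), Nat.factorial_succ]
    have h1 : (n.factorial : ℂ) ≠ 0 := by exact_mod_cast n.factorial_ne_zero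
    have h2 : (n + 1 : ℂ) ≠ 0 := by exact_mod_cast n.succ_ne_zero
    push_cast
    field_simp
    ring
  · simp
  · rw [if_neg (by omega), if_neg (by omega), if_neg (by omega)]
    simp

/-- The derivative is a finite geometric series in -X, so the truncation costs exactly one power of
X. -/
lemma one_add_X_mul_derivative_logPoly (N : ℕ) :
    (1 + X) * derivative (logPoly (N + 1)) = 1 - (-X) ^ N := by
  have h : derivative (logPoly (N + 1)) = ∑ n ∈ Finset.range N, (-X : ℂ[X]) ^ n := by
    ext n
    have h3 : ∀ k, ((-X : ℂ[X]) ^ k) = C ((-1 : ℂ) ^ k) * X ^ k := by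
      intro k
      rw [neg_pow]
      simp
    simp only [coeff_derivative, coeff_logPoly, finsetSum_coeff, h3, coeff_C_mul, coeff_X_pow,
      mul_ite, mul_one, mul_zero, Finset.sum_ite_eq, Finset.mem_range]
    have h2 : (n + 1 : ℂ) ≠ 0 := by exact_mod_cast n.succ_ne_zero
    by_cases hn : n < N
    · rw [if_pos (by omega), if_pos hn]
      push_cast
      field_simp
      ring
    · rw [if_neg (by omega), if_neg hn, zero_mul]
  rw [h]
  have := mul_neg_geom_sum (-X : ℂ[X]) N
  rwa [sub_neg_eq_add] at this

lemma X_dvd_logPoly (N : ℕ) : X ∣ logPoly N := by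
  rw [X_dvd_iff, coeff_logPoly]
  simp

/-- `exp (log (1 + X)) = 1 + X` up to terms of high order. -/
lemma X_pow_dvd_expPoly_comp_logPoly (N : ℕ) :
    X ^ (N + 1) ∣ (expPoly (N + 1)).comp (logPoly (N + 1)) - (1 + X) := by
  set f := (expPoly (N + 1)).comp (logPoly (N + 1)) with hf
  -- Modulo X^N, f solves the differential equation (1 + X) f' = f of 1 + X.
  have h1 : X ^ N ∣ (1 + X) * derivative f - f := by
    have e : (1 + X) * derivative f - f =
        - (C ((N.factorial : ℂ)⁻¹) * logPoly (N + 1) ^ N)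
        - (-X) ^ N * (derivative (expPoly (N + 1))).comp (logPoly (N + 1)) := by
      have h2 := congrArg (fun p : ℂ[X] => p.comp (logPoly (N + 1))) (derivative_expPoly N)
      simp only [add_comp, mul_comp, C_comp, pow_comp, X_comp] at h2
      rw [hf, derivative_comp, ← mul_assoc, one_add_X_mul_derivative_logPoly, ← h2]
      ring
    rw [e]
    refine dvd_sub (dvd_neg.mpr (Dvd.dvd.mul_left (pow_dvd_pow_of_dvd (X_dvd_logPoly _) N) _)) ?_
    refine Dvd.dvd.mul_right ?_ _
    rw [neg_pow]
    exact Dvd.intro_left _ rfl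
  have h0 : f.coeff 0 = 1 := by
    rw [coeff_zero_eq_eval_zero, hf, eval_comp, ← coeff_zero_eq_eval_zero, coeff_logPoly]
    simp only [Nat.cast_zero, div_zero, ite_self]
    rw [← coeff_zero_eq_eval_zero, coeff_expPoly]
    simp
  rw [X_pow_dvd_iff] at h1 ⊢
  -- The factor 1 - n vanishes at n = 1, so every later coefficient in the range is zero; f(0) = 1
  -- gives the first two.
  have hrec : ∀ n < N, f.coeff (n + 1) * (n + 1) = f.coeff n * (1 - n) := by
    intro n hn
    have h3 := h1 n hn
    rw [coeff_sub, add_mul, one_mul, coeff_add, coeff_derivative] at h3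
    rcases n with _ | n
    · simp only [coeff_X_mul_zero] at h3
      push_cast at h3 ⊢
      linear_combination h3
    · rw [coeff_X_mul, coeff_derivative] at h3
      push_cast at h3 ⊢
      linear_combination h3
  have h2 : ∀ n, n + 2 < N + 1 → f.coeff (n + 2) = 0 := by
    intro n
    induction n with
    | zero =>
      intro hn
      have := hrec 1 (by omega)
      norm_num at this
      simpa using this
    | succ n ih =>
      intro hn
      have := hrec (n + 2) (by omega)
      rw [ih (by omega), zero_mul] at this
      have h4 : ((n + 2 : ℕ) : ℂ) + 1 ≠ 0 := by exact_mod_cast (n + 2).succ_ne_zero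
      exact (mul_eq_zero.mp this).resolve_right h4
  intro n hn
  rcases n with _ | _ | n
  · simp [h0]
  · have := hrec 0 (by omega)
    rw [h0] at this
    simp only [Nat.cast_zero, zero_add, mul_one, sub_zero] at this
    simp [this, coeff_one, coeff_X]
  · rw [coeff_sub, h2 n hn]
    simp [coeff_one, coeff_X]

variable {A A' : Type*} [Ring A] [Algebra ℂ A] [Ring A'] [Algebra ℂ A']

/-- The length of the sum in `nilExp` varies with the element. Any common N with vanishing N-th
power makes it the value of one fixed polynomial, so elements can be compared and homomorphisms
applied. -/
lemma nilExp_eq_aeval {a : A} {N : ℕ} (h : a ^ N = 0) : nilExp a = aeval a (expPoly N) := by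
  have h2 : ∑ n ∈ Finset.range N, ((n.factorial : ℂ)⁻¹) • a ^ n = nilExp a := by
    rw [nilExp, ← Finset.sum_range_add_sum_Ico _
      (show nilpotencyClass a ≤ N from csInf_le' h)]
    refine add_eq_left.mpr ?_
    refine Finset.sum_eq_zero fun n hn => ?_
    rw [pow_eq_zero_of_le (Finset.mem_Ico.1 hn).1 (pow_nilpotencyClass ⟨N, h⟩), smul_zero]
  rw [← h2, expPoly, map_sum]
  simp [Algebra.smul_def]

lemma nilLog_eq_aeval {a : A} {N : ℕ} (h : a ^ N = 0) :
    nilLogOneAdd a = aeval a (logPoly N) := by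
  have h2 : ∑ n ∈ Finset.range N, ((-1 : ℂ) ^ (n + 1) / (n : ℂ)) • a ^ n = nilLogOneAdd a := by
    rw [nilLogOneAdd, ← Finset.sum_range_add_sum_Ico _
      (show nilpotencyClass a ≤ N from csInf_le' h)]
    refine add_eq_left.mpr ?_
    refine Finset.sum_eq_zero fun n hn => ?_
    rw [pow_eq_zero_of_le (Finset.mem_Ico.1 hn).1 (pow_nilpotencyClass ⟨N, h⟩), smul_zero]
  rw [← h2, logPoly, map_sum]
  simp only [map_mul, aeval_C, map_pow, aeval_X, Algebra.smul_def]

lemma map_nilExp (f : A →ₐ[ℂ] A') {a : A} (ha : IsNilpotent a) :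
    f (nilExp a) = nilExp (f a) := by
  obtain ⟨N, hN⟩ := ha
  rw [nilExp_eq_aeval hN, nilExp_eq_aeval (a := f a) (N := N) (by rw [← map_pow, hN, map_zero]),
    aeval_algHom_apply]

lemma map_nilLog (f : A →ₐ[ℂ] A') {a : A} (ha : IsNilpotent a) :
    f (nilLogOneAdd a) = nilLogOneAdd (f a) := by
  obtain ⟨N, hN⟩ := ha
  rw [nilLog_eq_aeval hN, nilLog_eq_aeval (a := f a) (N := N) (by rw [← map_pow, hN, map_zero]),
    aeval_algHom_apply]

/-- Gives access to the addition formula and to the exponential of a derivation, which are known for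
the rational exponential. -/
lemma nilExp_eq_exp [Module ℚ A] (a : A) : nilExp a = IsNilpotent.exp a := by
  unfold nilExp IsNilpotent.exp
  refine Finset.sum_congr rfl fun n _ => ?_
  have h := map_inv_natCast_smul (AddMonoidHom.id A) ℂ ℚ n.factorial (a ^ n)
  simpa using h

lemma nilExp_add {a b : A} (h : Commute a b) (ha : IsNilpotent a) (hb : IsNilpotent b) :
    nilExp (a + b) = nilExp a * nilExp b := by
  let _ : Module ℚ A := Module.compHom A (algebraMap ℚ ℂ)
  simp only [nilExp_eq_exp]
  exact IsNilpotent.exp_add_of_commute h ha hb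

@[simp] lemma nilExp_zero : nilExp (0 : A) = 1 := by
  rw [nilExp_eq_aeval (N := 1) (pow_one 0)]
  simp [expPoly]

lemma nilExp_mul_nilExp_neg {a : A} (ha : IsNilpotent a) : nilExp a * nilExp (-a) = 1 := by
  rw [← nilExp_add (Commute.neg_right rfl) ha ha.neg, add_neg_cancel, nilExp_zero]

lemma nilExp_neg_mul_nilExp {a : A} (ha : IsNilpotent a) : nilExp (-a) * nilExp a = 1 := by
  rw [← nilExp_add (Commute.neg_left rfl) ha.neg ha, neg_add_cancel, nilExp_zero]

lemma nilExp_nilLog {a : A} (ha : IsNilpotent a) : nilExp (nilLogOneAdd a) = 1 + a := by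
  obtain ⟨N, hN⟩ := ha
  have hN : a ^ (N + 1) = 0 := pow_eq_zero_of_le N.le_succ hN
  have h1 : (nilLogOneAdd a) ^ (N + 1) = 0 := by
    obtain ⟨q, hq⟩ := pow_dvd_pow_of_dvd (X_dvd_logPoly (N + 1)) (N + 1)
    rw [nilLog_eq_aeval hN, ← map_pow, hq, map_mul, map_pow, aeval_X, hN, zero_mul]
  rw [nilExp_eq_aeval h1, nilLog_eq_aeval hN, ← aeval_comp]
  obtain ⟨q, hq⟩ := X_pow_dvd_expPoly_comp_logPoly N
  rw [sub_eq_iff_eq_add.mp hq, map_add, map_mul, map_pow, aeval_X, hN, zero_mul, zero_add]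
  simp

lemma isNilpotent_nilLog {a : A} (ha : IsNilpotent a) : IsNilpotent (nilLogOneAdd a) := by
  obtain ⟨N, hN⟩ := ha
  obtain ⟨q, hq⟩ := pow_dvd_pow_of_dvd (X_dvd_logPoly N) N
  exact ⟨N, by rw [nilLog_eq_aeval hN, ← map_pow, hq, map_mul, map_pow, aeval_X, hN, zero_mul]⟩

lemma isNilpotent_nilExp_sub_one {a : A} (ha : IsNilpotent a) : IsNilpotent (nilExp a - 1) := by
  let _ : Module ℚ A := Module.compHom A (algebraMap ℚ ℂ)
  rw [nilExp_eq_exp]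
  exact IsNilpotent.isNilpotent_exp_sub_one ha

lemma commute_nilExp {a b : A} (h : Commute a b) : Commute (nilExp a) b :=
  Commute.sum_left _ _ _ fun _ _ => (h.pow_left _).smul_left _

lemma commute_nilLog {a b : A} (h : Commute a b) : Commute (nilLogOneAdd a) b :=
  Commute.sum_left _ _ _ fun _ _ => (h.pow_left _).smul_left _

/-- If a^(N+2) = 0, then a^N exp(a) = a^N + a^(N+1). With exp(a) = 1 this forces a^(N+1) = 0, and
the exponent descends to 1. -/
lemma eq_zero_of_nilExp_eq_one {a : A} (ha : IsNilpotent a) (h : nilExp a = 1) : a = 0 := by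
  obtain ⟨N, hN⟩ := ha
  induction N with
  | zero => exact eq_zero_of_zero_eq_one (by simpa using hN.symm) a
  | succ N ih =>
    rcases N with _ | N
    · simpa using hN
    · refine ih ?_
      have h1 : a ^ N * ∑ n ∈ Finset.range (N + 2), ((n.factorial : ℂ)⁻¹) • a ^ n = a ^ N := by
        have h2 := nilExp_eq_aeval hN
        rw [h, expPoly, map_sum] at h2
        simp only [map_mul, aeval_C, map_pow, aeval_X, ← Algebra.smul_def] at h2
        rw [← h2, mul_one]
      rw [Finset.sum_range_succ', Finset.sum_range_succ', mul_add, mul_add, Finset.mul_sum,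
        Finset.sum_eq_zero] at h1
      · simpa [pow_succ] using h1
      · intro n _
        rw [mul_smul_comm, ← pow_add, pow_eq_zero_of_le (by omega) hN, smul_zero]

/-- The logarithm x of exp(a) commutes with a and has the same exponential, so exp(x - a) = 1 and
the previous lemma applies. -/
lemma nilLog_nilExp {a : A} (ha : IsNilpotent a) : nilLogOneAdd (nilExp a - 1) = a := by
  set x := nilLogOneAdd (nilExp a - 1) with hx
  have hn := isNilpotent_nilExp_sub_one ha
  have hxn : IsNilpotent x := isNilpotent_nilLog hn
  have hc : Commute x a := commute_nilLog ((commute_nilExp (Commute.refl a)).sub_left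
    (Commute.one_left a))
  have he : nilExp x = nilExp a := by rw [hx, nilExp_nilLog hn]; abel
  have h1 : nilExp (x - a) = 1 := by
    rw [sub_eq_add_neg, nilExp_add hc.neg_right hxn ha.neg, he, nilExp_mul_nilExp_neg ha]
  exact sub_eq_zero.mp (eq_zero_of_nilExp_eq_one (hc.isNilpotent_sub hxn ha) h1)

@[simp] lemma nilLog_zero : nilLogOneAdd (0 : A) = 0 := by
  rw [nilLog_eq_aeval (N := 1) (pow_one 0)]
  simp [logPoly]

/-- The logarithm of a multiplicative unipotent endomorphism is a derivation. -/
lemma nilLog_derivation {S : Type*} [Ring S] [Algebra ℂ S] (ν : Module.End ℂ S)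
    (hν : IsNilpotent ν) (hmul : ∀ a b, (1 + ν) (a * b) = (1 + ν) a * (1 + ν) b) (a b : S) :
    nilLogOneAdd ν (a * b) = nilLogOneAdd ν a * b + a * nilLogOneAdd ν b := by
  obtain ⟨l, hl⟩ : ∃ l : Module.End ℂ S →ₐ[ℂ] Module.End ℂ (S ⊗[ℂ] S),
      ∀ x p q, l x (p ⊗ₜ[ℂ] q) = p ⊗ₜ x q := ⟨Module.End.lTensorAlgHom ℂ S S, fun _ _ _ => rfl⟩
  obtain ⟨r, hr⟩ : ∃ r : Module.End ℂ S →ₐ[ℂ] Module.End ℂ (S ⊗[ℂ] S),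
      ∀ x p q, r x (p ⊗ₜ[ℂ] q) = x p ⊗ₜ q := ⟨Module.End.rTensorAlgHom ℂ S S, fun _ _ _ => rfl⟩
  set L := nilLogOneAdd ν with hL
  have hLn : IsNilpotent L := isNilpotent_nilLog hν
  have hc : ∀ x y : Module.End ℂ S, Commute (r x) (l y) := by
    intro x y
    ext p q
    simp [hl, hr]
  have hn1 : IsNilpotent (r L) := hLn.map r
  have hn2 : IsNilpotent (l L) := hLn.map l
  have hn := (hc L L).isNilpotent_add hn1 hn2
  -- On S ⊗ S the operators L ⊗ 1 and 1 ⊗ L commute, so the logarithm of (1 + ν) ⊗ (1 + ν) is their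
  -- sum.
  have hexp : nilExp (r L + l L) = r (1 + ν) * l (1 + ν) := by
    rw [nilExp_add (hc L L) hn1 hn2, ← map_nilExp r hLn, ← map_nilExp l hLn, hL,
      nilExp_nilLog hν]
  set Φ := r (1 + ν) * l (1 + ν) - 1 with hΦ
  have hΦn : IsNilpotent Φ := by rw [hΦ, ← hexp]; exact isNilpotent_nilExp_sub_one hn
  have hlog : nilLogOneAdd Φ = r L + l L := by rw [hΦ, ← hexp, nilLog_nilExp hn]
  -- Multiplicativity of 1 + ν means that the product map S ⊗ S → S intertwines Φ and ν. It then
  -- intertwines their logarithms, which is the Leibniz rule for L.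
  have hm : ν ∘ₗ LinearMap.mul' ℂ S = LinearMap.mul' ℂ S ∘ₗ Φ := by
    ext p q
    have := hmul p q
    simp only [LinearMap.add_apply, Module.End.one_apply] at this
    simp only [hΦ, TensorProduct.AlgebraTensorModule.curry_apply, TensorProduct.curry_apply,
      LinearMap.comp_apply, LinearMap.restrictScalars_apply, LinearMap.mul'_apply,
      LinearMap.sub_apply, Module.End.mul_apply, Module.End.one_apply, hl, hr, map_sub,
      LinearMap.add_apply, ← this]
    abel
  obtain ⟨N, hN⟩ := hν
  obtain ⟨K, hK⟩ := hΦn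
  have hN' : ν ^ (max N K) = 0 := pow_eq_zero_of_le (le_max_left _ _) hN
  have hK' : Φ ^ (max N K) = 0 := pow_eq_zero_of_le (le_max_right _ _) hK
  have key : nilLogOneAdd ν (LinearMap.mul' ℂ S (a ⊗ₜ b)) =
      LinearMap.mul' ℂ S (nilLogOneAdd Φ (a ⊗ₜ b)) := by
    rw [nilLog_eq_aeval hN', nilLog_eq_aeval hK', logPoly]
    simp only [map_sum, LinearMap.sum_apply]
    refine Finset.sum_congr rfl fun n _ => ?_
    have := LinearMap.congr_fun (Module.End.commute_pow_left_of_commute hm n) (a ⊗ₜ b)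
    simp only [LinearMap.comp_apply] at this
    simp only [map_mul, aeval_C, map_pow, aeval_X, ← Algebra.smul_def, LinearMap.smul_apply,
      map_smul, this]
  rw [hlog] at key
  simpa [hl, hr] using key

end ExpLogLemmas

/-! ### The degree filtration and first-order expansions -/

/-- A system of projections onto the components of degrees `0, …, r` of a graded algebra; there may
be elements outside the sum of these components. -/
structure IsGradingProj {A : Type*} [Ring A] [Algebra ℂ A] (r : ℕ) (pr : ℕ → A →ₗ[ℂ] A) :
    Prop where
  pr_pr_self : ∀ k x, pr k (pr k x) = pr k x
  pr_pr_ne : ∀ k l x, k ≠ l → pr k (pr l x) = 0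
  pr_mul : ∀ a b x y, pr (a + b) (pr a x * pr b y) = pr a x * pr b y
  pr_one : pr 0 1 = 1
  pr_eq_zero : ∀ k x, r < k → pr k x = 0

namespace IsGradingProj

variable {A : Type*} [Ring A] [Algebra ℂ A] {r : ℕ} {pr : ℕ → A →ₗ[ℂ] A}

/-- The sum of the components of degrees `q, …, r`. -/
def filt (r : ℕ) (pr : ℕ → A →ₗ[ℂ] A) (q : ℕ) : Submodule ℂ A :=
  LinearMap.eqLocus (∑ k ∈ Finset.Icc q r, pr k) LinearMap.id

lemma mem_filt {q : ℕ} {x : A} : x ∈ filt r pr q ↔ ∑ k ∈ Finset.Icc q r, pr k x = x := by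
  simp [filt, LinearMap.mem_eqLocus]

lemma filt_eq_zero {q : ℕ} (hq : r < q) {x : A} (hx : x ∈ filt r pr q) : x = 0 := by
  rw [mem_filt, Finset.Icc_eq_empty (by omega), Finset.sum_empty] at hx
  exact hx.symm

variable (hp : IsGradingProj r pr)
include hp

lemma pr_mem {q k : ℕ} (h : q ≤ k) (x : A) : pr k x ∈ filt r pr q := by
  by_cases hk : k ≤ r
  · rw [mem_filt, Finset.sum_eq_single k, hp.pr_pr_self]
    · intro l _ hl
      exact hp.pr_pr_ne _ _ _ hl
    · intro h'
      exact absurd (Finset.mem_Icc.mpr ⟨h, hk⟩) h'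
  · rw [hp.pr_eq_zero k x (by omega)]
    exact zero_mem _

lemma filt_anti {q q' : ℕ} (h : q ≤ q') : filt r pr q' ≤ filt r pr q := by
  intro x hx
  rw [← mem_filt.mp hx]
  exact sum_mem fun k hk => hp.pr_mem (h.trans (Finset.mem_Icc.mp hk).1) x

lemma pr_eq_zero_of_mem {q k : ℕ} (h : k < q) {x : A} (hx : x ∈ filt r pr q) : pr k x = 0 := by
  rw [← mem_filt.mp hx, map_sum]
  refine Finset.sum_eq_zero fun l hl => hp.pr_pr_ne _ _ _ ?_
  have := (Finset.mem_Icc.mp hl).1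
  omega

lemma sub_pr_mem {q : ℕ} {x : A} (hx : x ∈ filt r pr q) : x - pr q x ∈ filt r pr (q + 1) := by
  by_cases hq : q ≤ r
  · have h1 := mem_filt.mp hx
    rw [← Finset.insert_Icc_add_one_left_eq_Icc hq, Finset.sum_insert (by simp)] at h1
    rw [sub_eq_of_eq_add' h1.symm]
    exact sum_mem fun k hk => hp.pr_mem (Finset.mem_Icc.mp hk).1 x
  · rw [filt_eq_zero (by omega) hx, map_zero, sub_zero]
    exact zero_mem _

lemma mem_succ_of_pr_eq_zero {q : ℕ} {x : A} (hx : x ∈ filt r pr q) (h : pr q x = 0) :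
    x ∈ filt r pr (q + 1) := by
  simpa [h] using hp.sub_pr_mem hx

lemma mul_mem {a b : ℕ} {x y : A} (hx : x ∈ filt r pr a) (hy : y ∈ filt r pr b) :
    x * y ∈ filt r pr (a + b) := by
  rw [← mem_filt.mp hx, ← mem_filt.mp hy, Finset.sum_mul_sum]
  refine sum_mem fun k hk => sum_mem fun l hl => ?_
  rw [← hp.pr_mul]
  exact hp.pr_mem (add_le_add (Finset.mem_Icc.mp hk).1 (Finset.mem_Icc.mp hl).1) _

lemma one_mem : (1 : A) ∈ filt r pr 0 := by
  rw [← hp.pr_one]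
  exact hp.pr_mem le_rfl _

lemma mem_zero {q : ℕ} {x : A} (hx : x ∈ filt r pr q) : x ∈ filt r pr 0 :=
  hp.filt_anti (Nat.zero_le q) hx

lemma mem_zero_of_sub_one_mem {x : A} (hx : x - 1 ∈ filt r pr 1) : x ∈ filt r pr 0 := by
  have := add_mem (hp.mem_zero hx) hp.one_mem
  rwa [sub_add_cancel] at this

lemma mul_mem_left {q : ℕ} {x y : A} (hx : x ∈ filt r pr 0) (hy : y ∈ filt r pr q) :
    x * y ∈ filt r pr q := by
  simpa using hp.mul_mem hx hy

lemma mul_mem_right {q : ℕ} {x y : A} (hx : x ∈ filt r pr q) (hy : y ∈ filt r pr 0) :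
    x * y ∈ filt r pr q := by
  simpa using hp.mul_mem hx hy

lemma mul_mem_succ {q : ℕ} {x y : A} (hx : x ∈ filt r pr 1) (hy : y ∈ filt r pr q) :
    x * y ∈ filt r pr (q + 1) := by
  simpa [add_comm] using hp.mul_mem hx hy

lemma pow_mem {x : A} (hx : x ∈ filt r pr 1) (n : ℕ) : x ^ n ∈ filt r pr n := by
  induction n with
  | zero => simpa using hp.one_mem
  | succ n ih => simpa [pow_succ] using hp.mul_mem ih hx

/-- The exponent r + 2 rather than r + 1 ensures that the truncated series of this length contain
the linear term even for r = 0. -/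
lemma pow_eq_zero {x : A} (hx : x ∈ filt r pr 1) : x ^ (r + 2) = 0 :=
  filt_eq_zero (by omega) (hp.pow_mem hx (r + 2))

lemma isNilpotent {x : A} (hx : x ∈ filt r pr 1) : IsNilpotent x :=
  ⟨_, hp.pow_eq_zero hx⟩

lemma pow_sub_pow_mem {q : ℕ} {x y : A} (hx : x ∈ filt r pr 1) (hy : y ∈ filt r pr 1)
    (h : x - y ∈ filt r pr q) (n : ℕ) : x ^ (n + 2) - y ^ (n + 2) ∈ filt r pr (q + 1) := by
  have key : ∀ n : ℕ, x ^ (n + 1) - y ^ (n + 1) ∈ filt r pr q := by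
    intro n
    induction n with
    | zero => simpa using h
    | succ n ih =>
      have e : x ^ (n + 1 + 1) - y ^ (n + 1 + 1) =
          x ^ (n + 1) * (x - y) + (x ^ (n + 1) - y ^ (n + 1)) * y := by
        rw [pow_succ x (n + 1), pow_succ y (n + 1)]
        noncomm_ring
      rw [e]
      exact add_mem (hp.mul_mem_left (hp.mem_zero (hp.pow_mem hx _)) h)
        (hp.mul_mem_right ih (hp.mem_zero hy))
  have e : x ^ (n + 2) - y ^ (n + 2) =
      x * (x ^ (n + 1) - y ^ (n + 1)) + (x - y) * y ^ (n + 1) := by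
    rw [pow_succ' x (n + 1), pow_succ' y (n + 1)]
    noncomm_ring
  rw [e]
  refine add_mem (hp.mul_mem_succ hx (key n)) ?_
  refine hp.filt_anti (by omega) (hp.mul_mem h (hp.pow_mem hy (n + 1)))

-- Constant terms cancel, and in a difference of higher powers each summand has, besides x - y, a
-- further factor of positive degree. Only the linear term survives modulo the next step of the
-- filtration.
open Polynomial in
lemma aeval_sub_aeval_mem {q : ℕ} {x y : A} (hx : x ∈ filt r pr 1) (hy : y ∈ filt r pr 1)
    (h : x - y ∈ filt r pr q) (p : ℂ[X]) :
    aeval x p - aeval y p - p.coeff 1 • (x - y) ∈ filt r pr (q + 1) := by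
  induction p using Polynomial.induction_on' with
  | add p p' hp hp' =>
    have := add_mem hp hp'
    convert this using 1
    simp only [map_add, coeff_add, add_smul]
    abel
  | monomial n c =>
    rcases n with _ | _ | n
    · simp
    · simp [← Algebra.smul_def, smul_sub]
    · have := Submodule.smul_mem _ c (hp.pow_sub_pow_mem hx hy h n)
      simpa [aeval_monomial, coeff_monomial, ← Algebra.smul_def, smul_sub] using this

lemma nilExp_sub_mem {q : ℕ} {x y : A} (hx : x ∈ filt r pr 1) (hy : y ∈ filt r pr 1)
    (h : x - y ∈ filt r pr q) : nilExp x - nilExp y - (x - y) ∈ filt r pr (q + 1) := by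
  have := hp.aeval_sub_aeval_mem hx hy h (expPoly (r + 2))
  rwa [coeff_expPoly, if_pos (by omega), Nat.factorial_one, Nat.cast_one, inv_one, one_smul,
    ← nilExp_eq_aeval (hp.pow_eq_zero hx), ← nilExp_eq_aeval (hp.pow_eq_zero hy)] at this

lemma nilLog_sub_mem {q : ℕ} {x y : A} (hx : x ∈ filt r pr 1) (hy : y ∈ filt r pr 1)
    (h : x - y ∈ filt r pr q) :
    nilLogOneAdd x - nilLogOneAdd y - (x - y) ∈ filt r pr (q + 1) := by
  have := hp.aeval_sub_aeval_mem hx hy h (logPoly (r + 2))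
  rw [coeff_logPoly, if_pos (by omega), Nat.cast_one, div_one,
    ← nilLog_eq_aeval (hp.pow_eq_zero hx), ← nilLog_eq_aeval (hp.pow_eq_zero hy)] at this
  norm_num at this
  exact this

lemma nilExp_sub_mem' {q : ℕ} {x y : A} (hx : x ∈ filt r pr 1) (hy : y ∈ filt r pr 1)
    (h : x - y ∈ filt r pr q) : nilExp x - nilExp y ∈ filt r pr q := by
  have := add_mem (hp.filt_anti q.le_succ (hp.nilExp_sub_mem hx hy h)) h
  rwa [sub_add_cancel] at this

lemma nilLog_sub_mem' {q : ℕ} {x y : A} (hx : x ∈ filt r pr 1) (hy : y ∈ filt r pr 1)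
    (h : x - y ∈ filt r pr q) : nilLogOneAdd x - nilLogOneAdd y ∈ filt r pr q := by
  have := add_mem (hp.filt_anti q.le_succ (hp.nilLog_sub_mem hx hy h)) h
  rwa [sub_add_cancel] at this

lemma nilExp_sub_one_mem {q : ℕ} {x : A} (hx : x ∈ filt r pr 1) (h : x ∈ filt r pr q) :
    nilExp x - 1 ∈ filt r pr q := by
  simpa using hp.nilExp_sub_mem' hx (zero_mem _) (by simpa using h)

lemma nilLog_mem {q : ℕ} {x : A} (hx : x ∈ filt r pr 1) (h : x ∈ filt r pr q) :
    nilLogOneAdd x ∈ filt r pr q := by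
  simpa using hp.nilLog_sub_mem' hx (zero_mem _) (by simpa using h)

lemma sub_mem_of_nilExp_sub_mem {q : ℕ} {x y : A} (hx : x ∈ filt r pr 1) (hy : y ∈ filt r pr 1)
    (h : nilExp x - nilExp y ∈ filt r pr q) : x - y ∈ filt r pr q := by
  have := hp.nilLog_sub_mem' (q := q) (hp.nilExp_sub_one_mem hx hx) (hp.nilExp_sub_one_mem hy hy)
    (by simpa using h)
  rwa [nilLog_nilExp (hp.isNilpotent hx), nilLog_nilExp (hp.isNilpotent hy)] at this

/-- The projection onto the degrees `1, …, q` and the filtration. -/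
lemma sub_sum_pr_mem {x : A} (hx : x ∈ filt r pr 1) (q : ℕ) :
    x - ∑ l ∈ Finset.Icc 1 q, pr l x ∈ filt r pr (q + 1) := by
  induction q with
  | zero => simpa using hx
  | succ q ih =>
    have h1 := hp.sub_pr_mem ih
    have h2 : pr (q + 1) (∑ l ∈ Finset.Icc 1 q, pr l x) = 0 := by
      rw [map_sum]
      refine Finset.sum_eq_zero fun l hl => hp.pr_pr_ne _ _ _ ?_
      have := (Finset.mem_Icc.mp hl).2
      omega
    rwa [map_sub, h2, sub_zero, sub_sub, ← Finset.sum_Icc_succ_top (by omega)] at h1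

lemma sum_pr_mem (x : A) (q : ℕ) : ∑ l ∈ Finset.Icc 1 q, pr l x ∈ filt r pr 1 :=
  sum_mem fun _ hl => hp.pr_mem (Finset.mem_Icc.mp hl).1 x

lemma sum_pr_eq_iff {x y : A} (hx : x ∈ filt r pr 1) (hy : y ∈ filt r pr 1) (q : ℕ) :
    ∑ l ∈ Finset.Icc 1 q, pr l x = ∑ l ∈ Finset.Icc 1 q, pr l y ↔
      x - y ∈ filt r pr (q + 1) := by
  constructor
  · intro h
    have := sub_mem (hp.sub_sum_pr_mem hx q) (hp.sub_sum_pr_mem hy q)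
    rwa [h, sub_sub_sub_cancel_right] at this
  · intro h
    rw [← sub_eq_zero, ← Finset.sum_sub_distrib]
    refine Finset.sum_eq_zero fun l hl => ?_
    rw [← map_sub]
    exact hp.pr_eq_zero_of_mem (by have := (Finset.mem_Icc.mp hl).2; omega) h

end IsGradingProj

/-! ### Graded sections, graded endomorphisms, and the exponential correspondence between Der^{(2)}
and G_E -/

section SheafLemmas

variable (B : Type*) [NormedAddCommGroup B] [NormedSpace ℂ B]
  {M : Type*} [TopologicalSpace M] [ChartedSpace B M]
  (F : Type*) [NormedAddCommGroup F] [NormedSpace ℂ F] [FiniteDimensional ℂ F]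
  (E : M → Type*) [TopologicalSpace (TotalSpace F E)]
  [∀ x, AddCommGroup (E x)] [∀ x, Module ℂ (E x)] [∀ x, TopologicalSpace (E x)]
  [FiberBundle F E] [VectorBundle ℂ F E]

variable {B F E} in
lemma Sec.ext' {U : Opens M} {s t : Sec B F E U} (h : ∀ x, s.val x = t.val x) : s = t :=
  Subtype.ext (funext h)

lemma secProj_mem (j : ℕ) {U : Opens M} (a : Sec B F E U) :
    secProj B F E j U a ∈ secDeg B F E j U := fun x =>
  SetLike.coe_mem (DirectSum.decompose (fun i : ℕ => ⋀[ℂ]^i (E x)) (a.1 x) j)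

lemma secProj_of_mem {j : ℕ} {U : Opens M} {a : Sec B F E U} (ha : a ∈ secDeg B F E j U) :
    secProj B F E j U a = a :=
  Sec.ext' fun x => extProj_of_mem (ha x)

lemma secProj_of_mem_ne {i j : ℕ} {U : Opens M} {a : Sec B F E U} (ha : a ∈ secDeg B F E i U)
    (h : i ≠ j) : secProj B F E j U a = 0 :=
  Sec.ext' fun x => extProj_of_mem_ne (ha x) h

lemma secDeg_eq_zero {j : ℕ} (hj : Module.finrank ℂ F < j) {U : Opens M} {a : Sec B F E U}
    (ha : a ∈ secDeg B F E j U) : a = 0 := by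
  rwa [secDeg_eq_bot B F E hj, Submodule.mem_bot] at ha

/-- The support of the decomposition depends on the point, but above the rank all components vanish,
so one range serves for all points. -/
lemma sum_secProj {U : Opens M} (a : Sec B F E U) :
    ∑ j ∈ Finset.range (Module.finrank ℂ F + 1), secProj B F E j U a = a := by
  classical
  refine Sec.ext' fun x => ?_
  let 𝒜 := fun i : ℕ => ⋀[ℂ]^i (E x)
  have h1 : ∀ s : Finset ℕ, (∑ j ∈ s, secProj B F E j U a).val x =
      ∑ j ∈ s, extProj (E x) j (a.val x) := by
    intro s
    let ev : Sec B F E U →+ ExteriorAlgebra ℂ (E x) :=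
      { toFun := fun s => s.val x, map_zero' := rfl, map_add' := fun _ _ => rfl }
    exact map_sum ev _ _
  rw [h1]
  conv_rhs => rw [← DirectSum.sum_support_decompose 𝒜 (a.val x)]
  symm
  refine Finset.sum_subset ?_ ?_
  · intro j hj
    rw [Finset.mem_range]
    by_contra hlt
    have h2 : extProj (E x) j (a.val x) = 0 := by
      have h3 := secDeg_eq_zero B F E (by omega) (secProj_mem B F E j a)
      exact congrArg (fun s : Sec B F E U => s.val x) h3
    rw [DFinsupp.mem_support_iff] at hj
    exact hj (Subtype.ext h2)
  · intro j _ hj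
    rw [DFinsupp.notMem_support_iff] at hj
    exact congrArg Subtype.val hj

variable {B F E} in
lemma sec_induction {U : Opens M} {p : Sec B F E U → Prop}
    (hom : ∀ j, ∀ a ∈ secDeg B F E j U, p a) (add : ∀ a b, p a → p b → p (a + b))
    (a : Sec B F E U) : p a := by
  rw [← sum_secProj B F E a]
  refine Finset.sum_induction _ p add (hom 0 0 (zero_mem _)) fun j _ => ?_
  exact hom j _ (secProj_mem B F E j a)

lemma secDeg_mul {i j : ℕ} {U : Opens M} {a b : Sec B F E U} (ha : a ∈ secDeg B F E i U)
    (hb : b ∈ secDeg B F E j U) : a * b ∈ secDeg B F E (i + j) U := fun x =>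
  SetLike.mul_mem_graded (A := fun i : ℕ => ⋀[ℂ]^i (E x)) (ha x) (hb x)

lemma secProj_mul_right {i j : ℕ} {U : Opens M} {a b : Sec B F E U}
    (hb : b ∈ secDeg B F E j U) :
    secProj B F E (i + j) U (a * b) = secProj B F E i U a * b :=
  Sec.ext' fun x => DirectSum.coe_decompose_mul_add_of_right_mem
    (fun i : ℕ => ⋀[ℂ]^i (E x)) (hb x)

lemma secProj_mul_left {i j : ℕ} {U : Opens M} {a b : Sec B F E U}
    (ha : a ∈ secDeg B F E i U) :
    secProj B F E (i + j) U (a * b) = a * secProj B F E j U b :=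
  Sec.ext' fun x => DirectSum.coe_decompose_mul_add_of_left_mem
    (fun i : ℕ => ⋀[ℂ]^i (E x)) (ha x)

lemma sum_secProj_of_mem_secAbove {j : ℕ} {U : Opens M} {a : Sec B F E U}
    (ha : a ∈ secAbove B F E j U) :
    ∑ k ∈ Finset.Icc 1 (Module.finrank ℂ F), secProj B F E (j + 2 * k) U a = a := by
  have h : secAbove B F E j U ≤ LinearMap.eqLocus
      (∑ k ∈ Finset.Icc 1 (Module.finrank ℂ F), secProj B F E (j + 2 * k) U) LinearMap.id := by
    refine iSup₂_le fun k hk b hb => ?_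
    rw [LinearMap.mem_eqLocus, LinearMap.sum_apply, LinearMap.id_apply]
    by_cases hkr : k ≤ Module.finrank ℂ F
    · rw [Finset.sum_eq_single k, secProj_of_mem B F E hb]
      · intro l _ hl
        exact secProj_of_mem_ne B F E hb (by omega)
      · intro h'
        exact absurd (Finset.mem_Icc.mpr ⟨hk, hkr⟩) h'
    · rw [secDeg_eq_zero B F E (by omega) hb]
      simp
  simpa using h ha

/-! ### Sheaf endomorphisms -/

/-- The action of sheaf endomorphisms on the sections over `V`. -/
def appHom {U : Opens M} (V : Set.Iic U) : SheafEnd B F E U →ₐ[ℂ] Module.End ℂ (Sec B F E V.1) where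
  toFun f := f.app V
  map_one' := rfl
  map_mul' _ _ := rfl
  map_zero' := rfl
  map_add' _ _ := rfl
  commutes' _ := rfl

variable {B F E} in
lemma SheafEnd.ext_hom {U : Opens M} {f g : SheafEnd B F E U}
    (h : ∀ (V : Set.Iic U) (j : ℕ), ∀ a ∈ secDeg B F E j V.1, f.app V a = g.app V a) : f = g := by
  refine Subtype.ext (funext fun V => LinearMap.ext fun a => ?_)
  induction a using sec_induction with
  | hom j a ha => exact h V j a ha
  | add a b ha hb => rw [map_add, map_add, ha, hb]

lemma endPr_app {k : ℕ} {U : Opens M} (f : SheafEnd B F E U) (V : Set.Iic U) {j : ℕ}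
    {a : Sec B F E V.1} (ha : a ∈ secDeg B F E j V.1) :
    (endPr B F E k U f).app V a = secProj B F E (j + 2 * k) V.1 (f.app V a) := by
  change degPart B F E k V.1 (f.app V) a = _
  simp only [degPart, LinearMap.sum_apply, Module.End.mul_apply]
  by_cases hj : j < Module.finrank ℂ F + 1
  · rw [Finset.sum_eq_single j, secProj_of_mem B F E ha]
    · intro l _ hl
      rw [secProj_of_mem_ne B F E ha (Ne.symm hl), map_zero, map_zero]
    · intro h'
      exact absurd (Finset.mem_range.mpr hj) h'
  · rw [secDeg_eq_zero B F E (by omega) ha]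
    simp

lemma endPr_app_mem {k : ℕ} {U : Opens M} (f : SheafEnd B F E U) (V : Set.Iic U) {j : ℕ}
    {a : Sec B F E V.1} (ha : a ∈ secDeg B F E j V.1) :
    (endPr B F E k U f).app V a ∈ secDeg B F E (j + 2 * k) V.1 := by
  rw [endPr_app B F E f V ha]
  exact secProj_mem B F E _ _

lemma sum_app {U : Opens M} {κ : Type*} (s : Finset κ) (f : κ → SheafEnd B F E U)
    (V : Set.Iic U) (a : Sec B F E V.1) :
    (∑ k ∈ s, f k).app V a = ∑ k ∈ s, (f k).app V a := by
  change appHom B F E V (∑ k ∈ s, f k) a = _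
  rw [map_sum, LinearMap.sum_apply]
  rfl

/-- The k-th projection belongs to degree 2k. Odd and negative components of an endomorphism are not
covered, which is why `IsGradingProj` does not ask the projections to add up to the identity. The
bound k ≤ rank is generous, since already 2k > rank kills the component. -/
lemma isGradingProj_endPr (U : Opens M) :
    IsGradingProj (Module.finrank ℂ F) (fun k => endPr B F E k U) where
  pr_pr_self k f := SheafEnd.ext_hom fun V j a ha => by
    rw [endPr_app B F E _ V ha, endPr_app B F E _ V ha, secProj_of_mem B F E (secProj_mem B F E _ _)]
  pr_pr_ne k l f h := SheafEnd.ext_hom fun V j a ha => by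
    rw [endPr_app B F E _ V ha, endPr_app B F E _ V ha,
      secProj_of_mem_ne B F E (secProj_mem B F E _ _) (by omega)]
    rfl
  pr_mul k l f g := SheafEnd.ext_hom fun V j a ha => by
    rw [endPr_app B F E _ V ha]
    refine secProj_of_mem B F E ?_
    change (endPr B F E k U f).app V ((endPr B F E l U g).app V a) ∈ _
    have := endPr_app_mem B F E (k := k) f V (endPr_app_mem B F E (k := l) g V ha)
    rwa [add_assoc, ← mul_add, add_comm l k] at this
  pr_one := SheafEnd.ext_hom fun V j a ha => by
    rw [endPr_app B F E _ V ha]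
    exact secProj_of_mem B F E ha
  pr_eq_zero k f h := SheafEnd.ext_hom fun V j a ha => by
    exact secDeg_eq_zero B F E (by omega) (endPr_app_mem B F E f V ha)

-- Translates the filtration into the condition on φ - Id in the definition of G_E.
open IsGradingProj in
lemma mem_filt_one_iff {U : Opens M} {f : SheafEnd B F E U} :
    f ∈ filt (Module.finrank ℂ F) (fun k => endPr B F E k U) 1 ↔
      ∀ (V : Set.Iic U) (j : ℕ), ∀ a ∈ secDeg B F E j V.1, f.app V a ∈ secAbove B F E j V.1 := by
  rw [mem_filt]
  constructor
  · intro h V j a ha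
    rw [← h, sum_app]
    exact sum_mem fun k hk => secDeg_le_secAbove B F E (Finset.mem_Icc.mp hk).1 V.1
      (endPr_app_mem B F E f V ha)
  · intro h
    refine SheafEnd.ext_hom fun V j a ha => ?_
    rw [sum_app, ← sum_secProj_of_mem_secAbove B F E (h V j a ha)]
    refine Finset.sum_congr rfl fun k _ => ?_
    rw [endPr_app B F E f V ha]

lemma endPr_of_mem_derDeg {k : ℕ} {U : Opens M} {f : SheafEnd B F E U}
    (hf : f ∈ derDeg B F E k U) : endPr B F E k U f = f :=
  SheafEnd.ext_hom fun V j a ha => by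
    rw [endPr_app B F E f V ha, secProj_of_mem B F E (hf.2 V j a ha)]

lemma derDeg_le_derPos {k : ℕ} (hk : 1 ≤ k) (U : Opens M) :
    derDeg B F E k U ≤ derPos B F E U :=
  le_iSup₂_of_le (f := fun k (_ : 1 ≤ k) => derDeg B F E k U) k hk le_rfl

/-- For homogeneous a and b of degrees i and j, take the component of degree i + j + 2k in the
Leibniz rule. -/
lemma endPr_mem_derDeg (k : ℕ) {U : Opens M} {f : SheafEnd B F E U}
    (hf : ∀ (V : Set.Iic U) (a b : Sec B F E V.1),
      f.app V (a * b) = f.app V a * b + a * f.app V b) :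
    endPr B F E k U f ∈ derDeg B F E k U := by
  refine ⟨fun V a b => ?_, fun V j a ha => endPr_app_mem B F E f V ha⟩
  induction a using sec_induction with
  | add a a' ha ha' => simp only [add_mul, map_add, ha, ha']; abel
  | hom i a ha =>
    induction b using sec_induction with
    | add b b' hb hb' => simp only [mul_add, map_add, hb, hb']; abel
    | hom j b hb =>
      rw [endPr_app B F E f V (secDeg_mul B F E ha hb), endPr_app B F E f V ha,
        endPr_app B F E f V hb, hf, map_add, add_assoc i j, secProj_mul_left B F E ha,
        ← add_assoc i j, add_right_comm, secProj_mul_right B F E hb]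

lemma derPos_derivation {U : Opens M} {f : SheafEnd B F E U} (hf : f ∈ derPos B F E U)
    (V : Set.Iic U) (a b : Sec B F E V.1) :
    f.app V (a * b) = f.app V a * b + a * f.app V b := by
  let N : Submodule ℂ (SheafEnd B F E U) :=
    LinearMap.ker ((LinearMap.applyₗ (a * b) - (LinearMap.mulRight ℂ b) ∘ₗ (LinearMap.applyₗ a)
      - (LinearMap.mulLeft ℂ a) ∘ₗ (LinearMap.applyₗ b)) ∘ₗ (appHom B F E V).toLinearMap)
  have h : derPos B F E U ≤ N := by
    refine iSup₂_le fun k _ g hg => ?_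
    have := hg.1 V a b
    change g.app V (a * b) - g.app V a * b - a * g.app V b = 0
    rw [this]
    abel
  have h2 : f.app V (a * b) - f.app V a * b - a * f.app V b = 0 := h hf
  rw [sub_sub, sub_eq_zero] at h2
  exact h2

open IsGradingProj in
lemma mem_derPos_iff {U : Opens M} {f : SheafEnd B F E U} :
    f ∈ derPos B F E U ↔ f ∈ filt (Module.finrank ℂ F) (fun k => endPr B F E k U) 1 ∧
      ∀ (V : Set.Iic U) (a b : Sec B F E V.1),
        f.app V (a * b) = f.app V a * b + a * f.app V b := by
  constructor
  · intro hf
    refine ⟨?_, derPos_derivation B F E hf⟩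
    have h : derPos B F E U ≤ filt (Module.finrank ℂ F) (fun k => endPr B F E k U) 1 := by
      refine iSup₂_le fun k hk g hg => ?_
      rw [← endPr_of_mem_derDeg B F E hg]
      exact (isGradingProj_endPr B F E U).pr_mem hk g
    exact h hf
  · rintro ⟨h1, h2⟩
    rw [← mem_filt.mp h1]
    exact sum_mem fun k hk => derDeg_le_derPos B F E (Finset.mem_Icc.mp hk).1 U
      (endPr_mem_derDeg B F E k h2)

lemma nilExp_mem_autG {U : Opens M} {f : SheafEnd B F E U} (hf : f ∈ derPos B F E U) :
    ∃ g ∈ autG B F E U, (g : SheafEnd B F E U) = nilExp f := by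
  have hp := isGradingProj_endPr B F E U
  obtain ⟨h1, h2⟩ := (mem_derPos_iff B F E).mp hf
  have hn := hp.isNilpotent h1
  refine ⟨⟨nilExp f, nilExp (-f), nilExp_mul_nilExp_neg hn, nilExp_neg_mul_nilExp hn⟩,
    ⟨fun V a b => ?_, ?_⟩, rfl⟩
  · have h3 : (nilExp f).app V = nilExp (f.app V) := map_nilExp (appHom B F E V) hn
    let _ : Module ℚ (Sec B F E V.1) := Module.compHom _ (algebraMap ℚ ℂ)
    change (nilExp f).app V (a * b) = (nilExp f).app V a * (nilExp f).app V b
    rw [h3, nilExp_eq_exp]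
    refine Module.End.exp_mul_of_derivation ℂ _ (f.app V) (fun x y => ?_)
      (hn.map (appHom B F E V)) a b
    rw [h2, add_comm]
  · exact (mem_filt_one_iff B F E).mp (hp.nilExp_sub_one_mem h1 h1)

lemma autG_sub_one_mem {U : Opens M} {g : (SheafEnd B F E U)ˣ} (hg : g ∈ autG B F E U) :
    (g : SheafEnd B F E U) - 1 ∈
      IsGradingProj.filt (Module.finrank ℂ F) (fun k => endPr B F E k U) 1 :=
  (mem_filt_one_iff B F E).mpr hg.2

/-- Together with `nilExp_mem_autG` this makes the exponential a bijection from Der^{(2)} to G_E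
over each open set. -/
lemma nilLog_mem_derPos {U : Opens M} {g : (SheafEnd B F E U)ˣ} (hg : g ∈ autG B F E U) :
    nilLogOneAdd ((g : SheafEnd B F E U) - 1) ∈ derPos B F E U := by
  have hp := isGradingProj_endPr B F E U
  have h1 := autG_sub_one_mem B F E hg
  have hn := hp.isNilpotent h1
  refine (mem_derPos_iff B F E).mpr ⟨hp.nilLog_mem h1 h1, fun V a b => ?_⟩
  have h3 : (nilLogOneAdd ((g : SheafEnd B F E U) - 1)).app V =
      nilLogOneAdd (((g : SheafEnd B F E U) - 1).app V) := map_nilLog (appHom B F E V) hn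
  rw [h3]
  refine nilLog_derivation _ (hn.map (appHom B F E V)) (fun x y => ?_) a b
  have h4 : 1 + appHom B F E V (g - 1) = appHom B F E V g := by
    rw [map_sub, map_one]
    abel
  rw [h4]
  exact hg.1 V x y

lemma conj_mem_derDeg {U : Opens M} {φ : (SheafEnd B F E U)ˣ} (hφ : φ ∈ autE B F E U) {k : ℕ}
    {f : SheafEnd B F E U} (hf : f ∈ derDeg B F E k U) :
    (φ : SheafEnd B F E U) * f * ((φ⁻¹ : (SheafEnd B F E U)ˣ) : SheafEnd B F E U) ∈
      derDeg B F E k U := by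
  have hφ' := inv_mem hφ
  have hr : ∀ (V : Set.Iic U) (a : Sec B F E V.1), φ.1.app V ((φ⁻¹).1.app V a) = a := fun V a =>
    congrArg (fun f : SheafEnd B F E U => f.app V a) φ.mul_inv
  refine ⟨fun V a b => ?_, fun V j a ha => ?_⟩
  · change φ.1.app V (f.app V ((φ⁻¹).1.app V (a * b))) =
      φ.1.app V (f.app V ((φ⁻¹).1.app V a)) * b + a * φ.1.app V (f.app V ((φ⁻¹).1.app V b))
    rw [hφ'.1, hf.1, map_add, hφ.1, hφ.1, hr, hr]
  · exact (hφ.2.1 V _ _).mpr (hf.2 V j _ ((hφ'.2.1 V j a).mpr ha))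

lemma endRes_mem_derDeg {U V : Opens M} (h : V ≤ U) {k : ℕ} {f : SheafEnd B F E U}
    (hf : f ∈ derDeg B F E k U) : endRes B F E h f ∈ derDeg B F E k V :=
  ⟨fun W => hf.1 ⟨W.1, le_trans W.2 h⟩, fun W => hf.2 ⟨W.1, le_trans W.2 h⟩⟩

lemma endRes_mem_derPos {U V : Opens M} (h : V ≤ U) {f : SheafEnd B F E U}
    (hf : f ∈ derPos B F E U) : endRes B F E h f ∈ derPos B F E V := by
  have : derPos B F E U ≤ (derPos B F E V).comap (endRes B F E h).toLinearMap :=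
    iSup₂_le fun k hk g hg => derDeg_le_derPos B F E hk V (endRes_mem_derDeg B F E h hg)
  exact this hf

lemma endRes_mem_autG {U V : Opens M} (h : V ≤ U) {g : (SheafEnd B F E U)ˣ}
    (hg : g ∈ autG B F E U) :
    Units.map (endRes B F E h : SheafEnd B F E U →* SheafEnd B F E V) g ∈ autG B F E V :=
  ⟨fun W => hg.1 ⟨W.1, le_trans W.2 h⟩, fun W => hg.2 ⟨W.1, le_trans W.2 h⟩⟩

lemma endRes_mem_autE {U V : Opens M} (h : V ≤ U) {g : (SheafEnd B F E U)ˣ}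
    (hg : g ∈ autE B F E U) :
    Units.map (endRes B F E h : SheafEnd B F E U →* SheafEnd B F E V) g ∈ autE B F E V :=
  ⟨fun W => hg.1 ⟨W.1, le_trans W.2 h⟩, fun W => hg.2.1 ⟨W.1, le_trans W.2 h⟩,
    fun W => hg.2.2 ⟨W.1, le_trans W.2 h⟩⟩

end SheafLemmas

/-! ### Gluing of sections and of sheaf endomorphisms -/

section Gluing

variable (B : Type*) [NormedAddCommGroup B] [NormedSpace ℂ B]
  {M : Type*} [TopologicalSpace M] [ChartedSpace B M]
  (F : Type*) [NormedAddCommGroup F] [NormedSpace ℂ F] [FiniteDimensional ℂ F]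
  (E : M → Type*) [TopologicalSpace (TotalSpace F E)]
  [∀ x, AddCommGroup (E x)] [∀ x, Module ℂ (E x)] [∀ x, TopologicalSpace (E x)]
  [FiberBundle F E] [VectorBundle ℂ F E]

/-- Holomorphy is a local property. -/
lemma isHolomorphic_of_local {U : Opens M} (s : ∀ x : U, ExteriorAlgebra ℂ (E x))
    (h : ∀ x₀ : U, ∃ (W : Opens M) (hW : W ≤ U), (x₀ : M) ∈ W ∧
      IsHolomorphic B F E (fun x : W => s ⟨x, hW x.2⟩)) : IsHolomorphic B F E s := by
  classical
  intro x₀ ℓ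
  obtain ⟨W, hW, hx, hs⟩ := h x₀
  -- Extension by zero to M turns the functions on U and on W into restrictions of a single
  -- function, so that smoothness at the point can be transferred.
  let f : M → ℂ := fun x => if hx : x ∈ U then ℓ (localRep F E s (x₀ : M) ⟨x, hx⟩) else 0
  have h1 : (fun x : U => ℓ (localRep F E s (x₀ : M) x)) = fun x : U => f x := by
    funext x
    simp [f]
  have h2 : (fun x : W => ℓ (localRep F E (fun x : W => s ⟨x, hW x.2⟩) (x₀ : M) x)) =
      fun x : W => f x := by
    funext x
    simp only [f, dif_pos (hW x.2)]
    rfl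
  have h3 := hs ⟨x₀, hx⟩ ℓ
  rw [h1]
  rw [h2] at h3
  exact contMDiffAt_subtype_iff.mpr
    ((contMDiffAt_subtype_iff (U := W) (f := f) (x := ⟨(x₀ : M), hx⟩)).mp h3)

variable {B F E} in
lemma sec_ext_of_cover {κ : Type*} {W : κ → Opens M} {V : Opens M} (hW : V ≤ ⨆ s, W s)
    {a b : Sec B F E V}
    (h : ∀ s, secRes B F E (inf_le_left : V ⊓ W s ≤ V) a = secRes B F E inf_le_left b) :
    a = b := by
  refine Sec.ext' fun x => ?_
  obtain ⟨s, hs⟩ := Opens.mem_iSup.mp (hW x.2)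
  exact congrArg (fun c : Sec B F E (V ⊓ W s) => c.val ⟨x, x.2, hs⟩) (h s)

variable {B F E} in
lemma exists_glue_sec {κ : Type*} {W : κ → Opens M} {V : Opens M} (hW : V ≤ ⨆ s, W s)
    (a : ∀ s, Sec B F E (V ⊓ W s))
    (h : ∀ s t (x : M) (hV : x ∈ V) (hs : x ∈ W s) (ht : x ∈ W t),
      (a s).val ⟨x, hV, hs⟩ = (a t).val ⟨x, hV, ht⟩) :
    ∃ b : Sec B F E V, ∀ s, secRes B F E inf_le_left b = a s := by
  choose s hs using fun x : V => Opens.mem_iSup.mp (hW x.2)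
  have key : ∀ (t : κ) (x : M) (hV : x ∈ V) (ht : x ∈ W t),
      (a (s ⟨x, hV⟩)).val ⟨x, hV, hs ⟨x, hV⟩⟩ = (a t).val ⟨x, hV, ht⟩ :=
    fun t x hV ht => h _ _ x hV (hs ⟨x, hV⟩) ht
  refine ⟨⟨fun x => (a (s x)).val ⟨x, x.2, hs x⟩,
    isHolomorphic_of_local B F E _ fun x₀ => ⟨V ⊓ W (s x₀), inf_le_left, ⟨x₀.2, hs x₀⟩, ?_⟩⟩, ?_⟩
  · have e : (fun x : (V ⊓ W (s x₀) : Opens M) =>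
        (a (s ⟨x, x.2.1⟩)).val ⟨x, x.2.1, hs ⟨x, x.2.1⟩⟩) = (a (s x₀)).1 :=
      funext fun x => key (s x₀) x x.2.1 x.2.2
    rw [e]
    exact (a (s x₀)).2
  · intro t
    exact Sec.ext' fun x => key t x x.2.1 x.2.2

/-- Sheaf endomorphisms, given on the sets of an open cover, that agree on overlaps can be glued. -/
lemma exists_glue_end {κ : Type*} {W : κ → Opens M} (hW : ⨆ s, W s = ⊤)
    (f : ∀ s, SheafEnd B F E (W s))
    (h : ∀ s t, endRes B F E (inf_le_left : W s ⊓ W t ≤ W s) (f s) =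
      endRes B F E inf_le_right (f t)) :
    ∃ g : SheafEnd B F E (⊤ : Opens M), ∀ s, endRes B F E le_top g = f s := by
  have hV : ∀ V : Opens M, V ≤ ⨆ s, W s := fun V => by rw [hW]; exact le_top
  -- The glued endomorphism must act on a ∈ 𝒪(V) through its restrictions to V ∩ W_s, where f_s is
  -- available.
  let loc : ∀ (V : Opens M) (s : κ), Sec B F E V →ₗ[ℂ] Sec B F E (V ⊓ W s) := fun V s =>
    (f s).app ⟨V ⊓ W s, Set.mem_Iic.mpr inf_le_right⟩ ∘ₗ (secRes B F E inf_le_left).toLinearMap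
  have hloc : ∀ (V V' : Opens M) (hVV : V' ≤ V) (s : κ) (a : Sec B F E V),
      secRes B F E (inf_le_inf_right _ hVV) (loc V s a) = loc V' s (secRes B F E hVV a) := by
    intro V V' hVV s a
    exact (f s).2 ⟨V ⊓ W s, Set.mem_Iic.mpr inf_le_right⟩ ⟨V' ⊓ W s, Set.mem_Iic.mpr inf_le_right⟩ (inf_le_inf_right _ hVV) _
  have hcompat : ∀ (V : Opens M) (a : Sec B F E V) (s t) (x : M) (hV : x ∈ V) (hs : x ∈ W s)
      (ht : x ∈ W t), (loc V s a).val ⟨x, hV, hs⟩ = (loc V t a).val ⟨x, hV, ht⟩ := by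
    intro V a s t x hV hs ht
    let O : Opens M := V ⊓ (W s ⊓ W t)
    have e1 := (f s).2 ⟨V ⊓ W s, Set.mem_Iic.mpr inf_le_right⟩ ⟨O, Set.mem_Iic.mpr (inf_le_right.trans inf_le_left)⟩
      (inf_le_inf_left _ inf_le_left) (secRes B F E inf_le_left a)
    have e2 := (f t).2 ⟨V ⊓ W t, Set.mem_Iic.mpr inf_le_right⟩ ⟨O, Set.mem_Iic.mpr (inf_le_right.trans inf_le_right)⟩
      (inf_le_inf_left _ inf_le_right) (secRes B F E inf_le_left a)
    have e3 := congrArg (fun g : SheafEnd B F E (W s ⊓ W t) =>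
      g.app ⟨O, Set.mem_Iic.mpr inf_le_right⟩ (secRes B F E inf_le_left a)) (h s t)
    have e4 := e1.trans (e3.trans e2.symm)
    exact congrArg (fun c : Sec B F E O => c.val ⟨x, hV, hs, ht⟩) e4
  choose G hG using fun (V : Opens M) (a : Sec B F E V) =>
    exists_glue_sec (hV V) (fun s => loc V s a) (hcompat V a)
  let glued : ∀ V : Opens M, Module.End ℂ (Sec B F E V) := fun V =>
    { toFun := G V
      map_add' := fun a b => sec_ext_of_cover (hV V) fun s => by
        rw [map_add, hG, hG, hG, map_add]
      map_smul' := fun c a => sec_ext_of_cover (hV V) fun s => by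
        rw [map_smul, hG, hG, map_smul, RingHom.id_apply] }
  refine ⟨⟨fun V => glued V.1, fun V V' hVV a => sec_ext_of_cover (hV V'.1) fun s => ?_⟩, ?_⟩
  · change _ = secRes B F E inf_le_left (G V'.1 (secRes B F E hVV a))
    rw [hG, ← hloc, ← hG]
    rfl
  · intro s
    refine Subtype.ext (funext fun V => LinearMap.ext fun a => ?_)
    change G V.1 a = (f s).app V a
    -- Here V ∩ W_s equals V without being the same expression; restricting back along this
    -- inclusion avoids a transport between section spaces.
    have hVs : V.1 ≤ V.1 ⊓ W s := le_inf le_rfl V.2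
    have e1 := congrArg (secRes B F E hVs) (hG V.1 a s)
    exact e1.trans ((f s).2 ⟨V.1 ⊓ W s, Set.mem_Iic.mpr inf_le_right⟩ V hVs (secRes B F E inf_le_left a))

/-- Being a derivation of degree `2k` is a local property. -/
lemma mem_derDeg_of_local {κ : Type*} {W : κ → Opens M} (hW : ⨆ s, W s = ⊤) {k : ℕ}
    {g : SheafEnd B F E (⊤ : Opens M)}
    (h : ∀ s, endRes B F E (le_top : W s ≤ ⊤) g ∈ derDeg B F E k (W s)) :
    g ∈ derDeg B F E k (⊤ : Opens M) := by
  have hV : ∀ V : Opens M, V ≤ ⨆ s, W s := fun V => by rw [hW]; exact le_top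
  have hres : ∀ (V : Set.Iic (⊤ : Opens M)) (s : κ) (a : Sec B F E V.1),
      secRes B F E (inf_le_left : V.1 ⊓ W s ≤ V.1) (g.app V a) =
        (endRes B F E (le_top : W s ≤ ⊤) g).app ⟨V.1 ⊓ W s, Set.mem_Iic.mpr inf_le_right⟩
          (secRes B F E inf_le_left a) := fun V s a =>
    g.2 V ⟨V.1 ⊓ W s, Set.mem_Iic.mpr le_top⟩ inf_le_left a
  refine ⟨fun V a b => sec_ext_of_cover (hV V.1) fun s => ?_, fun V j a ha x => ?_⟩
  · rw [hres, map_mul, (h s).1, ← hres, ← hres, ← map_mul, ← map_mul, ← map_add]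
  · obtain ⟨s, hs⟩ := Opens.mem_iSup.mp (hV V.1 x.2)
    have e := (h s).2 ⟨V.1 ⊓ W s, Set.mem_Iic.mpr inf_le_right⟩ j (secRes B F E inf_le_left a)
      (fun y => ha ⟨y, y.2.1⟩) ⟨x, x.2, hs⟩
    rw [← hres] at e
    exact e

end Gluing

/-! ### Čech cochains in the direct limit, and vanishing of derivation-valued 0-cocycles -/

section CochainLemmas

variable (B : Type*) [NormedAddCommGroup B] [NormedSpace ℂ B]
  {M : Type*} [TopologicalSpace M] [ChartedSpace B M]
  (F : Type*) [NormedAddCommGroup F] [NormedSpace ℂ F] [FiniteDimensional ℂ F]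
  (E : M → Type*) [TopologicalSpace (TotalSpace F E)]
  [∀ x, AddCommGroup (E x)] [∀ x, Module ℂ (E x)] [∀ x, TopologicalSpace (E x)]
  [FiberBundle F E] [VectorBundle ℂ F E]

open IsGradingProj

section FixedCover

variable {ι : Type*} (𝒰 : ι → Opens M) {p : ℕ}

lemma isGradingProj_prAt (p : ℕ) :
    IsGradingProj (Module.finrank ℂ F) (fun k => prAt B F E 𝒰 k p) where
  pr_pr_self k x := funext fun s => (isGradingProj_endPr B F E _).pr_pr_self k (x s)
  pr_pr_ne k l x h := funext fun s => (isGradingProj_endPr B F E _).pr_pr_ne k l (x s) h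
  pr_mul k l x y := funext fun s => (isGradingProj_endPr B F E _).pr_mul k l (x s) (y s)
  pr_one := funext fun s => (isGradingProj_endPr B F E (inter 𝒰 s)).pr_one
  pr_eq_zero k x h := funext fun s => (isGradingProj_endPr B F E _).pr_eq_zero k (x s) h

variable {B F E 𝒰}

lemma mem_filt_prAt {q : ℕ} {x : CochAt B F E 𝒰 p} :
    x ∈ filt (Module.finrank ℂ F) (fun k => prAt B F E 𝒰 k p) q ↔
      ∀ s, x s ∈ filt (Module.finrank ℂ F) (fun k => endPr B F E k (inter 𝒰 s)) q := by
  simp only [mem_filt, funext_iff, Finset.sum_apply]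
  rfl

lemma mem_derPosAt {x : CochAt B F E 𝒰 p} :
    x ∈ derPosAt B F E 𝒰 p ↔ ∀ s, x s ∈ derPos B F E (inter 𝒰 s) := by
  simp [derPosAt, Submodule.mem_pi]

lemma mem_derDegAt {k : ℕ} {x : CochAt B F E 𝒰 p} :
    x ∈ derDegAt B F E 𝒰 k p ↔ ∀ s, x s ∈ derDeg B F E k (inter 𝒰 s) := by
  simp [derDegAt, Submodule.mem_pi]

lemma mem_autGAt {g : (CochAt B F E 𝒰 p)ˣ} :
    g ∈ autGAt B F E 𝒰 p ↔ ∀ s, Units.map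
      (Pi.evalMonoidHom (fun s => SheafEnd B F E (inter 𝒰 s)) s) g ∈ autG B F E (inter 𝒰 s) := by
  simp [autGAt, Subgroup.mem_iInf]

lemma derPosAt_mem_filt {x : CochAt B F E 𝒰 p} (hx : x ∈ derPosAt B F E 𝒰 p) :
    x ∈ filt (Module.finrank ℂ F) (fun k => prAt B F E 𝒰 k p) 1 :=
  mem_filt_prAt.mpr fun s => ((mem_derPos_iff B F E).mp (mem_derPosAt.mp hx s)).1

lemma prAt_mem_derDegAt {x : CochAt B F E 𝒰 p} (hx : x ∈ derPosAt B F E 𝒰 p) (k : ℕ) :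
    prAt B F E 𝒰 k p x ∈ derDegAt B F E 𝒰 k p :=
  mem_derDegAt.mpr fun s => endPr_mem_derDeg B F E k (derPos_derivation B F E (mem_derPosAt.mp hx s))

lemma nilExp_mem_autGAt {x : CochAt B F E 𝒰 p} (hx : x ∈ derPosAt B F E 𝒰 p) :
    ∃ g ∈ autGAt B F E 𝒰 p, (g : CochAt B F E 𝒰 p) = nilExp x := by
  have hn := (isGradingProj_prAt B F E 𝒰 p).isNilpotent (derPosAt_mem_filt hx)
  refine ⟨⟨nilExp x, nilExp (-x), nilExp_mul_nilExp_neg hn, nilExp_neg_mul_nilExp hn⟩,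
    mem_autGAt.mpr fun s => ?_, rfl⟩
  obtain ⟨g, hg, e⟩ := nilExp_mem_autG B F E (mem_derPosAt.mp hx s)
  convert hg
  refine Units.ext ?_
  rw [e]
  exact map_nilExp (Pi.evalAlgHom ℂ (fun s => SheafEnd B F E (inter 𝒰 s)) s) hn

lemma autGAt_sub_one_mem {g : (CochAt B F E 𝒰 p)ˣ} (hg : g ∈ autGAt B F E 𝒰 p) :
    (g : CochAt B F E 𝒰 p) - 1 ∈ filt (Module.finrank ℂ F) (fun k => prAt B F E 𝒰 k p) 1 :=
  mem_filt_prAt.mpr fun s => autG_sub_one_mem B F E (mem_autGAt.mp hg s)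

lemma nilLog_mem_derPosAt {g : (CochAt B F E 𝒰 p)ˣ} (hg : g ∈ autGAt B F E 𝒰 p) :
    nilLogOneAdd ((g : CochAt B F E 𝒰 p) - 1) ∈ derPosAt B F E 𝒰 p := by
  have hn := (isGradingProj_prAt B F E 𝒰 p).isNilpotent (autGAt_sub_one_mem hg)
  refine mem_derPosAt.mpr fun s => ?_
  have e := map_nilLog (Pi.evalAlgHom ℂ (fun s => SheafEnd B F E (inter 𝒰 s)) s) hn
  have h := nilLog_mem_derPos B F E (mem_autGAt.mp hg s)
  change Pi.evalAlgHom ℂ (fun s => SheafEnd B F E (inter 𝒰 s)) s (nilLogOneAdd (g.1 - 1)) ∈ _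
  rw [e]
  exact h

end FixedCover

variable (𝒮 : CoverSystem M) {p q : ℕ}

lemma pr_toCoch (k : ℕ) (i : 𝒮.Idx) (u : CochAt B F E (𝒮.cover i) p) :
    pr B F E 𝒮 k (toCoch B F E 𝒮 i p u) = toCoch B F E 𝒮 i p (prAt B F E (𝒮.cover i) k p u) :=
  rfl

lemma cover_anti {i j : 𝒮.Idx} (h : i ≤ j) : 𝒮.cover j ≤ 𝒮.cover i := h

lemma isGradingProj_pr (p : ℕ) :
    IsGradingProj (Module.finrank ℂ F) (fun k => pr B F E 𝒮 k (p := p)) where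
  pr_pr_self k x := by
    obtain ⟨i, u, -, rfl, -⟩ := exists_toCoch₂ B F E 𝒮 x x
    have h := (isGradingProj_prAt B F E (𝒮.cover i) p).pr_pr_self k u
    simp only [pr_toCoch, h]
  pr_pr_ne k l x hkl := by
    obtain ⟨i, u, -, rfl, -⟩ := exists_toCoch₂ B F E 𝒮 x x
    have h := (isGradingProj_prAt B F E (𝒮.cover i) p).pr_pr_ne k l u hkl
    simp only [pr_toCoch, h, map_zero]
  pr_mul k l x y := by
    obtain ⟨i, u, v, rfl, rfl⟩ := exists_toCoch₂ B F E 𝒮 x y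
    have h := (isGradingProj_prAt B F E (𝒮.cover i) p).pr_mul k l u v
    simp only [pr_toCoch, ← map_mul, h]
  pr_one := by
    have h := (isGradingProj_prAt B F E (𝒮.cover (Classical.arbitrary _)) p).pr_one
    rw [← map_one (toCoch B F E 𝒮 (Classical.arbitrary _) p), pr_toCoch, h]
  pr_eq_zero k x hk := by
    obtain ⟨i, u, -, rfl, -⟩ := exists_toCoch₂ B F E 𝒮 x x
    have h := (isGradingProj_prAt B F E (𝒮.cover i) p).pr_eq_zero k u hk
    simp only [pr_toCoch, h, map_zero]

variable {B F E 𝒮}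

lemma toCoch_mem_filt {n : ℕ} {i : 𝒮.Idx} {u : CochAt B F E (𝒮.cover i) p}
    (hu : u ∈ filt (Module.finrank ℂ F) (fun k => prAt B F E (𝒮.cover i) k p) n) :
    toCoch B F E 𝒮 i p u ∈ filt (Module.finrank ℂ F) (fun k => pr B F E 𝒮 k (p := p)) n := by
  rw [mem_filt] at hu ⊢
  simp only [pr_toCoch]
  rw [← map_sum, hu]

/-- The supremum is directed under refinement, hence a union: each element has a representative on a
single cover. -/
lemma mem_CDerPos {x : Coch B F E 𝒮 p} :
    x ∈ CDerPos B F E 𝒮 p ↔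
      ∃ i, ∃ u ∈ derPosAt B F E (𝒮.cover i) p, toCoch B F E 𝒮 i p u = x := by
  unfold CDerPos
  rw [Submodule.mem_iSup_of_directed]
  · rfl
  · refine Monotone.directed_le ?_
    rintro i j h _ ⟨u, hu, rfl⟩
    refine ⟨refineIdx B F E 𝒮 p i j h u, mem_derPosAt.mpr fun s => ?_, toCoch_refine B F E 𝒮 h p u⟩
    exact endRes_mem_derPos B F E (inter_mono (cover_anti 𝒮 h) s) (mem_derPosAt.mp hu s)

lemma mem_CDer {k : ℕ} {x : Coch B F E 𝒮 p} :
    x ∈ CDer B F E 𝒮 k p ↔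
      ∃ i, ∃ u ∈ derDegAt B F E (𝒮.cover i) k p, toCoch B F E 𝒮 i p u = x := by
  unfold CDer
  rw [Submodule.mem_iSup_of_directed]
  · rfl
  · refine Monotone.directed_le ?_
    rintro i j h _ ⟨u, hu, rfl⟩
    refine ⟨refineIdx B F E 𝒮 p i j h u, mem_derDegAt.mpr fun s => ?_, toCoch_refine B F E 𝒮 h p u⟩
    exact endRes_mem_derDeg B F E (inter_mono (cover_anti 𝒮 h) s) (mem_derDegAt.mp hu s)

lemma mem_CG {g : (Coch B F E 𝒮 p)ˣ} :
    g ∈ CG B F E 𝒮 p ↔ ∃ i, ∃ h ∈ autGAt B F E (𝒮.cover i) p,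
      Units.map (toCoch B F E 𝒮 i p : CochAt B F E (𝒮.cover i) p →* Coch B F E 𝒮 p) h = g := by
  unfold CG
  rw [Subgroup.mem_iSup_of_directed]
  · rfl
  · refine Monotone.directed_le ?_
    rintro i j h _ ⟨u, hu, rfl⟩
    refine ⟨Units.map (refineIdx B F E 𝒮 p i j h :
      CochAt B F E (𝒮.cover i) p →* CochAt B F E (𝒮.cover j) p) u,
      mem_autGAt.mpr fun s => ?_, Units.ext (toCoch_refine B F E 𝒮 h p u)⟩
    exact endRes_mem_autG B F E (inter_mono (cover_anti 𝒮 h) s) (mem_autGAt.mp hu s)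

lemma CDerPos_mem_filt {x : Coch B F E 𝒮 p} (hx : x ∈ CDerPos B F E 𝒮 p) :
    x ∈ filt (Module.finrank ℂ F) (fun k => pr B F E 𝒮 k (p := p)) 1 := by
  obtain ⟨i, u, hu, rfl⟩ := mem_CDerPos.mp hx
  exact toCoch_mem_filt (derPosAt_mem_filt hu)

lemma CDerPos_isNilpotent {x : Coch B F E 𝒮 p} (hx : x ∈ CDerPos B F E 𝒮 p) : IsNilpotent x :=
  (isGradingProj_pr B F E 𝒮 p).isNilpotent (CDerPos_mem_filt hx)

lemma pr_mem_CDer {x : Coch B F E 𝒮 p} (hx : x ∈ CDerPos B F E 𝒮 p) (k : ℕ) :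
    pr B F E 𝒮 k x ∈ CDer B F E 𝒮 k p := by
  obtain ⟨i, u, hu, rfl⟩ := mem_CDerPos.mp hx
  exact mem_CDer.mpr ⟨i, _, prAt_mem_derDegAt hu k, rfl⟩

lemma CDer_le_CDerPos {k : ℕ} (hk : 1 ≤ k) : CDer B F E 𝒮 k p ≤ CDerPos B F E 𝒮 p := by
  intro x hx
  obtain ⟨i, u, hu, rfl⟩ := mem_CDer.mp hx
  exact mem_CDerPos.mpr ⟨i, u, mem_derPosAt.mpr fun s =>
    derDeg_le_derPos B F E hk _ (mem_derDegAt.mp hu s), rfl⟩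

lemma prLE_apply (k : ℕ) (x : Coch B F E 𝒮 p) :
    prLE B F E 𝒮 k x = ∑ l ∈ Finset.Icc 1 k, pr B F E 𝒮 l x := by
  simp [prLE]

lemma prLE_mem_CDerPos {x : Coch B F E 𝒮 p} (hx : x ∈ CDerPos B F E 𝒮 p) (k : ℕ) :
    prLE B F E 𝒮 k x ∈ CDerPos B F E 𝒮 p := by
  rw [prLE_apply]
  exact sum_mem fun l hl => CDer_le_CDerPos (Finset.mem_Icc.mp hl).1 (pr_mem_CDer hx l)

lemma nilExp_mem_CG {x : Coch B F E 𝒮 p} (hx : x ∈ CDerPos B F E 𝒮 p) :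
    ∃ g ∈ CG B F E 𝒮 p, (g : Coch B F E 𝒮 p) = nilExp x := by
  obtain ⟨i, u, hu, rfl⟩ := mem_CDerPos.mp hx
  obtain ⟨g, hg, e⟩ := nilExp_mem_autGAt hu
  refine ⟨_, mem_CG.mpr ⟨i, g, hg, rfl⟩, ?_⟩
  rw [← map_nilExp (toCoch B F E 𝒮 i p)
    ((isGradingProj_prAt B F E _ p).isNilpotent (derPosAt_mem_filt hu)), ← e]
  rfl

lemma CG_sub_one_mem {g : (Coch B F E 𝒮 p)ˣ} (hg : g ∈ CG B F E 𝒮 p) :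
    (g : Coch B F E 𝒮 p) - 1 ∈ filt (Module.finrank ℂ F) (fun k => pr B F E 𝒮 k (p := p)) 1 := by
  obtain ⟨i, h, hh, rfl⟩ := mem_CG.mp hg
  have := toCoch_mem_filt (autGAt_sub_one_mem hh)
  rwa [map_sub, map_one] at this

lemma nilLog_mem_CDerPos {g : (Coch B F E 𝒮 p)ˣ} (hg : g ∈ CG B F E 𝒮 p) :
    nilLogOneAdd ((g : Coch B F E 𝒮 p) - 1) ∈ CDerPos B F E 𝒮 p := by
  obtain ⟨i, h, hh, rfl⟩ := mem_CG.mp hg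
  refine mem_CDerPos.mpr ⟨i, _, nilLog_mem_derPosAt hh, ?_⟩
  rw [map_nilLog (toCoch B F E 𝒮 i p)
    ((isGradingProj_prAt B F E _ p).isNilpotent (autGAt_sub_one_mem hh)), map_sub, map_one]
  rfl

lemma pullUnits_mem_CG (a : Fin (p + 1) → Fin (q + 1)) {g : (Coch B F E 𝒮 p)ˣ}
    (hg : g ∈ CG B F E 𝒮 p) : pullUnits B F E 𝒮 a g ∈ CG B F E 𝒮 q := by
  obtain ⟨i, h, hh, rfl⟩ := mem_CG.mp hg
  refine mem_CG.mpr ⟨i, Units.map (pullAt B F E (𝒮.cover i) a :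
    CochAt B F E (𝒮.cover i) p →* CochAt B F E (𝒮.cover i) q) h, mem_autGAt.mpr fun s => ?_,
    Units.ext rfl⟩
  exact endRes_mem_autG B F E (inter_comp_le _ a s) (mem_autGAt.mp hh (s ∘ a))

lemma pull_pull {n : ℕ} (b : Fin (q + 1) → Fin (n + 1)) (a : Fin (p + 1) → Fin (q + 1))
    (x : Coch B F E 𝒮 p) : pull B F E 𝒮 b (pull B F E 𝒮 a x) = pull B F E 𝒮 (b ∘ a) x := by
  obtain ⟨i, u, -, rfl, -⟩ := exists_toCoch₂ B F E 𝒮 x x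
  rfl

lemma pr_pull (a : Fin (p + 1) → Fin (q + 1)) (k : ℕ) (x : Coch B F E 𝒮 p) :
    pr B F E 𝒮 k (pull B F E 𝒮 a x) = pull B F E 𝒮 a (pr B F E 𝒮 k x) := by
  obtain ⟨i, u, -, rfl, -⟩ := exists_toCoch₂ B F E 𝒮 x x
  rfl

lemma pull_mem_filt (a : Fin (p + 1) → Fin (q + 1)) {n : ℕ} {x : Coch B F E 𝒮 p}
    (hx : x ∈ filt (Module.finrank ℂ F) (fun k => pr B F E 𝒮 k (p := p)) n) :
    pull B F E 𝒮 a x ∈ filt (Module.finrank ℂ F) (fun k => pr B F E 𝒮 k (p := q)) n := by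
  rw [mem_filt] at hx ⊢
  simp only [pr_pull]
  rw [← map_sum, hx]

/-- The cover used to define `constCoch` is arbitrary; two choices agree on a common refinement. -/
lemma constCoch_eq_toCoch (i : 𝒮.Idx) (f : SheafEnd B F E (⊤ : Opens M)) :
    constCoch B F E 𝒮 p f = toCoch B F E 𝒮 i p (constAt B F E (𝒮.cover i) p f) := by
  obtain ⟨j, h1, h2⟩ := exists_ge_ge (Classical.arbitrary 𝒮.Idx) i
  change toCoch B F E 𝒮 _ p _ = _
  rw [← toCoch_refine B F E 𝒮 h1, ← toCoch_refine B F E 𝒮 h2]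
  rfl

lemma pull_constCoch (a : Fin (p + 1) → Fin (q + 1)) (f : SheafEnd B F E (⊤ : Opens M)) :
    pull B F E 𝒮 a (constCoch B F E 𝒮 p f) = constCoch B F E 𝒮 q f :=
  rfl

/-- The action of an automorphism of the bundle on cochains, as an algebra homomorphism. -/
def actHom (φ : autE B F E (⊤ : Opens M)) (p : ℕ) : Coch B F E 𝒮 p →ₐ[ℂ] Coch B F E 𝒮 p where
  toFun := act B F E 𝒮 φ
  map_one' := by simp [act, ← map_mul]
  map_mul' x y := by
    have h : constCoch B F E 𝒮 p ((φ.1⁻¹ : (SheafEnd B F E ⊤)ˣ) : SheafEnd B F E ⊤) *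
        constCoch B F E 𝒮 p (φ.1 : SheafEnd B F E ⊤) = 1 := by simp [← map_mul]
    simp only [act, mul_assoc]
    rw [← mul_assoc _ (constCoch B F E 𝒮 p (φ.1 : SheafEnd B F E ⊤)), h, one_mul]
  map_zero' := by simp [act]
  map_add' x y := by simp [act, mul_add, add_mul]
  commutes' r := by
    simp only [act]
    rw [← Algebra.commutes, mul_assoc, ← map_mul]
    simp

lemma actHom_apply (φ : autE B F E (⊤ : Opens M)) (x : Coch B F E 𝒮 p) :
    actHom φ p x = act B F E 𝒮 φ x := rfl

lemma act_act_inv (φ : autE B F E (⊤ : Opens M)) (x : Coch B F E 𝒮 p) :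
    act B F E 𝒮 φ (act B F E 𝒮 φ⁻¹ x) = x := by
  have h : constCoch B F E 𝒮 p (φ.1 : SheafEnd B F E ⊤) *
      constCoch B F E 𝒮 p ((φ.1⁻¹ : (SheafEnd B F E ⊤)ˣ) : SheafEnd B F E ⊤) = 1 := by
    simp [← map_mul]
  simp only [act, InvMemClass.coe_inv, inv_inv]
  simp only [mul_assoc, h, mul_one]
  simp only [← mul_assoc, h, one_mul]

lemma act_one (x : Coch B F E 𝒮 p) : act B F E 𝒮 1 x = x := by
  simp [act]

lemma pull_act (a : Fin (p + 1) → Fin (q + 1)) (φ : autE B F E (⊤ : Opens M))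
    (x : Coch B F E 𝒮 p) :
    pull B F E 𝒮 a (act B F E 𝒮 φ x) = act B F E 𝒮 φ (pull B F E 𝒮 a x) := by
  simp only [act, map_mul, pull_constCoch]

lemma act_mem_CDer (φ : autE B F E (⊤ : Opens M)) {k : ℕ} {x : Coch B F E 𝒮 p}
    (hx : x ∈ CDer B F E 𝒮 k p) : act B F E 𝒮 φ x ∈ CDer B F E 𝒮 k p := by
  obtain ⟨i, u, hu, rfl⟩ := mem_CDer.mp hx
  refine mem_CDer.mpr ⟨i, constAt B F E _ p φ.1 * u *
    constAt B F E _ p ((φ.1⁻¹ : (SheafEnd B F E ⊤)ˣ) : SheafEnd B F E ⊤),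
    mem_derDegAt.mpr fun s => ?_, ?_⟩
  · exact conj_mem_derDeg B F E (endRes_mem_autE B F E le_top φ.2) (mem_derDegAt.mp hu s)
  · rw [act, constCoch_eq_toCoch i, constCoch_eq_toCoch i, map_mul, map_mul]

lemma act_mem_CDerPos (φ : autE B F E (⊤ : Opens M)) {x : Coch B F E 𝒮 p}
    (hx : x ∈ CDerPos B F E 𝒮 p) : act B F E 𝒮 φ x ∈ CDerPos B F E 𝒮 p := by
  rw [← mem_filt.mp (CDerPos_mem_filt hx), ← actHom_apply, map_sum]
  exact sum_mem fun k hk => CDer_le_CDerPos (Finset.mem_Icc.mp hk).1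
    (act_mem_CDer φ (pr_mem_CDer hx k))

/-- This is where H^0 = 0 enters: a derivation-valued 0-cocycle is a family of local derivations
agreeing on overlaps, so it glues to a global derivation. -/
lemma eq_zero_of_mem_CDer_of_d0 (hH0 : derPos B F E (⊤ : Opens M) = ⊥) {k : ℕ} (hk : 1 ≤ k)
    {x : Coch B F E 𝒮 0} (hx : x ∈ CDer B F E 𝒮 k 0) (hd : d0 B F E 𝒮 x = 0) : x = 0 := by
  obtain ⟨i, u, hu, rfl⟩ := mem_CDer.mp hx
  have e1 : toCoch B F E 𝒮 i 1 (pullAt B F E (𝒮.cover i) ![0] u) =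
      toCoch B F E 𝒮 i 1 (pullAt B F E (𝒮.cover i) ![1] u) := sub_eq_zero.mp hd
  -- Equality in the direct limit is equality of representatives after refinement to some cover j;
  -- the rest takes place on that cover.
  obtain ⟨j, h1, h2, e2⟩ := Quotient.eq.mp e1
  replace e2 : pullAt B F E (𝒮.cover j) ![0] (refineIdx B F E 𝒮 0 i j h1 u) =
      pullAt B F E (𝒮.cover j) ![1] (refineIdx B F E 𝒮 0 i j h1 u) := e2
  change i ≤ j at h1
  rw [← toCoch_refine B F E 𝒮 h1]
  have hw : ∀ s, refineIdx B F E 𝒮 0 i j h1 u s ∈ derDeg B F E k (inter (𝒮.cover j) s) :=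
    fun s => endRes_mem_derDeg B F E (inter_mono (cover_anti 𝒮 h1) s) (mem_derDegAt.mp hu s)
  set w := refineIdx B F E 𝒮 0 i j h1 u
  have hcov : ⨆ s : Fin 1 → 𝒮.ι, inter (𝒮.cover j) s = ⊤ := by
    refine eq_top_iff.mpr ?_
    rw [← 𝒮.isCover _ (OrderDual.ofDual j).2]
    refine iSup_le fun a => le_iSup_of_le (fun _ => a) (Finset.le_inf fun _ _ => le_rfl)
  obtain ⟨g, hg⟩ := exists_glue_end B F E hcov w fun s t => by
    have e3 := congrFun e2 ![s 0, t 0]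
    have hs : ![s 0, t 0] ∘ ![0] = s := by
      funext n
      rw [Subsingleton.elim n 0]
      rfl
    have ht : ![s 0, t 0] ∘ ![1] = t := by
      funext n
      rw [Subsingleton.elim n 0]
      rfl
    have hO : inter (𝒮.cover j) s ⊓ inter (𝒮.cover j) t ≤ inter (𝒮.cover j) ![s 0, t 0] := by
      refine Finset.le_inf fun n _ => ?_
      fin_cases n
      · exact inf_le_left.trans (Finset.inf_le (Finset.mem_univ 0))
      · exact inf_le_right.trans (Finset.inf_le (Finset.mem_univ 0))
    -- The type of `w s` depends on s, so the identities `hs` and `ht` between multi-indices cannot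
    -- be rewritten directly and are used by substitution.
    have key : ∀ (s' : Fin 1 → 𝒮.ι) (h : inter (𝒮.cover j) s ⊓ inter (𝒮.cover j) t ≤
        inter (𝒮.cover j) s') (s'' : Fin 1 → 𝒮.ι) (e : s'' = s') (h' : inter (𝒮.cover j) s ⊓
        inter (𝒮.cover j) t ≤ inter (𝒮.cover j) s''),
        endRes B F E h' (w s'') = endRes B F E h (w s') := by
      rintro s' h _ rfl h'
      rfl
    have e4 := congrArg (endRes B F E hO) e3
    exact (key s inf_le_left _ hs (hO.trans (inter_comp_le _ _ _))).symm.trans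
      (e4.trans (key t inf_le_right _ ht (hO.trans (inter_comp_le _ _ _))))
  have hg2 : g ∈ derDeg B F E k (⊤ : Opens M) :=
    mem_derDeg_of_local B F E hcov fun s => by rw [hg]; exact hw s
  have hg3 : g = 0 := by
    have := derDeg_le_derPos B F E hk _ hg2
    rwa [hH0, Submodule.mem_bot] at this
  have hw0 : w = 0 := funext fun s => by rw [← hg s, hg3, map_zero]; rfl
  rw [hw0, map_zero]

end CochainLemmas

/-! ### The action of 0-cochains on 1-cochains, and the set of logarithms of cocycles -/

section CocycleLemmas

variable {B : Type*} [NormedAddCommGroup B] [NormedSpace ℂ B]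
  {M : Type*} [TopologicalSpace M] [ChartedSpace B M]
  {F : Type*} [NormedAddCommGroup F] [NormedSpace ℂ F] [FiniteDimensional ℂ F]
  {E : M → Type*} [TopologicalSpace (TotalSpace F E)]
  [∀ x, AddCommGroup (E x)] [∀ x, Module ℂ (E x)] [∀ x, TopologicalSpace (E x)]
  [FiberBundle F E] [VectorBundle ℂ F E] {𝒮 : CoverSystem M} {p q : ℕ}

open IsGradingProj

variable (B F E 𝒮) in
/-- The cochains all of whose components have even degree at least `2q`. -/
abbrev cochFilt (p q : ℕ) : Submodule ℂ (Coch B F E 𝒮 p) :=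
  filt (Module.finrank ℂ F) (fun k => pr B F E 𝒮 k (p := p)) q

variable (B F E 𝒮) in
/-- The action `(h.x)_{ij} = h_i x_{ij} h_j⁻¹` of `0`-cochains on `1`-cochains. -/
def gact (h : (Coch B F E 𝒮 0)ˣ) : Coch B F E 𝒮 1 →ₗ[ℂ] Coch B F E 𝒮 1 :=
  LinearMap.mulRight ℂ (pull B F E 𝒮 ![1] (h⁻¹ : (Coch B F E 𝒮 0)ˣ).1) ∘ₗ
    LinearMap.mulLeft ℂ (pull B F E 𝒮 ![0] h.1)

lemma gact_apply (h : (Coch B F E 𝒮 0)ˣ) (x : Coch B F E 𝒮 1) :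
    gact B F E 𝒮 h x = pull B F E 𝒮 ![0] h.1 * x *
      pull B F E 𝒮 ![1] (h⁻¹ : (Coch B F E 𝒮 0)ˣ).1 := rfl

lemma gact_mul (h k : (Coch B F E 𝒮 0)ˣ) (x : Coch B F E 𝒮 1) :
    gact B F E 𝒮 (h * k) x = gact B F E 𝒮 h (gact B F E 𝒮 k x) := by
  simp only [gact_apply, mul_inv_rev, Units.val_mul, map_mul, mul_assoc]

lemma gact_one (x : Coch B F E 𝒮 1) : gact B F E 𝒮 1 x = x := by
  simp [gact_apply]

lemma gact_inv_gact (h : (Coch B F E 𝒮 0)ˣ) (x : Coch B F E 𝒮 1) :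
    gact B F E 𝒮 h⁻¹ (gact B F E 𝒮 h x) = x := by
  rw [← gact_mul, inv_mul_cancel, gact_one]

lemma gact_units_mem_CG {h : (Coch B F E 𝒮 0)ˣ} (hh : h ∈ CG B F E 𝒮 0)
    {g : (Coch B F E 𝒮 1)ˣ} (hg : g ∈ CG B F E 𝒮 1) :
    ∃ g' ∈ CG B F E 𝒮 1, (g' : Coch B F E 𝒮 1) = gact B F E 𝒮 h g :=
  ⟨pullUnits B F E 𝒮 ![0] h * g * (pullUnits B F E 𝒮 ![1] h)⁻¹,
    mul_mem (mul_mem (pullUnits_mem_CG _ hh) hg) (inv_mem (pullUnits_mem_CG _ hh)), rfl⟩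

/-- The product telescopes: inner factors h_j⁻¹h_j and h_k⁻¹h_k cancel, and the cocycle condition
leaves h_i h_i⁻¹. The identities `e1`, `e2`, `e3` match the vertices of consecutive edges. -/
lemma mulD_gact (h : (Coch B F E 𝒮 0)ˣ) {x : Coch B F E 𝒮 1} (hx : mulD B F E 𝒮 x = 1) :
    mulD B F E 𝒮 (gact B F E 𝒮 h x) = 1 := by
  have e1 : (![0, 1] ∘ ![1] : Fin 1 → Fin 3) = ![1, 2] ∘ ![0] := by decide
  have e2 : (![1, 2] ∘ ![1] : Fin 1 → Fin 3) = ![2, 0] ∘ ![0] := by decide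
  have e3 : (![2, 0] ∘ ![1] : Fin 1 → Fin 3) = ![0, 1] ∘ ![0] := by decide
  have hc : ∀ (a : Fin 1 → Fin 3) (y : Coch B F E 𝒮 2),
      pull B F E 𝒮 a (h⁻¹ : (Coch B F E 𝒮 0)ˣ).1 * (pull B F E 𝒮 a h.1 * y) = y := by
    intro a y
    rw [← mul_assoc, ← map_mul]
    simp
  have hc' : ∀ (a : Fin 1 → Fin 3),
      pull B F E 𝒮 a h.1 * pull B F E 𝒮 a (h⁻¹ : (Coch B F E 𝒮 0)ˣ).1 = 1 := by
    intro a
    rw [← map_mul]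
    simp
  unfold mulD at hx ⊢
  rw [mul_assoc] at hx
  simp only [gact_apply, map_mul, pull_pull, mul_assoc, e1, e2, e3, hc]
  simp only [← mul_assoc (pull B F E 𝒮 ![1, 2] x), ← mul_assoc (pull B F E 𝒮 ![0, 1] x)]
  rw [mul_assoc (pull B F E 𝒮 ![0, 1] x), hx, one_mul, hc']

lemma CG_mem_filt {g : (Coch B F E 𝒮 p)ˣ} (hg : g ∈ CG B F E 𝒮 p) :
    (g : Coch B F E 𝒮 p) ∈ cochFilt B F E 𝒮 p 0 :=
  (isGradingProj_pr B F E 𝒮 p).mem_zero_of_sub_one_mem (CG_sub_one_mem hg)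

lemma gact_mem_filt {h : (Coch B F E 𝒮 0)ˣ} (hh : h ∈ CG B F E 𝒮 0) {x : Coch B F E 𝒮 1}
    (hx : x ∈ cochFilt B F E 𝒮 1 q) : gact B F E 𝒮 h x ∈ cochFilt B F E 𝒮 1 q := by
  have hp := isGradingProj_pr B F E 𝒮 1
  exact hp.mul_mem_right (hp.mul_mem_left (pull_mem_filt _ (CG_mem_filt hh)) hx)
    (pull_mem_filt _ (CG_mem_filt (inv_mem hh)))

lemma gact_sub_self_mem_filt {h : (Coch B F E 𝒮 0)ˣ} (hh : h ∈ CG B F E 𝒮 0)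
    {x : Coch B F E 𝒮 1} (hx : x ∈ cochFilt B F E 𝒮 1 q) :
    gact B F E 𝒮 h x - x ∈ cochFilt B F E 𝒮 1 (q + 1) := by
  have hp := isGradingProj_pr B F E 𝒮 1
  have h1 := pull_mem_filt (q := 1) ![0] (CG_sub_one_mem hh)
  have h2 := pull_mem_filt (q := 1) ![1] (CG_sub_one_mem (inv_mem hh))
  have h3 := pull_mem_filt (q := 1) ![1] (CG_mem_filt (inv_mem hh))
  have e : gact B F E 𝒮 h x - x =
      pull B F E 𝒮 ![0] (h.1 - 1) * (x * pull B F E 𝒮 ![1] (h⁻¹ : (Coch B F E 𝒮 0)ˣ).1) +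
        x * pull B F E 𝒮 ![1] ((h⁻¹ : (Coch B F E 𝒮 0)ˣ).1 - 1) := by
    rw [gact_apply, map_sub, map_sub, map_one, map_one]
    noncomm_ring
  rw [e]
  exact add_mem (hp.mul_mem_succ h1 (hp.mul_mem_right hx h3)) (hp.mul_mem hx h2)

lemma pr_d0 (k : ℕ) (x : Coch B F E 𝒮 0) :
    pr B F E 𝒮 k (d0 B F E 𝒮 x) = d0 B F E 𝒮 (pr B F E 𝒮 k x) := by
  simp [d0, pr_pull]

lemma pr_d1 (k : ℕ) (x : Coch B F E 𝒮 1) :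
    pr B F E 𝒮 k (d1 B F E 𝒮 x) = d1 B F E 𝒮 (pr B F E 𝒮 k x) := by
  simp [d1, pr_pull]

lemma d0_mem_filt {x : Coch B F E 𝒮 0} (hx : x ∈ cochFilt B F E 𝒮 0 q) :
    d0 B F E 𝒮 x ∈ cochFilt B F E 𝒮 1 q :=
  sub_mem (pull_mem_filt _ hx) (pull_mem_filt _ hx)

/-- The action of a `0`-cochain close to `1`, to first order. -/
lemma gact_sub_sub_d0_mem {h : (Coch B F E 𝒮 0)ˣ} (hq : 1 ≤ q) (hh : h ∈ CG B F E 𝒮 0)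
    (h1 : h.1 - 1 ∈ cochFilt B F E 𝒮 0 q) {x : Coch B F E 𝒮 1}
    (hx : x - 1 ∈ cochFilt B F E 𝒮 1 1) :
    gact B F E 𝒮 h x - x - d0 B F E 𝒮 (h.1 - 1) ∈ cochFilt B F E 𝒮 1 (q + 1) := by
  have hp0 := isGradingProj_pr B F E 𝒮 0
  have hp := isGradingProj_pr B F E 𝒮 1
  set w : Coch B F E 𝒮 0 := (h⁻¹ : (Coch B F E 𝒮 0)ˣ).1 - 1 with hw
  have hinv : (h⁻¹ : (Coch B F E 𝒮 0)ˣ).1 * h.1 = 1 := h.inv_mul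
  have hw1 : w ∈ cochFilt B F E 𝒮 0 q := by
    have e : w = -((h⁻¹ : (Coch B F E 𝒮 0)ˣ).1 * (h.1 - 1)) := by
      rw [mul_sub, hinv, mul_one, neg_sub]
    rw [e]
    exact neg_mem (hp0.mul_mem_left (CG_mem_filt (inv_mem hh)) h1)
  -- From h⁻¹h = 1 one gets w + (h - 1) = -w(h - 1), so h⁻¹ - 1 is -(h - 1) to first order.
  have hw2 : w + (h.1 - 1) ∈ cochFilt B F E 𝒮 0 (q + 1) := by
    have e : w + (h.1 - 1) = -(w * (h.1 - 1)) := by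
      rw [hw, sub_mul, mul_sub, hinv]
      noncomm_ring
    rw [e]
    exact neg_mem (hp0.mul_mem_succ (hp0.filt_anti hq hw1) h1)
  -- All products on the right contain a second factor of positive degree; replacing w by -(h - 1)
  -- in the linear part produces `d0`.
  have e : gact B F E 𝒮 h x - x - d0 B F E 𝒮 (h.1 - 1) =
      pull B F E 𝒮 ![0] (h.1 - 1) * (x - 1) + (x - 1) * pull B F E 𝒮 ![1] w +
        pull B F E 𝒮 ![1] (w + (h.1 - 1)) +
        pull B F E 𝒮 ![0] (h.1 - 1) * (x * pull B F E 𝒮 ![1] w) := by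
    simp only [gact_apply, hw, d0, LinearMap.sub_apply, AlgHom.toLinearMap_apply, map_sub, map_add,
      map_one]
    noncomm_ring
  have hy := pull_mem_filt (q := 1) ![0] h1
  have hw' := pull_mem_filt (q := 1) ![1] hw1
  rw [e]
  refine add_mem (add_mem (add_mem (hp.mul_mem hy hx) (hp.mul_mem_succ hx hw'))
    (pull_mem_filt _ hw2)) ?_
  exact hp.mul_mem_succ (hp.filt_anti hq hy)
    (hp.mul_mem_left (hp.mem_zero_of_sub_one_mem hx) hw')

/-- The leading term of g - 1 equals that of log g, which is a derivation. -/
lemma pr_sub_one_mem_CDer {g : (Coch B F E 𝒮 p)ˣ} (hg : g ∈ CG B F E 𝒮 p)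
    (h : g.1 - 1 ∈ cochFilt B F E 𝒮 p q) : pr B F E 𝒮 q (g.1 - 1) ∈ CDer B F E 𝒮 q p := by
  have hp := isGradingProj_pr B F E 𝒮 p
  have h1 := hp.nilLog_sub_mem (q := q) (CG_sub_one_mem hg) (zero_mem _) (by rwa [sub_zero])
  have h2 := hp.pr_eq_zero_of_mem q.lt_succ_self h1
  rw [nilLog_zero, sub_zero, sub_zero, map_sub, sub_eq_zero] at h2
  rw [← h2]
  exact pr_mem_CDer (nilLog_mem_CDerPos hg) q

/-- If there are no global derivations, only `0`-cochains close to `1` fix a cocycle up to terms of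
high degree. -/
lemma sub_one_mem_of_gact (hH0 : derPos B F E (⊤ : Opens M) = ⊥) {h : (Coch B F E 𝒮 0)ˣ}
    (hh : h ∈ CG B F E 𝒮 0) {x : Coch B F E 𝒮 1} (hx : x - 1 ∈ cochFilt B F E 𝒮 1 1)
    (hs : gact B F E 𝒮 h x - x ∈ cochFilt B F E 𝒮 1 q) : h.1 - 1 ∈ cochFilt B F E 𝒮 0 q := by
  have hp0 := isGradingProj_pr B F E 𝒮 0
  have hp := isGradingProj_pr B F E 𝒮 1
  have key : ∀ n, n ≤ q → h.1 - 1 ∈ cochFilt B F E 𝒮 0 n := by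
    intro n
    induction n with
    | zero => exact fun _ => hp0.mem_zero (CG_sub_one_mem hh)
    | succ n ih =>
      intro hn
      rcases Nat.eq_zero_or_pos n with rfl | hpos
      · exact CG_sub_one_mem hh
      · have h1 := ih (by omega)
        have h2 := gact_sub_sub_d0_mem hpos hh h1 hx
        have h3 := sub_mem (hp.filt_anti hn hs) h2
        rw [sub_sub_cancel] at h3
        have h4 := hp.pr_eq_zero_of_mem n.lt_succ_self h3
        rw [pr_d0] at h4
        exact hp0.mem_succ_of_pr_eq_zero h1
          (eq_zero_of_mem_CDer_of_d0 hH0 hpos (pr_sub_one_mem_CDer hh h1) h4)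
  exact key q le_rfl

/-! ### The set `C̃^1` -/

lemma CTilde.mem (u : CTilde B F E 𝒮) : u.1 ∈ CDerPos B F E 𝒮 1 := u.2.1

lemma CTilde.mem_filt (u : CTilde B F E 𝒮) : u.1 ∈ cochFilt B F E 𝒮 1 1 := CDerPos_mem_filt u.mem

lemma CTilde.exp_sub_one_mem (u : CTilde B F E 𝒮) : nilExp u.1 - 1 ∈ cochFilt B F E 𝒮 1 1 :=
  (isGradingProj_pr B F E 𝒮 1).nilExp_sub_one_mem u.mem_filt u.mem_filt

lemma CTilde.mulD_exp (u : CTilde B F E 𝒮) : mulD B F E 𝒮 (nilExp u.1) = 1 := by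
  obtain ⟨g, hg⟩ := u.2.2
  rw [← hg]
  exact g.2.2

lemma exists_CTilde_of_mem {x : Coch B F E 𝒮 1} (hx : x ∈ CDerPos B F E 𝒮 1)
    (hm : mulD B F E 𝒮 (nilExp x) = 1) : ∃ u : CTilde B F E 𝒮, u.1 = x := by
  obtain ⟨g, hg, e⟩ := nilExp_mem_CG hx
  exact ⟨⟨x, hx, ⟨g, hg, by rw [e]; exact hm⟩, e⟩, rfl⟩

lemma exists_CTilde {g : (Coch B F E 𝒮 1)ˣ} (hg : g ∈ CG B F E 𝒮 1)
    (hm : mulD B F E 𝒮 g.1 = 1) :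
    ∃ u : CTilde B F E 𝒮, u.1 = nilLogOneAdd (g.1 - 1) ∧ nilExp u.1 = g.1 := by
  have h1 : nilExp (nilLogOneAdd (g.1 - 1)) = g.1 := by
    rw [nilExp_nilLog ((isGradingProj_pr B F E 𝒮 1).isNilpotent (CG_sub_one_mem hg))]
    abel
  obtain ⟨u, hu⟩ := exists_CTilde_of_mem (nilLog_mem_CDerPos hg) (by rw [h1]; exact hm)
  exact ⟨u, hu, by rw [hu, h1]⟩

lemma exists_CTilde_gact {h : (Coch B F E 𝒮 0)ˣ} (hh : h ∈ CG B F E 𝒮 0) (u : CTilde B F E 𝒮) :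
    ∃ u' : CTilde B F E 𝒮, u'.1 = nilLogOneAdd (gact B F E 𝒮 h (nilExp u.1) - 1) ∧
      nilExp u'.1 = gact B F E 𝒮 h (nilExp u.1) := by
  obtain ⟨g, hg, e⟩ := nilExp_mem_CG u.mem
  obtain ⟨g', hg', e'⟩ := gact_units_mem_CG hh hg
  rw [e] at e'
  rw [← e']
  exact exists_CTilde hg' (by rw [e']; exact mulD_gact h u.mulD_exp)

/-- Identifies exp(v).exp(u) with the action of a group element of C^0(M, G_E). -/
lemma expAct_eq_gact {v : Coch B F E 𝒮 0} (hv : v ∈ CDerPos B F E 𝒮 0) :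
    ∃ h ∈ CG B F E 𝒮 0, h.1 = nilExp v ∧
      ∀ u, expAct B F E 𝒮 v u = gact B F E 𝒮 h (nilExp u) := by
  obtain ⟨h, hh, e⟩ := nilExp_mem_CG hv
  refine ⟨h, hh, e, fun u => ?_⟩
  have e' : (h⁻¹ : (Coch B F E 𝒮 0)ˣ).1 = nilExp (-v) := by
    rw [Units.inv_eq_of_mul_eq_one_right (u := h) (a := nilExp (-v))]
    rw [e, nilExp_mul_nilExp_neg (CDerPos_isNilpotent hv)]
  rw [gact_apply, e, e']
  rfl

lemma exists_CTilde_act_lam (φ : autE B F E (⊤ : Opens M)) (v : CDerPos B F E 𝒮 0)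
    (u : CTilde B F E 𝒮) :
    ∃ w : CTilde B F E 𝒮, w.1 = act B F E 𝒮 φ (lam B F E 𝒮 v.1 u.1) := by
  obtain ⟨h, hh, -, e⟩ := expAct_eq_gact v.2
  obtain ⟨u', hu', -⟩ := exists_CTilde_gact hh u
  have e2 : lam B F E 𝒮 v.1 u.1 = u'.1 := by rw [lam, e, hu']
  rw [e2]
  refine exists_CTilde_of_mem (act_mem_CDerPos φ u'.mem) ?_
  rw [← actHom_apply, ← map_nilExp _ (CDerPos_isNilpotent u'.mem), actHom_apply]
  simp only [mulD, pull_act]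
  simp only [← actHom_apply, ← map_mul]
  exact (congrArg _ u'.mulD_exp).trans (map_one _)

end CocycleLemmas

/-! ### Normal forms, the choice of D, and injectivity -/

section Sigma

variable {B : Type*} [NormedAddCommGroup B] [NormedSpace ℂ B]
  {M : Type*} [TopologicalSpace M] [ChartedSpace B M]
  {F : Type*} [NormedAddCommGroup F] [NormedSpace ℂ F] [FiniteDimensional ℂ F]
  {E : M → Type*} [TopologicalSpace (TotalSpace F E)]
  [∀ x, AddCommGroup (E x)] [∀ x, Module ℂ (E x)] [∀ x, TopologicalSpace (E x)]
  [FiberBundle F E] [VectorBundle ℂ F E] {𝒮 : CoverSystem M} {p q : ℕ}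

open IsGradingProj

/-- Two elements of `C̃^1` define cocycles that are cohomologous up to terms of degree at least
`2q`. -/
def CohomologousMod (q : ℕ) (u u' : CTilde B F E 𝒮) : Prop :=
  ∃ h ∈ CG B F E 𝒮 0, gact B F E 𝒮 h (nilExp u.1) - nilExp u'.1 ∈ cochFilt B F E 𝒮 1 q

lemma CohomologousMod.of_sub_mem {u u' : CTilde B F E 𝒮}
    (h : nilExp u.1 - nilExp u'.1 ∈ cochFilt B F E 𝒮 1 q) : CohomologousMod q u u' :=
  ⟨1, one_mem _, by rwa [gact_one]⟩

lemma CohomologousMod.symm {u u' : CTilde B F E 𝒮} (h : CohomologousMod q u u') :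
    CohomologousMod q u' u := by
  obtain ⟨h, hh, hu⟩ := h
  refine ⟨h⁻¹, inv_mem hh, ?_⟩
  have := neg_mem (gact_mem_filt (inv_mem hh) hu)
  rwa [map_sub, gact_inv_gact, neg_sub] at this

lemma CohomologousMod.trans {u u' u'' : CTilde B F E 𝒮} (h : CohomologousMod q u u')
    (h' : CohomologousMod q u' u'') : CohomologousMod q u u'' := by
  obtain ⟨h, hh, hu⟩ := h
  obtain ⟨k, hk, hu'⟩ := h'
  refine ⟨k * h, mul_mem hk hh, ?_⟩
  have := add_mem (gact_mem_filt hk hu) hu'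
  rwa [map_sub, sub_add_sub_cancel, ← gact_mul] at this

variable (B F E 𝒮) in
/-- Cohomology up to terms of degree at least `2q`, as a setoid. -/
def cohomologousModSetoid (q : ℕ) : Setoid (CTilde B F E 𝒮) where
  r := CohomologousMod q
  iseqv := ⟨fun _ => .of_sub_mem (by rw [sub_self]; exact zero_mem _), .symm, .trans⟩

/-- Exponential and logarithm both preserve the filtration, so the condition `factor` on D can be
tested on cocycles. -/
lemma prLE_eq_iff (hq : 1 ≤ q) {u u' : CTilde B F E 𝒮} :
    prLE B F E 𝒮 (q - 1) u.1 = prLE B F E 𝒮 (q - 1) u'.1 ↔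
      nilExp u.1 - nilExp u'.1 ∈ cochFilt B F E 𝒮 1 q := by
  have hp := isGradingProj_pr B F E 𝒮 1
  rw [prLE_apply, prLE_apply, hp.sum_pr_eq_iff u.mem_filt u'.mem_filt, Nat.sub_add_cancel hq]
  exact ⟨hp.nilExp_sub_mem' u.mem_filt u'.mem_filt,
    hp.sub_mem_of_nilExp_sub_mem u.mem_filt u'.mem_filt⟩

/-- Every element of `C̃^1` can be changed in degrees at least `2q`, depending only on its
components of lower degree, in such a way that the cocycles of two elements become cohomologous
if they were so up to degree `2q`. -/
lemma exists_normalForm (hq : 1 ≤ q) : ∃ N : CTilde B F E 𝒮 → CTilde B F E 𝒮,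
    (q = 1 → ∀ u, (N u).1 = 0) ∧
    (∀ u, nilExp (N u).1 - nilExp u.1 ∈ cochFilt B F E 𝒮 1 q) ∧
    (∀ u u', nilExp u.1 - nilExp u'.1 ∈ cochFilt B F E 𝒮 1 q → N u = N u') ∧
    ∀ u u', CohomologousMod q u u' → ∃ h ∈ CG B F E 𝒮 0,
      nilExp (N u').1 = gact B F E 𝒮 h (nilExp (N u).1) := by
  rcases eq_or_ne q 1 with rfl | hq1
  -- All cocycles agree with exp(0) below degree 2, so 0 is an admissible normal form. It has to be
  -- this one, because D has no term D_2 that could absorb another.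
  · obtain ⟨u₀, h0⟩ := exists_CTilde_of_mem (zero_mem (CDerPos B F E 𝒮 1))
      (by simp [mulD])
    refine ⟨fun _ => u₀, fun _ _ => h0, fun u => ?_, fun _ _ _ => rfl,
      fun _ _ _ => ⟨1, one_mem _, (gact_one _).symm⟩⟩
    rw [h0, nilExp_zero, ← neg_sub]
    exact neg_mem u.exp_sub_one_mem
  · let S := cohomologousModSetoid B F E 𝒮 q
    let S' : Setoid (CTilde B F E 𝒮) := Setoid.ker fun u => prLE B F E 𝒮 (q - 1) u.1
    -- `rep` depends only on the class up to terms of degree at least 2q, `cut` only on the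
    -- components below degree 2q.
    let rep : CTilde B F E 𝒮 → CTilde B F E 𝒮 := fun u => (Quotient.mk S u).out
    let cut : CTilde B F E 𝒮 → CTilde B F E 𝒮 := fun u => (Quotient.mk S' u).out
    have hrep : ∀ u, CohomologousMod q (rep u) u := fun u =>
      Quotient.exact (s := S) (Quotient.out_eq _)
    have hcut : ∀ u, nilExp (cut u).1 - nilExp u.1 ∈ cochFilt B F E 𝒮 1 q := fun u =>
      (prLE_eq_iff hq).mp (Quotient.exact (s := S') (Quotient.out_eq _))
    -- Moving `rep w` by the 0-cochain that relates it to w below degree 2q keeps its exact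
    -- cohomology class and restores agreement with w.
    have hn : ∀ w, ∃ n : CTilde B F E 𝒮, (∃ h ∈ CG B F E 𝒮 0,
        nilExp n.1 = gact B F E 𝒮 h (nilExp (rep w).1)) ∧
        nilExp n.1 - nilExp w.1 ∈ cochFilt B F E 𝒮 1 q := by
      intro w
      obtain ⟨h, hh, hw⟩ := hrep w
      obtain ⟨n, -, hn⟩ := exists_CTilde_gact hh (rep w)
      exact ⟨n, ⟨h, hh, hn⟩, by rwa [hn]⟩
    choose n hn1 hn2 using hn
    refine ⟨fun u => n (cut u), fun h => absurd h hq1, fun u => ?_, fun u u' h => ?_,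
      fun u u' h => ?_⟩
    · simpa using add_mem (hn2 (cut u)) (hcut u)
    · have : cut u = cut u' := congrArg Quotient.out (Quotient.sound (s := S')
        ((prLE_eq_iff hq).mpr h))
      simp only [this]
    -- Both normal forms lie in the orbit of the same representative.
    · have hc : CohomologousMod q (cut u) (cut u') :=
        ((CohomologousMod.of_sub_mem (hcut u)).trans h).trans
          (CohomologousMod.of_sub_mem (hcut u')).symm
      have hr : rep (cut u) = rep (cut u') := congrArg Quotient.out (Quotient.sound (s := S) hc)
      obtain ⟨h1, hh1, e1⟩ := hn1 (cut u)
      obtain ⟨h2, hh2, e2⟩ := hn1 (cut u')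
      refine ⟨h2 * h1⁻¹, mul_mem hh2 (inv_mem hh1), ?_⟩
      rw [e1, e2, gact_mul, gact_inv_gact, hr]

/-- The comparison of two cohomologous cocycles with two cohomologous cocycles that agree with them
in degrees less than `2q`. -/
lemma exists_pr_sub_eq_d0 (hH0 : derPos B F E (⊤ : Opens M) = ⊥) (hq : 1 ≤ q)
    {u u' n n' : CTilde B F E 𝒮} {h k : (Coch B F E 𝒮 0)ˣ} (hh : h ∈ CG B F E 𝒮 0)
    (hk : k ∈ CG B F E 𝒮 0) (hu : nilExp u'.1 = gact B F E 𝒮 h (nilExp u.1))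
    (hn : nilExp n'.1 = gact B F E 𝒮 k (nilExp n.1))
    (h1 : nilExp n.1 - nilExp u.1 ∈ cochFilt B F E 𝒮 1 q)
    (h2 : nilExp n'.1 - nilExp u'.1 ∈ cochFilt B F E 𝒮 1 q) :
    ∃ y ∈ CDer B F E 𝒮 q 0, pr B F E 𝒮 q (u'.1 - n'.1) - pr B F E 𝒮 q (u.1 - n.1) =
      d0 B F E 𝒮 y := by
  have hp := isGradingProj_pr B F E 𝒮 1
  -- Below degree 2q, m = h⁻¹k fixes exp(n): k takes it to exp(n'), which agrees there with exp(u'),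
  -- and h⁻¹ takes that to exp(u), which agrees with exp(n).
  obtain ⟨m, hmk⟩ : ∃ m, m = h⁻¹ * k := ⟨_, rfl⟩
  have hm : m ∈ CG B F E 𝒮 0 := by rw [hmk]; exact mul_mem (inv_mem hh) hk
  have e : gact B F E 𝒮 m (nilExp n.1) - nilExp n.1 =
      gact B F E 𝒮 h⁻¹ (nilExp n'.1 - nilExp u'.1) - (nilExp n.1 - nilExp u.1) := by
    rw [hmk, gact_mul, ← hn, map_sub, hu, gact_inv_gact]
    abel
  have hs : m.1 - 1 ∈ cochFilt B F E 𝒮 0 q := by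
    refine sub_one_mem_of_gact hH0 hm n.exp_sub_one_mem ?_
    rw [e]
    exact sub_mem (gact_mem_filt (inv_mem hh) h2) h1
  have h3 := gact_sub_sub_d0_mem hq hm hs n.exp_sub_one_mem
  rw [e] at h3
  have h4 := gact_sub_self_mem_filt (inv_mem hh) h2
  have h5 := hp.nilExp_sub_mem n.mem_filt u.mem_filt
    (hp.sub_mem_of_nilExp_sub_mem n.mem_filt u.mem_filt h1)
  have h6 := hp.nilExp_sub_mem n'.mem_filt u'.mem_filt
    (hp.sub_mem_of_nilExp_sub_mem n'.mem_filt u'.mem_filt h2)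
  -- In degree 2q the change of exp(n) under m is `d0` of m - 1, the action of h⁻¹ is invisible, and
  -- differences of exponentials are differences of exponents.
  have h7 : (n'.1 - u'.1) - (n.1 - u.1) - d0 B F E 𝒮 (m.1 - 1) ∈
      cochFilt B F E 𝒮 1 (q + 1) := by
    convert add_mem (sub_mem (sub_mem h3 h4) h6) h5 using 1
    abel
  have h8 := hp.pr_eq_zero_of_mem q.lt_succ_self h7
  rw [map_sub, pr_d0, sub_eq_zero] at h8
  refine ⟨-pr B F E 𝒮 q (m.1 - 1), neg_mem (pr_sub_one_mem_CDer hm hs), ?_⟩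
  rw [map_neg, ← h8, ← map_sub, ← map_neg]
  congr 1
  abel

/-- If two cocycles agree up to degree `2q` and differ in degree `2q` by a coboundary, then they are
cohomologous up to terms of higher degree. -/
lemma cohomologousMod_succ_of_pr_sub (hq : 1 ≤ q) {u u' : CTilde B F E 𝒮}
    (h : nilExp u.1 - nilExp u'.1 ∈ cochFilt B F E 𝒮 1 q) {z : Coch B F E 𝒮 0}
    (hz : z ∈ CDer B F E 𝒮 q 0) (e : pr B F E 𝒮 q (u.1 - u'.1) = d0 B F E 𝒮 z) :
    CohomologousMod (q + 1) u u' := by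
  have hp := isGradingProj_pr B F E 𝒮 1
  have hp0 := isGradingProj_pr B F E 𝒮 0
  -- The 0-cochain sought is exp(-z): its first-order effect -d0(z) cancels the difference d0(z) in
  -- degree 2q.
  have hz1 := neg_mem (CDer_le_CDerPos hq hz)
  obtain ⟨k, hk, ek⟩ := nilExp_mem_CG hz1
  have hzq : -z ∈ cochFilt B F E 𝒮 0 q := by
    have hzz : pr B F E 𝒮 q z = z := by
      obtain ⟨i, w, hw, rfl⟩ := mem_CDer.mp hz
      rw [pr_toCoch]
      exact congrArg _ (funext fun s => endPr_of_mem_derDeg B F E (mem_derDegAt.mp hw s))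
    rw [← hzz]
    exact neg_mem (hp0.pr_mem le_rfl z)
  have h1 := hp0.nilExp_sub_mem (CDerPos_mem_filt hz1) (zero_mem _) (by rwa [sub_zero])
  rw [nilExp_zero, sub_zero, ← ek] at h1
  have hk1 : k.1 - 1 ∈ cochFilt B F E 𝒮 0 q := by
    rw [ek]
    exact hp0.nilExp_sub_one_mem (CDerPos_mem_filt hz1) hzq
  have h2 := gact_sub_sub_d0_mem hq hk hk1 u.exp_sub_one_mem
  have h3 := d0_mem_filt h1
  have hs := hp.sub_mem_of_nilExp_sub_mem u.mem_filt u'.mem_filt h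
  have h4 := hp.nilExp_sub_mem u.mem_filt u'.mem_filt hs
  have h5 := hp.sub_pr_mem hs
  rw [e] at h5
  refine ⟨k, hk, ?_⟩
  rw [map_sub, map_neg] at h3
  convert add_mem (add_mem h2 h3) (add_mem h4 h5) using 1
  abel

/-- The additive coboundary is the linearization of the multiplicative one. The two-factor estimate
`key` is used twice, for the product of three factors. -/
lemma mulD_sub_sub_d1_mem {x y : Coch B F E 𝒮 1} (hx : x - 1 ∈ cochFilt B F E 𝒮 1 1)
    (hy : y - 1 ∈ cochFilt B F E 𝒮 1 1) (h : x - y ∈ cochFilt B F E 𝒮 1 q) :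
    mulD B F E 𝒮 x - mulD B F E 𝒮 y - d1 B F E 𝒮 (x - y) ∈ cochFilt B F E 𝒮 2 (q + 1) := by
  have hp := isGradingProj_pr B F E 𝒮 2
  have key : ∀ a b c d : Coch B F E 𝒮 2, a - 1 ∈ cochFilt B F E 𝒮 2 1 →
      d - 1 ∈ cochFilt B F E 𝒮 2 1 → a - c ∈ cochFilt B F E 𝒮 2 q →
      b - d ∈ cochFilt B F E 𝒮 2 q →
      a * b - c * d - ((a - c) + (b - d)) ∈ cochFilt B F E 𝒮 2 (q + 1) := by
    intro a b c d ha hd hac hbd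
    have e : a * b - c * d - ((a - c) + (b - d)) = (a - 1) * (b - d) + (a - c) * (d - 1) := by
      noncomm_ring
    rw [e]
    exact add_mem (hp.mul_mem_succ ha hbd) (hp.mul_mem hac hd)
  have hmul : ∀ a b : Coch B F E 𝒮 2, a - 1 ∈ cochFilt B F E 𝒮 2 1 →
      b - 1 ∈ cochFilt B F E 𝒮 2 1 → a * b - 1 ∈ cochFilt B F E 𝒮 2 1 := by
    intro a b ha hb
    have e : a * b - 1 = a * (b - 1) + (a - 1) := by noncomm_ring
    rw [e]
    exact add_mem (hp.mul_mem_left (hp.mem_zero_of_sub_one_mem ha) hb) ha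
  have hP : ∀ (a : Fin 2 → Fin 3) (x : Coch B F E 𝒮 1), x - 1 ∈ cochFilt B F E 𝒮 1 1 →
      pull B F E 𝒮 a x - 1 ∈ cochFilt B F E 𝒮 2 1 := by
    intro a x hx
    have := pull_mem_filt a hx
    rwa [map_sub, map_one] at this
  have hD : ∀ a : Fin 2 → Fin 3,
      pull B F E 𝒮 a x - pull B F E 𝒮 a y ∈ cochFilt B F E 𝒮 2 q := by
    intro a
    rw [← map_sub]
    exact pull_mem_filt a h
  have k1 := key _ _ _ _ (hP ![0, 1] x hx) (hP ![1, 2] y hy) (hD _) (hD _)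
  have k1' : pull B F E 𝒮 ![0, 1] x * pull B F E 𝒮 ![1, 2] x -
      pull B F E 𝒮 ![0, 1] y * pull B F E 𝒮 ![1, 2] y ∈ cochFilt B F E 𝒮 2 q := by
    have := add_mem (hp.filt_anti q.le_succ k1) (add_mem (hD ![0, 1]) (hD ![1, 2]))
    rwa [sub_add_cancel] at this
  have k2 := key _ _ _ _ (hmul _ _ (hP ![0, 1] x hx) (hP ![1, 2] x hx)) (hP ![2, 0] y hy)
    k1' (hD _)
  convert add_mem k1 k2 using 1
  simp only [mulD, d1, LinearMap.add_apply, AlgHom.toLinearMap_apply, map_sub]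
  abel

lemma pr_one_eq_zero (hq : 1 ≤ q) : pr B F E 𝒮 q (1 : Coch B F E 𝒮 p) = 0 := by
  have hp := isGradingProj_pr B F E 𝒮 p
  rw [← hp.pr_one]
  exact hp.pr_pr_ne q 0 1 (by omega)

/-- Passing from u to its truncation below degree 2q changes 𝐝 exp(u), in degree 2q, by d of the
first omitted component, and 𝐝 exp(u) = Id has no component in that degree. -/
lemma R_eq_neg_d1 (hq : 1 ≤ q) (u : CTilde B F E 𝒮) :
    R B F E 𝒮 q u.1 = -d1 B F E 𝒮 (pr B F E 𝒮 q u.1) := by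
  have hp := isGradingProj_pr B F E 𝒮 1
  set t := prLE B F E 𝒮 (q - 1) u.1 with ht
  have hs : u.1 - t ∈ cochFilt B F E 𝒮 1 q := by
    have := hp.sub_sum_pr_mem u.mem_filt (q - 1)
    rwa [Nat.sub_add_cancel hq, ← prLE_apply] at this
  have ht1 : t ∈ cochFilt B F E 𝒮 1 1 := by
    rw [ht, prLE_apply]
    exact hp.sum_pr_mem _ _
  have hprt : pr B F E 𝒮 q t = 0 := by
    rw [ht, prLE_apply, map_sum]
    refine Finset.sum_eq_zero fun l hl => hp.pr_pr_ne _ _ _ ?_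
    have := (Finset.mem_Icc.mp hl).2
    omega
  have h1 := hp.nilExp_sub_mem u.mem_filt ht1 hs
  have h2 := mulD_sub_sub_d1_mem u.exp_sub_one_mem (hp.nilExp_sub_one_mem ht1 ht1)
    (hp.nilExp_sub_mem' u.mem_filt ht1 hs)
  have h3 := (isGradingProj_pr B F E 𝒮 2).pr_eq_zero_of_mem q.lt_succ_self h2
  have h4 := hp.pr_eq_zero_of_mem q.lt_succ_self h1
  rw [u.mulD_exp, map_sub, map_sub, pr_d1, pr_one_eq_zero hq, zero_sub] at h3
  rw [map_sub, sub_eq_zero, map_sub _ u.1, hprt, sub_zero] at h4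
  rw [h4] at h3
  rw [R, ← ht]
  exact neg_eq_iff_eq_neg.mp (sub_eq_zero.mp h3)

/-- The degree 2q component of a logarithm does not see terms of higher degree, and the truncation
discards the summand 1. -/
lemma pr_nilLog_prLE {g : Coch B F E 𝒮 1} (hg : g - 1 ∈ cochFilt B F E 𝒮 1 1) :
    pr B F E 𝒮 q (nilLogOneAdd (prLE B F E 𝒮 q g)) = pr B F E 𝒮 q (nilLogOneAdd (g - 1)) := by
  have hp := isGradingProj_pr B F E 𝒮 1
  have e : prLE B F E 𝒮 q g = ∑ l ∈ Finset.Icc 1 q, pr B F E 𝒮 l (g - 1) := by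
    rw [prLE_apply]
    refine Finset.sum_congr rfl fun l hl => ?_
    rw [map_sub, pr_one_eq_zero (Finset.mem_Icc.mp hl).1, sub_zero]
  have h := hp.nilLog_sub_mem' hg (hp.sum_pr_mem (g - 1) q) (hp.sub_sum_pr_mem hg q)
  have h2 := hp.pr_eq_zero_of_mem q.lt_succ_self h
  rw [map_sub, sub_eq_zero] at h2
  rw [e, h2]

/-- Truncations of derivations are derivations, so the untruncated product lies in G_E, though it
need not be a cocycle; its logarithm is a derivation. -/
lemma pr_nilLog_FMap_mem {v : Coch B F E 𝒮 0} (hv : v ∈ CDerPos B F E 𝒮 0)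
    {u : Coch B F E 𝒮 1} (hu : u ∈ CDerPos B F E 𝒮 1) :
    pr B F E 𝒮 q (nilLogOneAdd (FMap B F E 𝒮 q v u)) ∈ CDer B F E 𝒮 q 1 := by
  obtain ⟨h, hh, -, e⟩ := expAct_eq_gact (prLE_mem_CDerPos hv (q - 1))
  obtain ⟨g, hg, eg⟩ := nilExp_mem_CG (prLE_mem_CDerPos hu (q - 1))
  obtain ⟨g', hg', e'⟩ := gact_units_mem_CG hh hg
  rw [FMap, e, ← eg, ← e', pr_nilLog_prLE (CG_sub_one_mem hg')]
  exact pr_mem_CDer (nilLog_mem_CDerPos hg') q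

/-- For v = 0 the logarithm returns the truncation of u, which has no component of degree 2q. This
makes the continuation rule consistent at (Id, 0). -/
lemma pr_nilLog_FMap_zero (hq : 1 ≤ q) (u : CTilde B F E 𝒮) :
    pr B F E 𝒮 q (nilLogOneAdd (FMap B F E 𝒮 q 0 u.1)) = 0 := by
  have hp := isGradingProj_pr B F E 𝒮 1
  have ht : prLE B F E 𝒮 (q - 1) u.1 ∈ cochFilt B F E 𝒮 1 1 := by
    rw [prLE_apply]
    exact hp.sum_pr_mem _ _
  rw [FMap, map_zero, expAct, neg_zero, nilExp_zero, map_one, map_one, one_mul, mul_one,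
    pr_nilLog_prLE (hp.nilExp_sub_one_mem ht ht), nilLog_nilExp (hp.isNilpotent ht),
    prLE_apply, map_sum]
  refine Finset.sum_eq_zero fun l hl => hp.pr_pr_ne _ _ _ ?_
  have := (Finset.mem_Icc.mp hl).2
  omega

/-- The choice of the maps `D` determined by maps `D'` with the required properties. -/
lemma exists_DChoice (D' : ℕ → CTilde B F E 𝒮 → Coch B F E 𝒮 1)
    (mem : ∀ q, 2 ≤ q → ∀ u, D' q u ∈ CDer B F E 𝒮 q 1)
    (factor : ∀ q, 2 ≤ q → ∀ u u' : CTilde B F E 𝒮,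
      prLE B F E 𝒮 (q - 1) u.1 = prLE B F E 𝒮 (q - 1) u'.1 → D' q u = D' q u')
    (d_eq : ∀ q, 2 ≤ q → ∀ u, d1 B F E 𝒮 (D' q u) = R B F E 𝒮 q u.1) :
    ∃ D : DChoice B F E 𝒮, ∀ q, 2 ≤ q → ∀ u, D.D q 1 0 u = D' q u := by
  choose w hw using exists_CTilde_act_lam (B := B) (F := F) (E := E) (𝒮 := 𝒮)
  -- The continuation rule, solved for the value at (φ, v, u).
  let D : ℕ → autE B F E (⊤ : Opens M) → CDerPos B F E 𝒮 0 → CTilde B F E 𝒮 →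
      Coch B F E 𝒮 1 := fun q φ v u => act B F E 𝒮 φ⁻¹ (D' q (w φ v u) +
        pr B F E 𝒮 q (nilLogOneAdd (FMap B F E 𝒮 q (act B F E 𝒮 φ v.1) (act B F E 𝒮 φ u.1))))
  have hD : ∀ q, 2 ≤ q → ∀ u, D q 1 0 u = D' q u := by
    intro q hq u
    have e : w 1 0 u = u := by
      refine Subtype.ext ?_
      rw [hw, act_one, lam, expAct]
      simp only [ZeroMemClass.coe_zero, neg_zero, nilExp_zero, map_one, one_mul, mul_one]
      exact nilLog_nilExp (CDerPos_isNilpotent u.mem)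
    simp only [D, e, inv_one, act_one, ZeroMemClass.coe_zero]
    rw [pr_nilLog_FMap_zero (by omega), add_zero]
  refine ⟨⟨D, fun q hq φ v u => ?_, fun q hq u u' h => ?_, fun q hq u => ?_,
    fun q hq φ v u => ⟨w φ v u, hw φ v u, ?_⟩⟩, hD⟩
  · exact act_mem_CDer _ (add_mem (mem q hq _)
      (pr_nilLog_FMap_mem (act_mem_CDerPos φ v.2) (act_mem_CDerPos φ u.mem)))
  · rw [hD q hq, hD q hq, factor q hq u u' h]
  · rw [hD q hq, d_eq q hq]
  · rw [hD q hq, act_act_inv]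

lemma expCocycle_eq {u : CTilde B F E 𝒮} {g : ZG B F E 𝒮}
    (h : (g.1 : Coch B F E 𝒮 1) = nilExp u.1) : expCocycle B F E 𝒮 u = g :=
  Subtype.ext (Units.ext ((expCocycle_spec B F E 𝒮 u).trans h.symm))

lemma expCocycle_equiv_iff {u u' : CTilde B F E 𝒮} :
    cohomologous B F E 𝒮 (expCocycle B F E 𝒮 u) (expCocycle B F E 𝒮 u') ↔
      ∃ h ∈ CG B F E 𝒮 0, nilExp u'.1 = gact B F E 𝒮 h (nilExp u.1) := by
  rw [← expCocycle_spec, ← expCocycle_spec]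
  constructor
  · rintro ⟨h, hh, e⟩
    exact ⟨h, hh, congrArg Units.val e⟩
  · rintro ⟨h, hh, e⟩
    exact ⟨h, hh, Units.ext e⟩

lemma exists_CTilde_of_ZG (g : ZG B F E 𝒮) :
    ∃ u : CTilde B F E 𝒮, expCocycle B F E 𝒮 u = g := by
  obtain ⟨u, -, hu⟩ := exists_CTilde g.2.1 g.2.2
  exact ⟨u, expCocycle_eq hu.symm⟩

theorem exists_injective_sigma (𝒮 : CoverSystem M) (hH0 : derPos B F E (⊤ : Opens M) = ⊥) :
    ∃ (D : DChoice B F E 𝒮) (σ : HG B F E 𝒮 → HDer B F E 𝒮), D.IsSigma σ ∧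
      Function.Injective σ := by
  have hp := isGradingProj_pr B F E 𝒮 1
  -- The condition 1 ≤ q is moved inside the existential so that one choice covers all q; the value
  -- at q = 0 is a dummy.
  obtain ⟨N, hN⟩ := Classical.axiomOfChoice fun q : ℕ =>
    show ∃ N : CTilde B F E 𝒮 → CTilde B F E 𝒮, 1 ≤ q →
        (q = 1 → ∀ u, (N u).1 = 0) ∧
        (∀ u, nilExp (N u).1 - nilExp u.1 ∈ cochFilt B F E 𝒮 1 q) ∧
        (∀ u u', nilExp u.1 - nilExp u'.1 ∈ cochFilt B F E 𝒮 1 q → N u = N u') ∧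
        ∀ u u', CohomologousMod q u u' → ∃ h ∈ CG B F E 𝒮 0,
          nilExp (N u').1 = gact B F E 𝒮 h (nilExp (N u).1) by
      rcases Nat.eq_zero_or_pos q with rfl | hq
      · exact ⟨id, fun h => absurd h (by omega)⟩
      · obtain ⟨N, hN⟩ := exists_normalForm (B := B) (F := F) (E := E) (𝒮 := 𝒮) hq
        exact ⟨N, fun _ => hN⟩
  have hN1 := fun q hq => (hN q hq).1
  have hN2 := fun q hq => (hN q hq).2.1
  have hN3 := fun q hq => (hN q hq).2.2.1
  have hN4 := fun q hq => (hN q hq).2.2.2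
  -- R_{2q} is the same for u and for its normal form, which again lies in C̃^1.
  have hR : ∀ q, 1 ≤ q → ∀ u, R B F E 𝒮 q u.1 = -d1 B F E 𝒮 (pr B F E 𝒮 q (N q u).1) := by
    intro q hq u
    rw [← R_eq_neg_d1 hq, R, R, (prLE_eq_iff hq).mpr (hN2 q hq u)]
  obtain ⟨D, hD⟩ := exists_DChoice (fun q u => -pr B F E 𝒮 q (N q u).1)
    (fun q _ u => neg_mem (pr_mem_CDer (N q u).mem q))
    (fun q hq u u' h => by rw [hN3 q (by omega) u u' ((prLE_eq_iff (by omega)).mp h)])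
    (fun q hq u => by rw [map_neg, hR q (by omega)])
  let c : CTilde B F E 𝒮 → Coch B F E 𝒮 1 := fun u =>
    ∑ q ∈ Finset.Icc 1 (Module.finrank ℂ F), pr B F E 𝒮 q (u.1 - (N q u).1)
  have htotal : ∀ u, D.total 1 0 u + u.1 = c u := by
    intro u
    have h1 : D.total 1 0 u = ∑ q ∈ Finset.Icc 1 (Module.finrank ℂ F),
        -pr B F E 𝒮 q (N q u).1 := by
      rw [DChoice.total, Finset.sum_congr rfl fun q hq => hD q (Finset.mem_Icc.mp hq).1 u]
      -- Adding the term q = 1 is harmless because N_1 = 0.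
      refine Finset.sum_subset (Finset.Icc_subset_Icc_left one_le_two) fun q hq hq' => ?_
      have : q = 1 := by
        simp only [Finset.mem_Icc] at hq hq'
        omega
      rw [this, hN1 1 le_rfl rfl u, map_zero, neg_zero]
    conv_lhs => rw [h1, ← mem_filt.mp u.mem_filt]
    rw [← Finset.sum_add_distrib]
    exact Finset.sum_congr rfl fun q _ => by rw [map_sub]; abel
  have hz : ∀ u, c u ∈ ZDer B F E 𝒮 := by
    intro u
    refine ⟨sum_mem fun q hq => CDer_le_CDerPos (Finset.mem_Icc.mp hq).1
      (pr_mem_CDer (sub_mem u.mem (N q u).mem) q), ?_⟩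
    change d1 B F E 𝒮 (c u) = 0
    rw [map_sum]
    refine Finset.sum_eq_zero fun q hq => ?_
    have hq1 := (Finset.mem_Icc.mp hq).1
    rw [map_sub, map_sub, sub_eq_zero, ← neg_inj, ← R_eq_neg_d1 hq1, hR q hq1]
  -- Cohomologous cocycles have cohomologous degree 2q summands; this serves both well-definedness
  -- and injectivity.
  have hstep : ∀ q, 1 ≤ q → ∀ u u' : CTilde B F E 𝒮, ∀ h ∈ CG B F E 𝒮 0,
      nilExp u'.1 = gact B F E 𝒮 h (nilExp u.1) → ∃ y ∈ CDer B F E 𝒮 q 0,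
      pr B F E 𝒮 q (u'.1 - (N q u').1) - pr B F E 𝒮 q (u.1 - (N q u).1) = d0 B F E 𝒮 y := by
    intro q hq u u' h hh e
    obtain ⟨k, hk, ek⟩ := hN4 q hq u u' ⟨h, hh, by rw [e, sub_self]; exact zero_mem _⟩
    exact exists_pr_sub_eq_d0 hH0 hq hh hk e ek (hN2 q hq u) (hN2 q hq u')
  let cl : CTilde B F E 𝒮 → HDer B F E 𝒮 := fun u => Submodule.Quotient.mk ⟨c u, hz u⟩
  have hcl : ∀ u u', cl u = cl u' ↔ c u - c u' ∈ BDer B F E 𝒮 := by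
    intro u u'
    exact Submodule.Quotient.eq _
  choose τ hτ using exists_CTilde_of_ZG (B := B) (F := F) (E := E) (𝒮 := 𝒮)
  have hwd : ∀ u u', cohomologous B F E 𝒮 (expCocycle B F E 𝒮 u) (expCocycle B F E 𝒮 u') →
      cl u = cl u' := by
    intro u u' huu
    obtain ⟨h, hh, e⟩ := expCocycle_equiv_iff.mp huu
    rw [hcl, ← neg_mem_iff, neg_sub]
    simp only [c]
    rw [← Finset.sum_sub_distrib]
    refine sum_mem fun q hq => ?_
    obtain ⟨y, hy, ey⟩ := hstep q (Finset.mem_Icc.mp hq).1 u u' h hh e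
    rw [ey]
    exact ⟨y, CDer_le_CDerPos (Finset.mem_Icc.mp hq).1 hy, rfl⟩
  let σ : HG B F E 𝒮 → HDer B F E 𝒮 := Quotient.lift (fun g => cl (τ g)) fun g g' hg =>
    hwd _ _ (by rw [hτ, hτ]; exact hg)
  have hσ : ∀ u, σ ⟦expCocycle B F E 𝒮 u⟧ = cl u := fun u =>
    hwd _ _ (by rw [hτ])
  refine ⟨D, σ, ⟨fun u => ⟨by rw [htotal]; exact hz u, ?_⟩, fun x => ?_⟩, fun x x' hx => ?_⟩
  · rw [hσ]
    simp only [htotal, cl]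
  · induction x using Quotient.inductionOn with
    | _ g => exact ⟨τ g, by rw [hτ]⟩
  · induction x using Quotient.inductionOn with
    | _ g =>
    induction x' using Quotient.inductionOn with
    | _ g' =>
    rw [← hτ g, ← hτ g'] at hx ⊢
    generalize τ g = u at hx ⊢
    generalize τ g' = u' at hx ⊢
    rw [hσ, hσ, hcl] at hx
    obtain ⟨v, hv, ev⟩ := hx
    -- The q-th summand of c is homogeneous of degree 2q, so an equation of classes splits into one
    -- equation for each degree.
    have hpr : ∀ q ∈ Finset.Icc 1 (Module.finrank ℂ F),
        pr B F E 𝒮 q (u.1 - (N q u).1) - pr B F E 𝒮 q (u'.1 - (N q u').1) =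
          d0 B F E 𝒮 (pr B F E 𝒮 q v) := by
      intro q hq
      have hc : ∀ u, pr B F E 𝒮 q (c u) = pr B F E 𝒮 q (u.1 - (N q u).1) := by
        intro u
        simp only [c]
        rw [map_sum, Finset.sum_eq_single_of_mem q hq]
        · exact hp.pr_pr_self q _
        · intro l _ hl
          exact hp.pr_pr_ne q l _ (Ne.symm hl)
      rw [← hc, ← hc, ← map_sub, ← ev, pr_d0]
    have key : ∀ q, q ≤ Module.finrank ℂ F → CohomologousMod (q + 1) u u' := by
      intro q
      induction q with
      | zero =>
        intro _
        refine .of_sub_mem ?_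
        have := sub_mem u.exp_sub_one_mem u'.exp_sub_one_mem
        rwa [sub_sub_sub_cancel_right] at this
      | succ q ih =>
        intro hq
        have hq1 : 1 ≤ q + 1 := by omega
        obtain ⟨h, hh, hs⟩ := ih (by omega)
        obtain ⟨u'', -, e''⟩ := exists_CTilde_gact hh u
        rw [← e''] at hs
        obtain ⟨y, hy, ey⟩ := hstep (q + 1) hq1 u u'' h hh e''
        -- After the move by h both elements agree in lower degrees and share their normal form,
        -- which cancels from the difference of the summands.
        have hn : N (q + 1) u'' = N (q + 1) u' := hN3 _ hq1 _ _ hs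
        have hpq := hpr (q + 1) (Finset.mem_Icc.mpr ⟨hq1, hq⟩)
        have h2 : CohomologousMod (q + 1 + 1) u'' u' := by
          refine cohomologousMod_succ_of_pr_sub hq1 hs
            (add_mem hy (pr_mem_CDer hv (q + 1))) ?_
          rw [map_add, ← ey, ← hpq, hn]
          simp only [map_sub]
          abel
        refine CohomologousMod.trans ⟨h, hh, ?_⟩ h2
        rw [e'', sub_self]
        exact zero_mem _
    obtain ⟨h, hh, hs⟩ := key _ le_rfl
    -- Beyond the rank the filtration is zero, so cohomologous up to higher terms becomes
    -- cohomologous.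
    have h0 := sub_eq_zero.mp (filt_eq_zero (Nat.lt_succ_self _) hs)
    exact Quotient.sound (expCocycle_equiv_iff.mpr ⟨h, hh, h0.symm⟩)

end Sigma

end SplitSuper

end

/-- Both kinds of cohomology are direct limits over a `CoverSystem`, with a fixed cover as the
one-element system, so one argument serves both. -/
theorem mainTheorem2
    {B : Type*} [NormedAddCommGroup B] [NormedSpace ℂ B] [FiniteDimensional ℂ B]
    {M : Type*} [TopologicalSpace M] [ChartedSpace B M] [IsManifold 𝓘(ℂ, B) ω M]
    (F : Type*) [NormedAddCommGroup F] [NormedSpace ℂ F] [FiniteDimensional ℂ F]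
    (E : M → Type*) [TopologicalSpace (TotalSpace F E)]
    [∀ x, AddCommGroup (E x)] [∀ x, Module ℂ (E x)] [∀ x, TopologicalSpace (E x)]
    [FiberBundle F E] [VectorBundle ℂ F E] [ContMDiffVectorBundle ω F E 𝓘(ℂ, B)]
    (hH0 : SplitSuper.derPos B F E (⊤ : Opens M) = ⊥) :
    (∃ (D : SplitSuper.DChoice B F E (SplitSuper.CoverSystem.all M))
      (σ : SplitSuper.HG B F E (SplitSuper.CoverSystem.all M) →
        SplitSuper.HDer B F E (SplitSuper.CoverSystem.all M)),
      D.IsSigma σ ∧ Function.Injective σ) ∧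
    ∀ {ι : Type*} (𝒰 : ι → Opens M) (h𝒰 : ⨆ i, 𝒰 i = ⊤),
      ∃ (D : SplitSuper.DChoice B F E (SplitSuper.CoverSystem.single 𝒰 h𝒰))
        (σ : SplitSuper.HG B F E (SplitSuper.CoverSystem.single 𝒰 h𝒰) →
          SplitSuper.HDer B F E (SplitSuper.CoverSystem.single 𝒰 h𝒰)),
        D.IsSigma σ ∧ Function.Injective σ :=
  ⟨SplitSuper.exists_injective_sigma _ hH0,
    fun 𝒰 h𝒰 => SplitSuper.exists_injective_sigma (SplitSuper.CoverSystem.single 𝒰 h𝒰) hH0⟩
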